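/- Let $M$ be a matroid on a finite ground set $E=\{0,\dots,n-1\}$, with set of circuits $\mathcal C$ and set of cocircuits $\mathcal C^*$. A signed subset of $E$ is a pair $Z=(Z^+,Z^-)$ of disjoint subsets of $E$; put $-Z=(Z^-,Z^+)$ and $\underline Z=Z^+\cup Z^-$. Signed subsets $X,Y$ are orthogonal if $(X^+\cap Y^+)\cup(X^-\cap Y^-)\ne\varnothing \iff (X^+\cap Y^-)\cup(X^-\cap Y^+)\neq\varnothing$. A weak orientation of $M$ is a pair $(\mathscr O,\mathscr O^*)$ of collections of signed subsets of $E$, each closed under $Z\mapsto -Z$ and such that $\underline Z\subseteq\underline X$ implies $Z=\pm X$ for $X,Z$ in the same collection, with $\{\underline X: X\in\mathscr O\}=\mathcal C$ and $\{\underline Y: Y\in\mathscr O^*\}=\mathcal C^*$, such that $X$ and $Y$ are orthogonal whenever $X\in\mathscr O$, $Y\in\mathscr O^*$ and $|\underline X\cap\underline Y|=2$. The matroid $M$ is weakly orientable if it has a weak orientation. Take a variable $a_{e,X}\in\mathbb F_2$ for each $X\in\mathcal C$ and $e\in X$, and a variable $b_{e,Y}\in\mathbb F_2$ for each $Y\in\mathcal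 C^*$ and $e\in Y$. The Bland--Jensen system of $M$ consists of the equations $a_{e,X}+b_{e,Y}+a_{f,X}+b_{f,Y}+1=0$ over $\mathbb F_2$, for all $X\in\mathcal C$ and $Y\in\mathcal C^*$ with $X\cap Y=\{e,f\}$, $e\ne f$. An assignment $x$ of the variables determines the pair $(\mathscr O_x,\mathscr O_x^*)$, where $\mathscr O_x$ consists of the signed subsets $\pm(\{e\in X: a_{e,X}=0\},\{e\in X: a_{e,X}=1\})$, $X\in\mathcal C$, and $\mathscr O^*_x$ consists of the signed subsets $\pm(\{e\in Y: b_{e,Y}=0\},\{e\in Y: b_{e,Y}=1\})$, $Y\in\mathcal C^*$. **Theorem.** There is an algorithm (a deterministic multi-stack Turing machine) that, given any matroid $M$ on a ground set $\{0,\dots,n-1\}$, specified by lists (without repetition, in any order) of all its circuits and of all its cocircuits, each written as a $0/1$ characteristic vector, decides whether $M$ is weakly orientable, in a number of steps that is at most polynomial in the length of the input word. If $M$ is weakly orientable, the algorithm also outputs, within the same time bound, a solution $s$ of the Bland--Jensen system of $M$ and a basis $v_1,\dots,v_k$ of its null space (the solution space of the homogeneous system), and these describe all the weak orientations of $M$: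 $$\{(\mathscr O,\mathscr O^*) : (\mathscr O,\mathscr O^*)\text{ is a weak orientation of }M\}=\{(\mathscr O_x,\mathscr O_x^*) : x\in s+\operatorname{span}(v_1,\dots,v_k)\},$$ where $x,y\in s+\operatorname{span}(v_1,\dots,v_k)$ give the same weak orientation if and only if the difference $x-y$ is constant on the variables $a_{e,X}$ $(e\in X)$ of each circuit $X$ and constant on the variables $b_{e,Y}$ $(e\in Y)$ of each cocircuit $Y$. -/

import Mathlib

/-! ### Signed subsets and weak orientations of a matroid -/

/-- A signed subset of `α`: a pair of disjoint subsets, the positive and the negative part. -/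
@[ext]
structure SignedSubset (α : Type*) where
  pos : Set α
  neg : Set α
  disj : Disjoint pos neg

namespace SignedSubset

variable {α : Type*}

/-- The signed subset `-Z`, in which the two parts are exchanged. -/
def opp (Z : SignedSubset α) : SignedSubset α :=
  ⟨Z.neg, Z.pos, Z.disj.symm⟩

/-- The underlying set of a signed subset. -/
def supp (Z : SignedSubset α) : Set α :=
  Z.pos ∪ Z.neg

/-- Orthogonality: `X` and `Y` agree in sign on some element if and only if they disagree in
sign on some element. -/
def Orthogonal (X Y : SignedSubset α) : Prop :=
  ((X.pos ∩ Y.pos) ∪ (X.neg ∩ Y.neg)).Nonempty ↔ ((X.pos ∩ Y.neg) ∪ (X.neg ∩ Y.pos)).Nonempty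

/-- A collection of signed subsets that is closed under `Z ↦ -Z` and in which `Z ⊆ X` (as
underlying sets) holds only for `Z = ±X`. -/
def IsSignedClutter (O : Set (SignedSubset α)) : Prop :=
  (opp '' O = O) ∧ ∀ X ∈ O, ∀ Z ∈ O, Z.supp ⊆ X.supp → Z = X ∨ Z = X.opp

end SignedSubset

namespace Matroid

variable {α : Type*}

/-- `O` and `O'` are a signing of the circuits and the cocircuits of `M`. -/
def IsSigning (M : Matroid α) (O O' : Set (SignedSubset α)) : Prop :=
  SignedSubset.IsSignedClutter O ∧ SignedSubset.IsSignedClutter O' ∧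
    SignedSubset.supp '' O = {C | M.IsCircuit C} ∧
    SignedSubset.supp '' O' = {K | M.IsCocircuit K}

/-- `(O, O')` is a weak orientation of `M`: a signing of the circuits and the cocircuits for which
every signed circuit is orthogonal to every signed cocircuit that it meets in exactly two
elements. -/
def IsWeakOrientation (M : Matroid α) (O O' : Set (SignedSubset α)) : Prop :=
  M.IsSigning O O' ∧ ∀ X ∈ O, ∀ Y ∈ O', (X.supp ∩ Y.supp).ncard = 2 → X.Orthogonal Y

/-- A matroid is weakly orientable if it has a weak orientation. -/
def WeaklyOrientable (M : Matroid α) : Prop :=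
  ∃ O O' : Set (SignedSubset α), M.IsWeakOrientation O O'

/-! ### The Bland-Jensen linear system over the field with two elements -/

/-- The index of a variable `a_{e,X}`: a circuit `X` and an element `e ∈ X`. -/
structure CircuitVar (M : Matroid α) where
  elt : α
  set : Set α
  isCircuit : M.IsCircuit set
  mem : elt ∈ set

/-- The index of a variable `b_{e,Y}`: a cocircuit `Y` and an element `e ∈ Y`. -/
structure CocircuitVar (M : Matroid α) where
  elt : α
  set : Set α
  isCocircuit : M.IsCocircuit set
  mem : elt ∈ set

/-- The index set of all variables `a_{e,X}` and `b_{e,Y}`. -/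
abbrev BJVar (M : Matroid α) : Type _ :=
  M.CircuitVar ⊕ M.CocircuitVar

/-- An index of an equation: a circuit and a cocircuit that meet in exactly two elements `e`
and `f`. -/
structure BJEquation (M : Matroid α) where
  circuit : Set α
  cocircuit : Set α
  e : α
  f : α
  isCircuit : M.IsCircuit circuit
  isCocircuit : M.IsCocircuit cocircuit
  ne : e ≠ f
  inter_eq : circuit ∩ cocircuit = {e, f}

namespace BJEquation

variable {M : Matroid α}

theorem e_mem (q : M.BJEquation) : q.e ∈ q.circuit ∩ q.cocircuit := by
  rw [q.inter_eq]; exact Or.inl rfl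

theorem f_mem (q : M.BJEquation) : q.f ∈ q.circuit ∩ q.cocircuit := by
  rw [q.inter_eq]; exact Or.inr rfl

/-- The linear form `a_{e,X} + b_{e,Y} + a_{f,X} + b_{f,Y}`. -/
def linearForm (q : M.BJEquation) : (M.BJVar → ZMod 2) →ₗ[ZMod 2] ZMod 2 where
  toFun x :=
    x (Sum.inl ⟨q.e, q.circuit, q.isCircuit, q.e_mem.1⟩) +
    x (Sum.inr ⟨q.e, q.cocircuit, q.isCocircuit, q.e_mem.2⟩) +
    x (Sum.inl ⟨q.f, q.circuit, q.isCircuit, q.f_mem.1⟩) +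
    x (Sum.inr ⟨q.f, q.cocircuit, q.isCocircuit, q.f_mem.2⟩)
  map_add' x y := by simp only [Pi.add_apply]; ring
  map_smul' c x := by simp only [Pi.smul_apply, smul_eq_mul, RingHom.id_apply]; ring

end BJEquation

/-- The solutions of the Bland-Jensen system
`a_{e,X} + b_{e,Y} + a_{f,X} + b_{f,Y} + 1 = 0`, over all `X`, `Y` with `X ∩ Y = {e, f}`. -/
def bjSolutions (M : Matroid α) : Set (M.BJVar → ZMod 2) :=
  {x | ∀ q : M.BJEquation, q.linearForm x + 1 = 0}

/-- The null space of the Bland-Jensen system: the solutions of the homogeneous equations. -/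
def bjNullSpace (M : Matroid α) : Submodule (ZMod 2) (M.BJVar → ZMod 2) :=
  ⨅ q : M.BJEquation, LinearMap.ker q.linearForm

/-- The circuit `X` signed by `x`: `e ∈ X` is positive if `a_{e,X} = 0` and negative if
`a_{e,X} = 1`. -/
def signedCircuit (M : Matroid α) (x : M.BJVar → ZMod 2) (X : Set α) (hX : M.IsCircuit X) :
    SignedSubset α where
  pos := {e | ∃ h : e ∈ X, x (Sum.inl ⟨e, X, hX, h⟩) = 0}
  neg := {e | ∃ h : e ∈ X, x (Sum.inl ⟨e, X, hX, h⟩) = 1}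
  disj := by
    rw [Set.disjoint_left]
    rintro e ⟨h, h0⟩ ⟨_, h1⟩
    exact zero_ne_one (h0.symm.trans h1)

/-- The cocircuit `Y` signed by `x`: `e ∈ Y` is positive if `b_{e,Y} = 0` and negative if
`b_{e,Y} = 1`. -/
def signedCocircuit (M : Matroid α) (x : M.BJVar → ZMod 2) (Y : Set α) (hY : M.IsCocircuit Y) :
    SignedSubset α where
  pos := {e | ∃ h : e ∈ Y, x (Sum.inr ⟨e, Y, hY, h⟩) = 0}
  neg := {e | ∃ h : e ∈ Y, x (Sum.inr ⟨e, Y, hY, h⟩) = 1}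
  disj := by
    rw [Set.disjoint_left]
    rintro e ⟨h, h0⟩ ⟨_, h1⟩
    exact zero_ne_one (h0.symm.trans h1)

/-- The pair of collections of signed subsets given by `x`: all circuits and all cocircuits,
signed by `x`, and their opposites. -/
def signingOf (M : Matroid α) (x : M.BJVar → ZMod 2) :
    Set (SignedSubset α) × Set (SignedSubset α) :=
  ({Z | ∃ X, ∃ hX : M.IsCircuit X,
      Z = M.signedCircuit x X hX ∨ Z = (M.signedCircuit x X hX).opp},
   {Z | ∃ Y, ∃ hY : M.IsCocircuit Y,
      Z = M.signedCocircuit x Y hY ∨ Z = (M.signedCocircuit x Y hY).opp})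

/-- `x` and `y` differ, on each circuit and on each cocircuit, by a constant (that is, by
reversing all the signs of some circuits and cocircuits). -/
def SignEquivalent (M : Matroid α) (x y : M.BJVar → ZMod 2) : Prop :=
  (∀ i j : M.CircuitVar, i.set = j.set →
    x (Sum.inl i) - y (Sum.inl i) = x (Sum.inl j) - y (Sum.inl j)) ∧
  (∀ i j : M.CocircuitVar, i.set = j.set →
    x (Sum.inr i) - y (Sum.inr i) = x (Sum.inr j) - y (Sum.inr j))

/-- The data of a description of an affine space of assignments of the variables: one point and a
list of directions. -/
structure AffineDescription (M : Matroid α) where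
  particular : M.BJVar → ZMod 2
  basis : List (M.BJVar → ZMod 2)

/-- The point is a particular solution of the Bland-Jensen system, the directions form a basis of
its null space, the points `particular + v`, `v` in the span of the directions, give exactly the
weak orientations of `M`, and two such points give the same weak orientation exactly when they
are sign equivalent. -/
def AffineDescription.DescribesWeakOrientations {M : Matroid α} (d : M.AffineDescription) : Prop :=
  d.particular ∈ M.bjSolutions ∧
  LinearIndependent (ZMod 2) d.basis.get ∧
  Submodule.span (ZMod 2) {v | v ∈ d.basis} = M.bjNullSpace ∧
  {P : Set (SignedSubset α) × Set (SignedSubset α) | M.IsWeakOrientation P.1 P.2} =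
    {P | ∃ v ∈ Submodule.span (ZMod 2) {v | v ∈ d.basis}, P = M.signingOf (d.particular + v)} ∧
  ∀ v ∈ Submodule.span (ZMod 2) {v | v ∈ d.basis},
    ∀ w ∈ Submodule.span (ZMod 2) {v | v ∈ d.basis},
      (M.signingOf (d.particular + v) = M.signingOf (d.particular + w) ↔
        M.SignEquivalent (d.particular + v) (d.particular + w))

end Matroid

/-! ### Instances and answers as words -/

/-- The alphabet of the words that the machine reads and writes. -/
inductive TapeSymbol where
  | bit (b : Bool)
  | comma
  | semicolon
  deriving DecidableEq, Fintype

/-- An instance of the problem: a matroid with ground set `{0, …, n - 1}` together with a list of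
all its circuits and a list of all its cocircuits, each in an arbitrary order and without
repetitions. -/
structure MatroidInstance where
  n : ℕ
  M : Matroid (Fin n)
  ground_eq : M.E = Set.univ
  circuits : List (Finset (Fin n))
  circuits_nodup : circuits.Nodup
  mem_circuits : ∀ C : Finset (Fin n), C ∈ circuits ↔ M.IsCircuit (C : Set (Fin n))
  cocircuits : List (Finset (Fin n))
  cocircuits_nodup : cocircuits.Nodup
  mem_cocircuits : ∀ K : Finset (Fin n), K ∈ cocircuits ↔ M.IsCocircuit (K : Set (Fin n))

namespace MatroidInstance

/-- The `n` bits `b 0, …, b (n - 1)`, followed by a comma. -/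
def encodeRow {n : ℕ} (b : Fin n → Bool) : List TapeSymbol :=
  (List.finRange n).map (fun e => TapeSymbol.bit (b e)) ++ [TapeSymbol.comma]

/-- The input word. It lists the circuits and then the cocircuits, each as its characteristic
vector. -/
def encode (I : MatroidInstance) : List TapeSymbol :=
  I.circuits.flatMap (fun C => encodeRow fun e => decide (e ∈ C)) ++ [TapeSymbol.semicolon] ++
  I.cocircuits.flatMap (fun K => encodeRow fun e => decide (e ∈ K))

open Classical in
/-- An assignment of the variables as a word of the same shape as the input word: the bit for an
element `e` of the circuit `X` is the value `a_{e,X}`, the bit for an element `e` of the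
cocircuit `Y` is the value `b_{e,Y}`, and the bits for elements outside are `0`. -/
noncomputable def encodeVector (I : MatroidInstance) (x : I.M.BJVar → ZMod 2) : List TapeSymbol :=
  I.circuits.flatMap (fun C => encodeRow fun e =>
    decide (∃ i : I.M.CircuitVar, i.elt = e ∧ i.set = C ∧ x (Sum.inl i) = 1)) ++
  [TapeSymbol.semicolon] ++
  I.cocircuits.flatMap (fun K => encodeRow fun e =>
    decide (∃ i : I.M.CocircuitVar, i.elt = e ∧ i.set = K ∧ x (Sum.inr i) = 1))

/-- The output word. It is the single bit `0` for the answer no; for the answer yes it is the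
bit `1`, followed by the particular solution and the basis vectors, each ended by a semicolon. -/
noncomputable def encodeAnswer (I : MatroidInstance) :
    Option I.M.AffineDescription → List TapeSymbol
  | none => [TapeSymbol.bit false]
  | some d => TapeSymbol.bit true ::
      (d.particular :: d.basis).flatMap fun x => I.encodeVector x ++ [TapeSymbol.semicolon]

end MatroidInstance

/-! Choose for every circuit and cocircuit one of its two opposite signings and record the signs in
F₂. Two signed sets that meet exactly in {e, f} are orthogonal if and only if they agree at one of
these elements and disagree at the other, which is the equation a_e + b_e + a_f + b_f = 1
(`SignedSubset.orthogonal_ofFun_iff`). Reversing a signed set preserves orthogonality, so the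
choices do not matter: weak orientations are the solutions of the Bland-Jensen system, up to
constants on single circuits and cocircuits (`Matroid.isWeakOrientation_iff`,
`Matroid.signingOf_eq_iff`).

The system is homogenized: the constant 1 becomes one more coordinate. Starting from the standard
basis of the whole space, the basis is cut down to the kernel of one equation after another. The
first vector on which the form is 1 becomes the pivot, is added to the later vectors of this kind,
and is then discarded. What remains is a basis of the kernel, because the span and the number of
vectors, pivot included, are preserved (`reduce_spec`). A last round uses the constant term as the
form: the remaining vectors are a basis of the null space, the pivot is a particular solution, and
if there is no pivot the system is unsolvable (`Instance.exists_answer`).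

For an input word of length W there are never more than W + 1 vectors. Each has W + 1 bits, because
it is written in the shape of the input word after one bit for the constant term; the bits 1 of the
input word are the variables. There is one round at most for each pair of a circuit and a cocircuit,
so the time is polynomial (`go_mainProg`). The statements `Go p m m' t` record the effect and the
cost of a program and can be composed; `Runs.outputs` turns the final one into a machine
computation. `reduce_map` and `Instance.isBasisOf_pairStep` connect the bit strings with linear
algebra. -/

/-! ### Structured programs over finitely many stacks -/

namespace StackMachine

open Turing

variable {K Γ σ : Type}

/-- A store: the value of the internal state and the contents of the stacks. -/
abbrev Store (K Γ σ : Type) : Type := σ × (K → List Γ)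

/-- Straight-line code, to be run in one step of a machine. -/
inductive Op (K Γ σ : Type) : Type
  | push (k : K) (f : σ → Γ)
  | peek (k : K) (f : σ → Option Γ → σ)
  | pop (k : K) (f : σ → Option Γ → σ)
  | load (f : σ → σ)
  | andThen (a b : Op K Γ σ)

namespace Op

/-- The effect of straight-line code on a store. -/
def exec [DecidableEq K] : Op K Γ σ → Store K Γ σ → Store K Γ σ
  | push k f, s => (s.1, Function.update s.2 k (f s.1 :: s.2 k))
  | peek k f, s => (f s.1 (s.2 k).head?, s.2)
  | pop k f, s => (f s.1 (s.2 k).head?, Function.update s.2 k (s.2 k).tail)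
  | load f, s => (f s.1, s.2)
  | andThen a b, s => b.exec (a.exec s)

/-- The machine statement that runs straight-line code and continues with `q`. -/
def toStmt {Λ : Type} : Op K Γ σ → TM2.Stmt (fun _ : K => Γ) Λ σ → TM2.Stmt (fun _ : K => Γ) Λ σ
  | push k f, q => .push k f q
  | peek k f, q => .peek k f q
  | pop k f, q => .pop k f q
  | load f, q => .load f q
  | andThen a b, q => a.toStmt (b.toStmt q)

theorem stepAux_toStmt [DecidableEq K] {Λ : Type} (o : Op K Γ σ)
    (q : TM2.Stmt (fun _ : K => Γ) Λ σ) (s : Store K Γ σ) :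
    TM2.stepAux (o.toStmt q) s.1 s.2 = TM2.stepAux q (o.exec s).1 (o.exec s).2 := by
  induction o generalizing q s with
  | andThen a b iha ihb => rw [toStmt, iha, ihb, exec]
  | _ => rfl

end Op

/-- Structured programs: straight-line code, sequences, conditionals and loops. The loop
`loop o c p` runs `o`, stops if the condition `c` fails, and otherwise runs `p` and starts again. -/
inductive Prog (K Γ σ : Type) : Type
  | op (o : Op K Γ σ)
  | seq (p q : Prog K Γ σ)
  | ite (c : σ → Bool) (p q : Prog K Γ σ)
  | loop (o : Op K Γ σ) (c : σ → Bool) (p : Prog K Γ σ)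

namespace Prog

/-- The control points of a program. -/
def Label : Prog K Γ σ → Type
  | op _ => Unit
  | seq p q => p.Label ⊕ q.Label
  | ite _ p q => Option (p.Label ⊕ q.Label)
  | loop _ _ p => Option p.Label

instance fintypeLabel : (p : Prog K Γ σ) → Fintype p.Label
  | op _ => inferInstanceAs (Fintype Unit)
  | seq p q =>
    haveI := fintypeLabel p
    haveI := fintypeLabel q
    inferInstanceAs (Fintype (p.Label ⊕ q.Label))
  | ite _ p q =>
    haveI := fintypeLabel p
    haveI := fintypeLabel q
    inferInstanceAs (Fintype (Option (p.Label ⊕ q.Label)))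
  | loop _ _ p =>
    haveI := fintypeLabel p
    inferInstanceAs (Fintype (Option p.Label))

/-- The control point at which a program starts. -/
def entry : (p : Prog K Γ σ) → p.Label
  | op _ => ()
  | seq p _ => Sum.inl p.entry
  | ite _ _ _ => none
  | loop _ _ _ => none

/-- The machine code of a program whose control points are embedded in the labels `Λ` of a
machine, and which ends by a jump to the label `exit`. -/
def code {Λ : Type} : (p : Prog K Γ σ) → (p.Label → Λ) → Λ → p.Label →
    TM2.Stmt (fun _ : K => Γ) Λ σ
  | op o, _, exit, _ => o.toStmt (.goto fun _ => exit)
  | seq p q, emb, _, Sum.inl l => p.code (fun l => emb (Sum.inl l)) (emb (Sum.inr q.entry)) l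
  | seq _ q, emb, exit, Sum.inr l => q.code (fun l => emb (Sum.inr l)) exit l
  | ite c p q, emb, _, none =>
    .branch c (.goto fun _ => emb (some (Sum.inl p.entry)))
      (.goto fun _ => emb (some (Sum.inr q.entry)))
  | ite _ p _, emb, exit, some (Sum.inl l) => p.code (fun l => emb (some (Sum.inl l))) exit l
  | ite _ _ q, emb, exit, some (Sum.inr l) => q.code (fun l => emb (some (Sum.inr l))) exit l
  | loop o c p, emb, exit, none =>
    o.toStmt (.branch c (.goto fun _ => emb (some p.entry)) (.goto fun _ => exit))
  | loop _ _ p, emb, _, some l => p.code (fun l => emb (some l)) (emb none) l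

end Prog

variable [DecidableEq K]

/-- Within `t` steps, every machine that contains the code of `p` gets from the store `s` at the
entry of `p` to the store `s'` at the exit. -/
def Runs (p : Prog K Γ σ) (s s' : Store K Γ σ) (t : ℕ) : Prop :=
  ∀ (Λ : Type) (m : Λ → TM2.Stmt (fun _ : K => Γ) Λ σ) (emb : p.Label → Λ) (exit : Λ),
    (∀ l, m (emb l) = p.code emb exit l) →
      ∃ n ≤ t, (flip bind (TM2.step m))^[n] (some ⟨some (emb p.entry), s.1, s.2⟩) =
        some ⟨some exit, s'.1, s'.2⟩

/-! ### Step counts of composed programs -/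

namespace Runs

variable {p q : Prog K Γ σ} {o : Op K Γ σ} {c : σ → Bool} {s s' s'' : Store K Γ σ} {t t' : ℕ}

theorem mono (h : Runs p s s' t) (ht : t ≤ t') : Runs p s s' t' := fun Λ m emb exit hm =>
  let ⟨n, hn, e⟩ := h Λ m emb exit hm
  ⟨n, hn.trans ht, e⟩

theorem op (o : Op K Γ σ) (s : Store K Γ σ) : Runs (.op o) s (o.exec s) 1 := by
  intro Λ m emb exit hm
  refine ⟨1, le_rfl, ?_⟩
  have h := hm ()
  simp only [Function.iterate_one, flip, Option.bind_eq_bind, Option.bind_some, TM2.step,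
    Prog.entry, h, Prog.code, Op.stepAux_toStmt, TM2.stepAux]

/-- Since `Runs` speaks of every machine that contains the code, both halves can be read in the same
machine; the exit label of `p` is the entry label of `q`. -/
theorem seq (h : Runs p s s' t) (h' : Runs q s' s'' t') : Runs (.seq p q) s s'' (t + t') := by
  intro Λ m emb exit hm
  obtain ⟨n, hn, e⟩ := h Λ m (fun l => emb (Sum.inl l)) (emb (Sum.inr q.entry))
    fun l => hm (Sum.inl l)
  obtain ⟨n', hn', e'⟩ := h' Λ m (fun l => emb (Sum.inr l)) exit fun l => hm (Sum.inr l)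
  refine ⟨n' + n, by omega, ?_⟩
  rw [Function.iterate_add_apply]
  exact (congrArg _ e).trans e'

theorem ite_true (hc : c s.1 = true) (h : Runs p s s' t) : Runs (.ite c p q) s s' (t + 1) := by
  intro Λ m emb exit hm
  obtain ⟨n, hn, e⟩ := h Λ m (fun l => emb (some (Sum.inl l))) exit
    fun l => hm (some (Sum.inl l))
  refine ⟨n + 1, by omega, ?_⟩
  have h0 := hm none
  rw [Function.iterate_add_apply, ← e]
  simp only [Function.iterate_one, flip, Option.bind_eq_bind, Option.bind_some, TM2.step,
    Prog.entry, h0, Prog.code, TM2.stepAux, hc, cond_true]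

theorem ite_false (hc : c s.1 = false) (h : Runs q s s' t) :
    Runs (.ite c p q) s s' (t + 1) := by
  intro Λ m emb exit hm
  obtain ⟨n, hn, e⟩ := h Λ m (fun l => emb (some (Sum.inr l))) exit
    fun l => hm (some (Sum.inr l))
  refine ⟨n + 1, by omega, ?_⟩
  have h0 := hm none
  rw [Function.iterate_add_apply, ← e]
  simp only [Function.iterate_one, flip, Option.bind_eq_bind, Option.bind_some, TM2.step,
    Prog.entry, h0, Prog.code, TM2.stepAux, hc, cond_false]

theorem loop_done (hc : c (o.exec s).1 = false) : Runs (.loop o c p) s (o.exec s) 1 := by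
  intro Λ m emb exit hm
  refine ⟨1, le_rfl, ?_⟩
  have h0 := hm none
  simp only [Function.iterate_one, flip, Option.bind_eq_bind, Option.bind_some, TM2.step,
    Prog.entry, h0, Prog.code, Op.stepAux_toStmt, TM2.stepAux, hc, cond_false]

/-- The body exits to the label `none` of the loop itself, so the remaining rounds are a run of the
same loop in the same machine. The extra step is the test. -/
theorem loop_step (hc : c (o.exec s).1 = true) (h : Runs p (o.exec s) s' t)
    (h' : Runs (.loop o c p) s' s'' t') : Runs (.loop o c p) s s'' (t + t' + 1) := by
  intro Λ m emb exit hm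
  obtain ⟨n, hn, e⟩ := h Λ m (fun l => emb (some l)) (emb none) fun l => hm (some l)
  obtain ⟨n', hn', e'⟩ := h' Λ m emb exit hm
  refine ⟨n' + (n + 1), by omega, ?_⟩
  have h0 := hm none
  rw [Function.iterate_add_apply, Function.iterate_add_apply, ← e']
  refine congrArg _ (Eq.trans ?_ e)
  simp only [Function.iterate_one, flip, Option.bind_eq_bind, Option.bind_some, TM2.step,
    Prog.entry, h0, Prog.code, Op.stepAux_toStmt, TM2.stepAux, hc, cond_true]

end Runs

/-- The machine that runs a program and then halts. All its stacks have the finite alphabet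
`Γ`. -/
def Prog.machine [Fintype K] [Fintype Γ] [Fintype σ] (p : Prog K Γ σ) (k₀ k₁ : K) (v : σ) :
    FinTM2 where
  K := K
  k₀ := k₀
  k₁ := k₁
  Γ _ := Γ
  Λ := Option p.Label
  main := some p.entry
  σ := σ
  initialState := v
  Γk₀Fin := ‹_›
  m
    | some l => p.code some none l
    | none => .halt

/-- The store in which the stack `k` has content `w` and all other stacks are empty. -/
def single (v : σ) (k : K) (w : List Γ) : Store K Γ σ :=
  (v, Function.update (fun _ => []) k w)

theorem single_self (v : σ) (k : K) (w : List Γ) : (single v k w).2 k = w :=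
  by simp [single]

theorem single_of_ne (v : σ) {k k' : K} (w : List Γ) (h : k' ≠ k) : (single v k w).2 k' = [] :=
  by simp [single, h]

/-- A halting configuration must carry the initial internal state and have all stacks but the output
stack empty, hence the form of the final store. The step added to `t` executes `halt` at the label
`none`. -/
theorem Runs.outputs {p : Prog K Γ σ} {t : ℕ} [Fintype K] [Fintype Γ] [Fintype σ] {k₀ k₁ : K} {v : σ} {w w' : List Γ}
    (h : Runs p (single v k₀ w) (single v k₁ w') t) :
    Nonempty (TM2OutputsInTime (p.machine k₀ k₁ v) w (some w') (t + 1)) := by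
  obtain ⟨n, hn, e⟩ := h _ (p.machine k₀ k₁ v).m some none fun l => rfl
  have h1 : initList (p.machine k₀ k₁ v) w =
      ⟨some (some p.entry), (single v k₀ w).1, (single v k₀ w).2⟩ := by
    refine congrArg (TM2.Cfg.mk _ _) (funext fun (k : K) => ?_)
    by_cases hk : k = k₀
    · subst hk
      exact (dif_pos rfl).trans (single_self v k _).symm
    · exact (dif_neg hk).trans (single_of_ne v _ hk).symm
  have h2 : haltList (p.machine k₀ k₁ v) w' =
      ⟨none, (single v k₁ w').1, (single v k₁ w').2⟩ := by
    refine congrArg (TM2.Cfg.mk _ _) (funext fun (k : K) => ?_)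
    by_cases hk : k = k₁
    · subst hk
      exact (dif_pos rfl).trans (single_self v k _).symm
    · exact (dif_neg hk).trans (single_of_ne v _ hk).symm
  have e1 : (flip bind (p.machine k₀ k₁ v).step)^[1 + n]
      (some (initList (p.machine k₀ k₁ v) w)) = some (haltList (p.machine k₀ k₁ v) w') := by
    rw [Function.iterate_add_apply, h1, h2]
    exact congrArg (flip bind (p.machine k₀ k₁ v).step) e
  exact ⟨⟨⟨1 + n, e1⟩, (by omega : 1 + n ≤ t + 1)⟩⟩

end StackMachine

/-! ### The memory of the machine -/

namespace BlandJensenMachine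

open StackMachine

/-- The finite internal state: two symbol registers, two flags and a counter. -/
structure Reg where
  cur : Option TapeSymbol
  aux : Option TapeSymbol
  par : Bool
  piv : Bool
  cnt : Fin 4
  deriving Fintype

/-- The initial internal state. -/
def Reg.init : Reg := ⟨none, none, false, false, 0⟩

/-- The names of the stacks. -/
inductive Stack where
  | inp | out | l1 | r1 | x | l2 | r2 | y | e | z | b | nb | p | v | t | t2
  deriving DecidableEq

instance : Fintype Stack where
  elems := {.inp, .out, .l1, .r1, .x, .l2, .r2, .y, .e, .z, .b, .nb, .p, .v, .t, .t2}
  complete k := by cases k <;> decide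

/-- The memory: the internal state and the contents of the stacks. -/
@[ext]
structure Mem where
  reg : Reg
  inp : List TapeSymbol
  out : List TapeSymbol
  l1 : List TapeSymbol
  r1 : List TapeSymbol
  x : List TapeSymbol
  l2 : List TapeSymbol
  r2 : List TapeSymbol
  y : List TapeSymbol
  e : List TapeSymbol
  z : List TapeSymbol
  b : List TapeSymbol
  nb : List TapeSymbol
  p : List TapeSymbol
  v : List TapeSymbol
  t : List TapeSymbol
  t2 : List TapeSymbol

namespace Mem

/-- The content of a stack. -/
def get (m : Mem) : Stack → List TapeSymbol
  | .inp => m.inp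
  | .out => m.out
  | .l1 => m.l1
  | .r1 => m.r1
  | .x => m.x
  | .l2 => m.l2
  | .r2 => m.r2
  | .y => m.y
  | .e => m.e
  | .z => m.z
  | .b => m.b
  | .nb => m.nb
  | .p => m.p
  | .v => m.v
  | .t => m.t
  | .t2 => m.t2

/-- The memory with the content of one stack replaced. -/
def set (m : Mem) (k : Stack) (l : List TapeSymbol) : Mem :=
  match k with
  | .inp => { m with inp := l }
  | .out => { m with out := l }
  | .l1 => { m with l1 := l }
  | .r1 => { m with r1 := l }
  | .x => { m with x := l }
  | .l2 => { m with l2 := l }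
  | .r2 => { m with r2 := l }
  | .y => { m with y := l }
  | .e => { m with e := l }
  | .z => { m with z := l }
  | .b => { m with b := l }
  | .nb => { m with nb := l }
  | .p => { m with p := l }
  | .v => { m with v := l }
  | .t => { m with t := l }
  | .t2 => { m with t2 := l }

/-- The memory as a store of the machine. -/
def toStore (m : Mem) : Store Stack TapeSymbol Reg := (m.reg, m.get)

theorem get_set (m : Mem) (k j : Stack) (l : List TapeSymbol) :
    (m.set k l).get j = if j = k then l else m.get j := by
  split_ifs with h
  · subst h; cases j <;> rfl
  · cases k <;> cases j <;> first | rfl | exact absurd rfl h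

theorem reg_set (m : Mem) (k : Stack) (l : List TapeSymbol) : (m.set k l).reg = m.reg := by
  cases k <;> rfl

theorem toStore_set (m : Mem) (k : Stack) (l : List TapeSymbol) :
    (m.set k l).toStore = (m.reg, Function.update m.get k l) := by
  refine Prod.ext (reg_set m k l) (funext fun j => ?_)
  by_cases h : j = k
  · subst h
    simp [toStore, get_set]
  · simp [toStore, get_set, h]

theorem ext_get {m m' : Mem} (h : m.reg = m'.reg) (h' : ∀ k, m.get k = m'.get k) : m = m' :=
  Mem.ext h (h' .inp) (h' .out) (h' .l1) (h' .r1) (h' .x) (h' .l2) (h' .r2) (h' .y) (h' .e)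
    (h' .z) (h' .b) (h' .nb) (h' .p) (h' .v) (h' .t) (h' .t2)

/-- The effect of straight-line code on the memory. -/
def exec (m : Mem) : Op Stack TapeSymbol Reg → Mem
  | .push k f => m.set k (f m.reg :: m.get k)
  | .peek k f => { m with reg := f m.reg (m.get k).head? }
  | .pop k f => { m.set k (m.get k).tail with reg := f m.reg (m.get k).head? }
  | .load f => { m with reg := f m.reg }
  | .andThen a b => (m.exec a).exec b

/-- Because of this agreement, the effect of programs can be computed field by field on a record
instead of on an updated function. -/
theorem toStore_exec (m : Mem) (o : Op Stack TapeSymbol Reg) :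
    (m.exec o).toStore = o.exec m.toStore := by
  induction o generalizing m with
  | push k f => exact toStore_set _ _ _
  | peek k f => rfl
  | pop k f =>
    exact congrArg (fun s : Store Stack TapeSymbol Reg => (f m.reg (m.get k).head?, s.2))
      (toStore_set m k (m.get k).tail)
  | load f => rfl
  | andThen a b iha ihb => rw [exec, ihb, iha]; rfl

end Mem

/-- Programs on the memory. -/
abbrev Program : Type := Prog Stack TapeSymbol Reg

/-- Straight-line code on the memory. -/
abbrev Code : Type := Op Stack TapeSymbol Reg

/-- The program `p` leads from the memory `m` to the memory `m'` in at most `t` steps. -/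
def Go (p : Program) (m m' : Mem) (t : ℕ) : Prop :=
  Runs p m.toStore m'.toStore t

namespace Go

variable {p q : Program} {o : Code} {c : Reg → Bool} {m m' m'' : Mem} {t t' : ℕ}

theorem congr (h : Go p m m' t) (hm : m' = m'') (ht : t ≤ t') : Go p m m'' t' :=
  hm ▸ Runs.mono h ht

theorem pre {m₀ : Mem} (hm : m₀ = m) (h : Go p m m' t) : Go p m₀ m' t :=
  hm ▸ h

theorem op (o : Code) (m : Mem) : Go (.op o) m (m.exec o) 1 := by
  rw [Go, Mem.toStore_exec]; exact Runs.op o _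

theorem seq (h : Go p m m' t) (h' : Go q m' m'' t') : Go (.seq p q) m m'' (t + t') :=
  Runs.seq h h'

theorem ite_true (hc : c m.reg = true) (h : Go p m m' t) : Go (.ite c p q) m m' (t + 1) :=
  Runs.ite_true hc h

theorem ite_false (hc : c m.reg = false) (h : Go q m m' t) : Go (.ite c p q) m m' (t + 1) :=
  Runs.ite_false hc h

theorem loop_done (hc : c (m.exec o).reg = false) : Go (.loop o c p) m (m.exec o) 1 := by
  have h := Mem.toStore_exec m o
  rw [Go, h]
  exact Runs.loop_done (by rw [← h]; exact hc)

theorem loop_step (hc : c (m.exec o).reg = true) (h : Go p (m.exec o) m' t)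
    (h' : Go (.loop o c p) m' m'' t') : Go (.loop o c p) m m'' (t + t' + 1) := by
  have e := Mem.toStore_exec m o
  rw [Go, e] at h
  exact Runs.loop_step (by rw [← e]; exact hc) h h'

end Go

/-! ### Basic programs -/

/-- Pop a stack into the first register. -/
def popCur (k : Stack) : Code := .pop k fun r a => { r with cur := a }

/-- Pop a stack into the second register. -/
def popAux (k : Stack) : Code := .pop k fun r a => { r with aux := a }

/-- Read the top of a stack into the first register. -/
def peekCur (k : Stack) : Code := .peek k fun r a => { r with cur := a }

/-- Push the image under `g` of the symbol in the first register. -/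
def pushCur (k : Stack) (g : TapeSymbol → TapeSymbol) : Code :=
  .push k fun r => g (r.cur.getD .comma)

/-- Push the symbol in the second register. -/
def pushAux (k : Stack) : Code := .push k fun r => r.aux.getD .comma

/-- Push a fixed symbol. -/
def put (k : Stack) (a : TapeSymbol) : Code := .push k fun _ => a

/-- The first register is not empty. -/
def hasCur (r : Reg) : Bool := r.cur.isSome

/-- The first register contains a bit. -/
def curBit (r : Reg) : Bool :=
  match r.cur with
  | some (.bit _) => true
  | _ => false

/-- The constant bit `0`. -/
def zeroBit (_ : TapeSymbol) : TapeSymbol := .bit false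

/-- Run straight-line code for each symbol of a stack, which is consumed. -/
def drain (k : Stack) (o : Code) : Program := .loop (popCur k) hasCur (.op o)

/-- Move the symbols of stack `k`, mapped by `g`, to stack `d`, in reversed order. -/
def move (k d : Stack) (g : TapeSymbol → TapeSymbol) : Program := drain k (pushCur d g)

/-- Push the symbols of stack `k`, mapped by `g`, to stack `d`, in reversed order, and keep them
on stack `k`; stack `w` is auxiliary. -/
def copy (k w d : Stack) (g : TapeSymbol → TapeSymbol) : Program :=
  .seq (drain k (.andThen (pushCur w id) (pushCur d g))) (move w k id)

/-- Empty a stack. -/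
def clear (k : Stack) : Program := drain k (.load id)

/-- Move a string of bits to stack `d`, in reversed order, and drop the symbol that ends it. -/
def readRow (k d : Stack) : Program := .loop (popCur k) curBit (.op (pushCur d id))

/-- The memory with a new value of the first register. -/
def Mem.setCur (m : Mem) (a : Option TapeSymbol) : Mem := { m with reg := { m.reg with cur := a } }

/-! ### Effect and cost of the basic programs -/

theorem Mem.get_setCur (m : Mem) (a : Option TapeSymbol) (k : Stack) :
    (m.setCur a).get k = m.get k := by
  cases k <;> rfl

theorem Mem.exec_popCur (m : Mem) (k : Stack) :
    m.exec (popCur k) = (m.setCur (m.get k).head?).set k (m.get k).tail := by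
  cases k <;> rfl

theorem Mem.exec_pushCur (m : Mem) (k : Stack) (g : TapeSymbol → TapeSymbol) :
    m.exec (pushCur k g) = m.set k (g (m.reg.cur.getD .comma) :: m.get k) :=
  rfl

theorem Mem.reg_setCur (m : Mem) (a : Option TapeSymbol) :
    (m.setCur a).reg = { m.reg with cur := a } :=
  rfl

theorem Mem.exec_load_id (m : Mem) : m.exec (.load id) = m :=
  rfl

/-- Each symbol costs two steps, the test with its pop and the push. The failing test at the end
costs one more and leaves `none` in the register. -/
theorem go_move (k d : Stack) (g : TapeSymbol → TapeSymbol) (m : Mem) (hkd : k ≠ d) :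
    Go (move k d g) m (((m.setCur none).set k []).set d (((m.get k).map g).reverse ++ m.get d))
      (2 * (m.get k).length + 1) := by
  generalize hl : m.get k = l
  induction l generalizing m with
  | nil =>
    have e : m.exec (popCur k) = (m.setCur none).set k [] := by rw [Mem.exec_popCur, hl]; rfl
    refine Go.congr (Go.loop_done (by rw [e, Mem.reg_set]; rfl)) ?_ le_rfl
    rw [e]
    refine Mem.ext_get (by simp only [Mem.reg_set]) fun j => ?_
    simp only [Mem.get_set, Mem.get_setCur]
    by_cases hd : j = d
    · subst hd; simp [hkd.symm]
    · simp [hd]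
  | cons a l ih =>
    have e : m.exec (popCur k) = (m.setCur (some a)).set k l := by rw [Mem.exec_popCur, hl]; rfl
    refine Go.congr (Go.loop_step (by rw [e, Mem.reg_set]; rfl) (Go.op _ _) (ih _ ?_)) ?_
      (by simp only [List.length_cons]; omega)
    · simp [e, Mem.exec_pushCur, Mem.get_set, hkd]
    · rw [e]
      refine Mem.ext_get (by simp only [Mem.exec_pushCur, Mem.reg_set, Mem.reg_setCur]) fun j => ?_
      simp only [Mem.exec_pushCur, Mem.get_set, Mem.get_setCur, Mem.reg_set, Mem.reg_setCur]
      by_cases hd : j = d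
      · subst hd; simp [hkd.symm]
      · by_cases hk : j = k
        · subst hk; simp [hkd]
        · simp [hd, hk]

/-- Two reversals, to `w` and back, restore stack `k`, while the image on `d` is reversed once.
Stack `w` has to be empty so that only the borrowed symbols come back. -/
theorem go_copy (k w d : Stack) (g : TapeSymbol → TapeSymbol) (m : Mem) (hkw : k ≠ w)
    (hkd : k ≠ d) (hwd : w ≠ d) (hw : m.get w = []) :
    Go (copy k w d g) m ((m.setCur none).set d (((m.get k).map g).reverse ++ m.get d))
      (4 * (m.get k).length + 2) := by
  have key : ∀ (l : List TapeSymbol) (m : Mem), m.get k = l →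
      Go (drain k (.andThen (pushCur w id) (pushCur d g))) m
        ((((m.setCur none).set k []).set w (l.reverse ++ m.get w)).set d
          ((l.map g).reverse ++ m.get d)) (2 * l.length + 1) := by
    intro l
    induction l with
    | nil =>
      intro m hl
      have e : m.exec (popCur k) = (m.setCur none).set k [] := by rw [Mem.exec_popCur, hl]; rfl
      refine Go.congr (Go.loop_done (by rw [e, Mem.reg_set]; rfl)) ?_ le_rfl
      rw [e]
      refine Mem.ext_get (by simp only [Mem.reg_set]) fun j => ?_
      simp only [Mem.get_set, Mem.get_setCur]
      by_cases hd : j = d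
      · subst hd; simp [hkd.symm]
      · by_cases hj : j = w
        · subst hj; simp [hkw.symm, hd]
        · simp [hd, hj]
    | cons a l ih =>
      intro m hl
      have e : m.exec (popCur k) = (m.setCur (some a)).set k l := by rw [Mem.exec_popCur, hl]; rfl
      refine Go.congr (Go.loop_step (by rw [e, Mem.reg_set]; rfl) (Go.op _ _) (ih _ ?_)) ?_
        (by simp only [List.length_cons]; omega)
      · simp [e, Mem.exec, Mem.exec_pushCur, Mem.get_set, hkd, hkw]
      · rw [e]
        refine Mem.ext_get
          (by simp only [Mem.exec, Mem.exec_pushCur, Mem.reg_set, Mem.reg_setCur]) fun j => ?_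
        simp only [Mem.exec, Mem.exec_pushCur, Mem.get_set, Mem.get_setCur, Mem.reg_set,
          Mem.reg_setCur]
        by_cases hd : j = d
        · subst hd; simp [hkd.symm, hwd.symm]
        · by_cases hj : j = w
          · subst hj; simp [hkw.symm, hd]
          · by_cases hk : j = k
            · subst hk; simp [hkd, hkw]
            · simp [hd, hj, hk]
  refine Go.congr (Go.seq (key _ m rfl) (go_move w k id _ hkw.symm)) ?_
    (by simp [Mem.get_set, hwd, hw]; omega)
  refine Mem.ext_get (by simp only [Mem.reg_set, Mem.reg_setCur]) fun j => ?_
  simp only [Mem.get_set, Mem.get_setCur]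
  by_cases hd : j = d
  · subst hd; simp [hkd.symm, hwd.symm]
  · by_cases hj : j = w
    · subst hj; simp [hkw.symm, hd, hw]
    · by_cases hk : j = k
      · subst hk; simp [hkw, hkd, hwd, hw]
      · simp [hd, hj, hk]

theorem go_clear (k : Stack) (m : Mem) :
    Go (clear k) m ((m.setCur none).set k []) (2 * (m.get k).length + 1) := by
  generalize hl : m.get k = l
  induction l generalizing m with
  | nil =>
    have e : m.exec (popCur k) = (m.setCur none).set k [] := by rw [Mem.exec_popCur, hl]; rfl
    refine Go.congr (Go.loop_done (by rw [e, Mem.reg_set]; rfl)) e le_rfl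
  | cons a l ih =>
    have e : m.exec (popCur k) = (m.setCur (some a)).set k l := by rw [Mem.exec_popCur, hl]; rfl
    refine Go.congr (Go.loop_step (by rw [e, Mem.reg_set]; rfl) (Go.op _ _) (ih _ ?_)) ?_
      (by simp only [List.length_cons]; omega)
    · rw [Mem.exec_load_id, e, Mem.get_set, if_pos rfl]
    · rw [Mem.exec_load_id, e]
      refine Mem.ext_get (by simp only [Mem.reg_set, Mem.reg_setCur]) fun j => ?_
      simp only [Mem.get_set, Mem.get_setCur]
      split_ifs <;> rfl

/-- The symbol `a` is consumed by the failing test and stays in the register. -/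
theorem go_readRow (k d : Stack) (m : Mem) (hkd : k ≠ d) (l : List Bool) (a : TapeSymbol)
    (ha : ∀ c, a ≠ .bit c) (rest : List TapeSymbol) (hl : m.get k = l.map .bit ++ a :: rest) :
    Go (readRow k d) m
      (((m.setCur (some a)).set k rest).set d ((l.map .bit).reverse ++ m.get d))
      (2 * l.length + 1) := by
  induction l generalizing m with
  | nil =>
    have e : m.exec (popCur k) = (m.setCur (some a)).set k rest := by
      rw [Mem.exec_popCur, hl]; rfl
    refine Go.congr (Go.loop_done ?_) ?_ le_rfl
    · rw [e, Mem.reg_set]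
      cases a <;> first | rfl | exact absurd rfl (ha _)
    rw [e]
    refine Mem.ext_get (by simp only [Mem.reg_set]) fun j => ?_
    simp only [Mem.get_set, Mem.get_setCur]
    by_cases hd : j = d
    · subst hd; simp [hkd.symm]
    · simp [hd]
  | cons c l ih =>
    have e : m.exec (popCur k) = (m.setCur (some (.bit c))).set k (l.map .bit ++ a :: rest) := by
      rw [Mem.exec_popCur, hl]; rfl
    refine Go.congr (Go.loop_step (by rw [e, Mem.reg_set]; rfl) (Go.op _ _) (ih _ ?_)) ?_
      (by simp only [List.length_cons]; omega)
    · simp [e, Mem.exec_pushCur, Mem.get_set, hkd]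
    · rw [e]
      refine Mem.ext_get (by simp only [Mem.exec_pushCur, Mem.reg_set, Mem.reg_setCur]) fun j => ?_
      simp only [Mem.exec_pushCur, Mem.get_set, Mem.get_setCur, Mem.reg_set, Mem.reg_setCur]
      by_cases hd : j = d
      · subst hd; simp [hkd.symm]
      · by_cases hk : j = k
        · subst hk; simp [hkd]
        · simp [hd, hk]

/-! ### Elimination -/

/-- The inner product of two strings of bits. -/
def dot : List Bool → List Bool → Bool
  | a :: l, b :: m => (a && b) ^^ dot l m
  | _, _ => false

/-- The sum of two strings of bits. -/
def addBits (l m : List Bool) : List Bool := List.zipWith xor l m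

/-- The word for a list of strings of bits, each ended by a comma. -/
def rowsWord (rows : List (List Bool)) : List TapeSymbol :=
  rows.flatMap fun v => v.map .bit ++ [.comma]

/-- One step of an elimination with the functional `q`: a vector on which `q` vanishes is kept,
the first other vector becomes the pivot, and to any further vector the pivot is added. -/
def reduceStep {α : Type*} (q : α → Bool) (add : α → α → α) :
    List α × Option α → α → List α × Option α
  | (acc, none), v => if q v then (acc, some v) else (v :: acc, none)
  | (acc, some p), v => if q v then (add v p :: acc, some p) else (v :: acc, some p)

/-- The elimination with the functional `q`: the vectors after the elimination, and the pivot. -/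
def reduce {α : Type*} (q : α → Bool) (add : α → α → α) (l : List α) : List α × Option α :=
  let r := l.foldl (reduceStep q add) ([], none)
  (r.1.reverse, r.2)

/-- The value of a bit. -/
def bitValue : Option TapeSymbol → Bool
  | some (.bit b) => b
  | _ => false

/-- Read a vector from stack `b` and compute its inner product with the vector on stack `e`. -/
def readDot : Program :=
  .loop (popCur .b) curBit (.op (.andThen (popAux .e) (.andThen (pushCur .v id)
    (.andThen (pushAux .t) (.load fun r =>
      { r with aux := none, par := r.par ^^ (bitValue r.aux && bitValue r.cur) })))))

/-- Both strings are consumed in lockstep and kept reversed on `v` and `t`, from where a further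
move restores their order. Each round leaves the second register empty; by `ha` this agrees with its
initial value. -/
theorem go_readDot (m : Mem) (vs es : List Bool) (rest : List TapeSymbol)
    (h : vs.length = es.length) (hb : m.b = vs.map .bit ++ .comma :: rest)
    (he : m.e = es.map .bit) (ha : m.reg.aux = none) :
    Go readDot m { m with
      reg := { m.reg with cur := some .comma, par := m.reg.par ^^ dot es vs }
      b := rest, e := []
      v := (vs.map .bit).reverse ++ m.v
      t := (es.map .bit).reverse ++ m.t } (2 * vs.length + 1) := by
  induction vs generalizing m es with
  | nil =>
    obtain rfl : es = [] := List.eq_nil_of_length_eq_zero h.symm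
    obtain ⟨⟨cur, aux, par, piv, cnt⟩, inp, out, l1, r1, x, l2, r2, y, e, z, b, nb, p, v, t, t2⟩ := m
    dsimp only at hb he ha
    subst hb he ha
    refine Go.congr (Go.loop_done rfl) ?_ le_rfl
    simp [dot]
    rfl
  | cons c vs ih =>
    obtain _ | ⟨d, es⟩ := es
    · simp at h
    obtain ⟨⟨cur, aux, par, piv, cnt⟩, inp, out, l1, r1, x, l2, r2, y, e, z, b, nb, p, v, t, t2⟩ := m
    dsimp only at hb he ha
    subst hb he ha
    refine Go.congr (Go.loop_step rfl (Go.op _ _) (ih _ es (by simpa using h) rfl rfl rfl)) ?_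
      (by simp only [List.length_cons]; omega)
    simp [dot, Mem.exec, popAux, pushCur, pushAux, popCur, Mem.set, Mem.get, bitValue]

/-- Consume the vectors on stacks `v` and `t2`, push their sum to stack `nb`, and the second one
to stack `p`. -/
def addPivot : Program :=
  .loop (.andThen (popCur .v) (popAux .t2)) hasCur (.op (.andThen
    (.push .nb fun r => .bit (bitValue r.cur ^^ bitValue r.aux)) (pushAux .p)))

/-- It is applied to a reversed vector and a reversed pivot, so pushing entry by entry puts both the
sum and the pivot back in order. -/
theorem go_addPivot (m : Mem) (vs ps : List Bool) (h : vs.length = ps.length)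
    (hv : m.v = vs.map .bit) (hp : m.t2 = ps.map .bit) :
    Go addPivot m { m with
      reg := { m.reg with cur := none, aux := none }
      v := [], t2 := []
      nb := ((addBits vs ps).map .bit).reverse ++ m.nb
      p := (ps.map .bit).reverse ++ m.p } (2 * vs.length + 1) := by
  induction vs generalizing m ps with
  | nil =>
    obtain rfl : ps = [] := List.eq_nil_of_length_eq_zero h.symm
    obtain ⟨⟨cur, aux, par, piv, cnt⟩, inp, out, l1, r1, x, l2, r2, y, e, z, b, nb, p, v, t, t2⟩ := m
    dsimp only at hv hp
    subst hv hp
    exact Go.congr (Go.loop_done rfl) rfl le_rfl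
  | cons c vs ih =>
    obtain _ | ⟨d, ps⟩ := ps
    · simp at h
    obtain ⟨⟨cur, aux, par, piv, cnt⟩, inp, out, l1, r1, x, l2, r2, y, e, z, b, nb, p, v, t, t2⟩ := m
    dsimp only at hv hp
    subst hv hp
    refine Go.congr (Go.loop_step rfl (Go.op _ _) (ih _ ps (by simpa using h) rfl rfl)) ?_
      (by simp only [List.length_cons]; omega)
    simp [addBits, Mem.exec, popAux, popCur, pushAux, Mem.set, Mem.get, bitValue]

/-- Process one vector in an elimination. -/
def elimBody : Program :=
  .seq readDot <| .seq (move .t .e id) <| .seq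
    (.ite (fun r => r.par)
      (.ite (fun r => r.piv)
        (.seq (.op (put .nb .comma)) (.seq (move .p .t2 id) addPivot))
        (.seq (move .v .p id) (.op (.load fun r => { r with piv := true }))))
      (.seq (.op (put .nb .comma)) (move .v .nb id)))
    (.op (.load fun r => { Reg.init with piv := r.piv }))

/-- Eliminate with the vector on stack `e` in the list of vectors on stack `b`; the pivot is left
on stack `p`. -/
def elim : Program :=
  .seq (.op (.load fun _ => Reg.init)) <| .seq (.loop (peekCur .b) hasCur elimBody)
    (.loop (peekCur .nb) hasCur
      (.seq (readRow .nb .v) (.seq (.op (put .b .comma)) (move .v .b id))))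

/-- The content of the stack `p` for a pivot. -/
def pivotWord (p : Option (List Bool)) : List TapeSymbol := (p.getD []).map .bit

theorem rowsWord_cons (v : List Bool) (vs : List (List Bool)) :
    rowsWord (v :: vs) = v.map .bit ++ .comma :: rowsWord vs := by
  simp [rowsWord]

theorem addBits_reverse (v w : List Bool) (h : v.length = w.length) :
    addBits v.reverse w.reverse = (addBits v w).reverse := by
  rw [addBits, addBits, List.reverse_zipWith h]

/-- Each branch of the program is one case of `reduceStep`. Reading leaves the vector reversed on
`v`, so a single move puts it in order on `nb` or `p`; on `nb` its comma goes first, being the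
deepest symbol. The final reset clears the parity for the next vector. -/
theorem go_elimBody (m : Mem) (es v : List Bool) (vs acc : List (List Bool))
    (piv : Option (List Bool)) (c : Option TapeSymbol) (hv : v.length = es.length)
    (hp : ∀ p ∈ piv, p.length = es.length)
    (hr : m.reg = { Reg.init with cur := c, piv := piv.isSome })
    (hb : m.b = rowsWord (v :: vs)) (he : m.e = es.map .bit) (hnb : m.nb = rowsWord acc)
    (hpw : m.p = pivotWord piv) (h1 : m.v = []) (h2 : m.t = []) (h3 : m.t2 = []) :
    Go elimBody m { m with
      reg := { Reg.init with piv := (reduceStep (dot es) addBits (acc, piv) v).2.isSome }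
      b := rowsWord vs
      nb := rowsWord (reduceStep (dot es) addBits (acc, piv) v).1
      p := pivotWord (reduceStep (dot es) addBits (acc, piv) v).2 } (8 * es.length + 9) := by
  obtain ⟨reg, inp, out, l1, r1, x, l2, r2, y, e, z, b, nb, p, w, t, t2⟩ := m
  dsimp only at hr hb he hnb hpw h1 h2 h3
  subst hr hb he hnb hpw h1 h2 h3
  have hA := go_readDot ⟨{ Reg.init with cur := c, piv := piv.isSome }, inp, out, l1, r1, x, l2, r2,
    y, es.map .bit, z, rowsWord (v :: vs), rowsWord acc, pivotWord piv, [], [], []⟩ v es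
    (rowsWord vs) hv (rowsWord_cons v vs) rfl rfl
  have hes : ((es.map TapeSymbol.bit).reverse.map id).reverse = es.map .bit := by simp
  cases hd : dot es v with
  | false =>
    rw [hd] at hA
    refine Go.congr (Go.seq hA <| Go.seq (go_move .t .e id _ (by decide)) <| Go.seq
      (Go.ite_false rfl (Go.seq (Go.op _ _) (go_move .v .nb id _ (by decide)))) (Go.op _ _)) ?_ ?_
    · cases piv <;>
        simp [Mem.exec, Mem.set, Mem.get, Mem.setCur, put, reduceStep, hd, rowsWord_cons, Reg.init]
    · simp [Mem.exec, Mem.set, Mem.get, Mem.setCur, put, hv]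
      omega
  | true =>
    rw [hd] at hA
    cases piv with
    | none =>
      refine Go.congr (Go.seq hA <| Go.seq (go_move .t .e id _ (by decide)) <| Go.seq
        (Go.ite_true rfl (Go.ite_false rfl (Go.seq (go_move .v .p id _ (by decide))
          (Go.op _ _)))) (Go.op _ _)) ?_ ?_
      · simp [Mem.exec, Mem.set, Mem.get, Mem.setCur, reduceStep, hd, Reg.init,
          pivotWord]
      · simp [Mem.set, Mem.get, Mem.setCur, hv]
        omega
    | some p =>
      have hpl := hp p rfl
      refine Go.congr (Go.seq hA <| Go.seq (go_move .t .e id _ (by decide)) <| Go.seq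
        (Go.ite_true rfl (Go.ite_true rfl (Go.seq (Go.op _ _) (Go.seq
          (go_move .p .t2 id _ (by decide))
          (go_addPivot _ v.reverse p.reverse (by simp [hv, hpl]) ?_ ?_)))))
          (Go.op _ _)) ?_ ?_
      · simp [Mem.exec, Mem.set, Mem.get, Mem.setCur, put]
      · simp [Mem.exec, Mem.set, Mem.get, Mem.setCur, put, pivotWord]
      · simp [Mem.exec, Mem.set, Mem.get, Mem.setCur, put, reduceStep, hd, Reg.init,
          pivotWord, rowsWord_cons, addBits_reverse _ _ (hv.trans hpl.symm)]
      · simp [Mem.exec, Mem.set, Mem.get, Mem.setCur, put, hv, hpl, pivotWord]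
        omega

/-! ### Invariants of the elimination and its running time -/

theorem reduceStep_forall {α : Type*} {q : α → Bool} {add : α → α → α} {P : α → Prop}
    (hadd : ∀ v w, P v → P w → P (add v w)) {s : List α × Option α} {v : α}
    (h1 : ∀ w ∈ s.1, P w) (h2 : ∀ w ∈ s.2, P w) (hv : P v) :
    (∀ w ∈ (reduceStep q add s v).1, P w) ∧ ∀ w ∈ (reduceStep q add s v).2, P w := by
  obtain ⟨acc, _ | p⟩ := s <;> unfold reduceStep <;> dsimp only at h1 h2 ⊢ <;> split_ifs <;>
    simp_all

/-- No vector is lost as long as the pivot is counted. With the invariance of the span this yields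
linear independence after the elimination, and it bounds the number of vectors in the time
estimates. -/
theorem reduceStep_length {α : Type*} (q : α → Bool) (add : α → α → α)
    (s : List α × Option α) (v : α) :
    (reduceStep q add s v).1.length + (reduceStep q add s v).2.toList.length =
      s.1.length + s.2.toList.length + 1 := by
  obtain ⟨acc, _ | p⟩ := s <;> unfold reduceStep <;> dsimp only <;> split_ifs <;> simp

theorem foldl_reduceStep_forall {α : Type*} {q : α → Bool} {add : α → α → α} {P : α → Prop}
    (hadd : ∀ v w, P v → P w → P (add v w)) {s : List α × Option α} {l : List α}
    (h1 : ∀ w ∈ s.1, P w) (h2 : ∀ w ∈ s.2, P w) (hl : ∀ v ∈ l, P v) :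
    (∀ w ∈ (l.foldl (reduceStep q add) s).1, P w) ∧
      ∀ w ∈ (l.foldl (reduceStep q add) s).2, P w := by
  induction l generalizing s with
  | nil => exact ⟨h1, h2⟩
  | cons v l ih =>
    have h := reduceStep_forall (q := q) hadd h1 h2 (hl v List.mem_cons_self)
    exact ih h.1 h.2 fun w hw => hl w (List.mem_cons_of_mem v hw)

theorem foldl_reduceStep_length {α : Type*} (q : α → Bool) (add : α → α → α)
    (s : List α × Option α) (l : List α) :
    (l.foldl (reduceStep q add) s).1.length + (l.foldl (reduceStep q add) s).2.toList.length =
      s.1.length + s.2.toList.length + l.length := by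
  induction l generalizing s with
  | nil => rfl
  | cons v l ih =>
    rw [List.foldl_cons, ih, reduceStep_length, List.length_cons]
    omega

theorem reduce_forall {α : Type*} {q : α → Bool} {add : α → α → α} {P : α → Prop}
    (hadd : ∀ v w, P v → P w → P (add v w)) {l : List α} (hl : ∀ v ∈ l, P v) :
    (∀ w ∈ (reduce q add l).1, P w) ∧ ∀ w ∈ (reduce q add l).2, P w := by
  have h := foldl_reduceStep_forall (q := q) (s := ([], none)) hadd (by simp) (by simp) hl
  exact ⟨fun w hw => h.1 w (List.mem_reverse.1 hw), h.2⟩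

theorem reduce_length {α : Type*} (q : α → Bool) (add : α → α → α) (l : List α) :
    (reduce q add l).1.length + (reduce q add l).2.toList.length = l.length := by
  have h := foldl_reduceStep_length q add ([], none) l
  simpa [reduce] using h

theorem length_addBits {n : ℕ} (v w : List Bool) (hv : v.length = n) (hw : w.length = n) :
    (addBits v w).length = n := by
  simp [addBits, hv, hw]

theorem go_elimLoop (m : Mem) (es : List Bool) (vs acc : List (List Bool))
    (piv : Option (List Bool)) (hvs : ∀ v ∈ vs, v.length = es.length)
    (hacc : ∀ v ∈ acc, v.length = es.length) (hp : ∀ p ∈ piv, p.length = es.length)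
    (hr : m.reg = { Reg.init with piv := piv.isSome })
    (hb : m.b = rowsWord vs) (he : m.e = es.map .bit) (hnb : m.nb = rowsWord acc)
    (hpw : m.p = pivotWord piv) (h1 : m.v = []) (h2 : m.t = []) (h3 : m.t2 = []) :
    Go (.loop (peekCur .b) hasCur elimBody) m { m with
      reg := { Reg.init with piv := (vs.foldl (reduceStep (dot es) addBits) (acc, piv)).2.isSome }
      b := []
      nb := rowsWord (vs.foldl (reduceStep (dot es) addBits) (acc, piv)).1
      p := pivotWord (vs.foldl (reduceStep (dot es) addBits) (acc, piv)).2 }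
      (vs.length * (8 * es.length + 10) + 1) := by
  induction vs generalizing m acc piv with
  | nil =>
    obtain ⟨reg, inp, out, l1, r1, x, l2, r2, y, e, z, b, nb, p, w, t, t2⟩ := m
    dsimp only at hr hb he hnb hpw h1 h2 h3
    subst hr hb he hnb hpw h1 h2 h3
    exact Go.congr (Go.loop_done rfl) rfl (by simp)
  | cons v vs ih =>
    have h := reduceStep_forall (q := dot es) (add := addBits) (s := (acc, piv))
      (P := fun v => v.length = es.length) length_addBits hacc hp (hvs v List.mem_cons_self)
    -- Even an empty vector would leave its comma on the stack, so the test finds a symbol.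
    have hne : m.b.head?.isSome := by
      rw [hb, rowsWord_cons]; cases v <;> rfl
    refine Go.congr (Go.loop_step hne
      (go_elimBody _ es v vs acc piv m.b.head? (hvs v List.mem_cons_self) hp ?_ hb he hnb hpw h1 h2 h3)
      (ih _ _ _ (fun w hw => hvs w (List.mem_cons_of_mem v hw)) h.1 h.2 rfl rfl he rfl rfl h1 h2 h3))
      rfl ?_
    · simp [Mem.exec, peekCur, hr, Mem.get]
    · simp only [List.length_cons]
      ring_nf
      omega

/-- The loop that moves a list of vectors from stack `nb` to stack `b`. -/
theorem go_restoreLoop (m : Mem) (n : ℕ) (vs acc : List (List Bool))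
    (hvs : ∀ v ∈ vs, v.length = n)
    (hb : m.b = rowsWord acc) (hnb : m.nb = rowsWord vs) (h1 : m.v = []) :
    Go (.loop (peekCur .nb) hasCur
      (.seq (readRow .nb .v) (.seq (.op (put .b .comma)) (move .v .b id)))) m { m with
      reg := { m.reg with cur := none }
      b := rowsWord (vs.reverse ++ acc)
      nb := [] } (vs.length * (4 * n + 4) + 1) := by
  induction vs generalizing m acc with
  | nil =>
    obtain ⟨reg, inp, out, l1, r1, x, l2, r2, y, e, z, b, nb, p, w, t, t2⟩ := m
    dsimp only at hb hnb h1
    subst hb hnb h1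
    exact Go.congr (Go.loop_done rfl) rfl (by simp)
  | cons v vs ih =>
    have hne : m.nb.head?.isSome := by
      rw [hnb, rowsWord_cons]; cases v <;> rfl
    have h := go_readRow .nb .v (m.exec (peekCur .nb)) (by decide) v .comma (by simp)
      (rowsWord vs) (hnb.trans (rowsWord_cons v vs))
    refine Go.congr (Go.loop_step hne (Go.seq h (Go.seq (Go.op _ _)
      (go_move .v .b id _ (by decide)))) (ih _ (v :: acc)
        (fun w hw => hvs w (List.mem_cons_of_mem v hw)) ?_ rfl rfl)) ?_ ?_
    · simp [Mem.exec, Mem.set, Mem.get, Mem.setCur, put, peekCur, h1, hb, rowsWord_cons]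
    · simp [Mem.exec, Mem.set, Mem.get, Mem.setCur, put, peekCur, h1]
    · simp [Mem.exec, Mem.set, Mem.get, Mem.setCur, put, peekCur, h1,
        hvs v List.mem_cons_self]
      ring_nf
      omega

/-- The list on `nb` grew at its top and is in reversed order; the second loop turns it round, which
is the reversal in `reduce`. With `L = es.length`, elimination costs `8 * L + 10` and restoring `4 *
L + 4` steps per vector. -/
theorem go_elim (m : Mem) (es : List Bool) (vs : List (List Bool))
    (hvs : ∀ v ∈ vs, v.length = es.length) (hb : m.b = rowsWord vs) (he : m.e = es.map .bit)
    (hnb : m.nb = []) (hp : m.p = []) (h1 : m.v = []) (h2 : m.t = []) (h3 : m.t2 = []) :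
    Go elim m { m with
      reg := { Reg.init with piv := (reduce (dot es) addBits vs).2.isSome }
      b := rowsWord (reduce (dot es) addBits vs).1
      p := pivotWord (reduce (dot es) addBits vs).2 }
      (vs.length * (12 * es.length + 14) + 3) := by
  have h := foldl_reduceStep_forall (q := dot es) (add := addBits) (s := ([], none))
    (P := fun v => v.length = es.length) length_addBits (by simp) (by simp) hvs
  have hl := foldl_reduceStep_length (dot es) addBits ([], none) vs
  refine Go.congr (Go.seq (Go.op _ _) (Go.seq
    (go_elimLoop _ es vs [] none hvs (by simp) (by simp) rfl hb he hnb hp h1 h2 h3)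
    (go_restoreLoop _ es.length _ [] h.1 rfl rfl h1))) ?_ ?_
  · simp [Mem.exec, reduce, hnb]
    rfl
  · simp at hl
    generalize (vs.foldl (reduceStep (dot es) addBits) ([], none)).1 = acc at hl ⊢
    -- At most one vector, the pivot, is missing from `acc`.
    have : acc.length ≤ vs.length := by omega
    nlinarith

/-! ### Processing a circuit and a cocircuit -/

/-- A counter that stops at `3`. -/
def bump (c : Fin 4) (b : Bool) : Fin 4 :=
  if b then (if c = 0 then 1 else if c = 1 then 2 else 3) else c

theorem val_foldl_bump (l : List Bool) (c : Fin 4) :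
    (l.foldl bump c).val = min (c.val + l.count true) 3 := by
  induction l generalizing c with
  | nil => simp; omega
  | cons b l ih =>
    rw [List.foldl_cons, ih]
    cases b
    · simp [bump]
    · rw [List.count_cons_self]
      fin_cases c <;> simp [bump] <;> omega

/-- Saturation at 3 instead of 2 lets a finite counter tell exactly two from more than two. -/
theorem foldl_bump_eq_two_iff (l : List Bool) : l.foldl bump 0 = 2 ↔ l.count true = 2 := by
  rw [Fin.ext_iff, val_foldl_bump]
  simp only [Fin.val_zero, Nat.zero_add, Fin.val_two]
  omega

/-- The vector of an equation: a leading bit `1`, for the constant term, and the bits `z` at the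
places of two rows, with the given numbers of symbols before and after the two rows. -/
def equationBits (l₁ r₁ l₂ r₂ : ℕ) (z : List Bool) : List Bool :=
  true :: (List.replicate l₁ false ++ (z ++ false :: (List.replicate r₁ false ++
    false :: (List.replicate l₂ false ++ (z ++ false :: List.replicate r₂ false)))))

/-- Write the vector of an equation to stack `e`. -/
def writeEquation : Program :=
  .seq (copy .r2 .t .e zeroBit) <| .seq (.op (put .e (.bit false))) <|
  .seq (copy .z .t .e id) <| .seq (copy .l2 .t .e zeroBit) <| .seq (.op (put .e (.bit false))) <|
  .seq (copy .r1 .t .e zeroBit) <| .seq (.op (put .e (.bit false))) <|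
  .seq (copy .z .t .e id) <| .seq (copy .l1 .t .e zeroBit) (.op (put .e (.bit true)))

theorem reverse_map_zeroBit (l : List TapeSymbol) :
    (l.map zeroBit).reverse = (List.replicate l.length false).map .bit := by
  have h : l.map zeroBit = List.replicate l.length (.bit false) :=
    List.eq_replicate_iff.2 ⟨by simp, by simp [zeroBit]⟩
  rw [h, List.reverse_replicate, List.map_replicate]

/-- The stack is filled from the last entry to the first. The blocks of zeros depend only on the
heights of `l1`, `r1`, `l2`, `r2`, whereas `z` is stored reversed so that copying puts it in order.
-/
theorem go_writeEquation (m : Mem) (z : List Bool) (hz : m.z = (z.map .bit).reverse)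
    (he : m.e = []) (ht : m.t = []) :
    Go writeEquation m { m with
      reg := { m.reg with cur := none }
      e := (equationBits m.l1.length m.r1.length m.l2.length m.r2.length z).map .bit }
      (4 * (m.l1.length + m.r1.length + m.l2.length + m.r2.length) + 8 * z.length + 16) := by
  obtain ⟨reg, inp, out, l1, r1, x, l2, r2, y, e, z', b, nb, p, w, t, t2⟩ := m
  dsimp only at hz he ht
  subst hz he ht
  refine Go.congr (Go.seq (go_copy .r2 .t .e _ _ (by decide) (by decide) (by decide) rfl) <|
    Go.seq (Go.op _ _) <|
    Go.seq (go_copy .z .t .e _ _ (by decide) (by decide) (by decide) rfl) <|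
    Go.seq (go_copy .l2 .t .e _ _ (by decide) (by decide) (by decide) rfl) <|
    Go.seq (Go.op _ _) <|
    Go.seq (go_copy .r1 .t .e _ _ (by decide) (by decide) (by decide) rfl) <|
    Go.seq (Go.op _ _) <|
    Go.seq (go_copy .z .t .e _ _ (by decide) (by decide) (by decide) rfl) <|
    Go.seq (go_copy .l1 .t .e _ _ (by decide) (by decide) (by decide) rfl) (Go.op _ _)) ?_ ?_
  · simp [Mem.exec, Mem.set, Mem.get, Mem.setCur, put, equationBits, reverse_map_zeroBit]
  · simp [Mem.exec, Mem.set, Mem.get, Mem.setCur, put]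
    omega

/-- The bits of the intersection of two rows. -/
def andBits (x y : List Bool) : List Bool := List.zipWith and x y

/-- Consume rows on the stacks `t` and `t2`, move them to the stacks `x` and `y`, and write their
intersection to the stack `z` and its truncated size to the counter. -/
def meetLoop : Program :=
  .loop (.andThen (popCur .t) (popAux .t2)) hasCur (.op (.andThen (pushCur .x id)
    (.andThen (pushAux .y) (.andThen (.push .z fun r => .bit (bitValue r.cur && bitValue r.aux))
      (.load fun r => { r with cnt := bump r.cnt (bitValue r.cur && bitValue r.aux) })))))

theorem go_meetLoop (m : Mem) (x y : List Bool) (h : x.length = y.length)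
    (hx : m.t = x.map .bit) (hy : m.t2 = y.map .bit) :
    Go meetLoop m { m with
      reg := { m.reg with cur := none, aux := none, cnt := (andBits x y).foldl bump m.reg.cnt }
      t := [], t2 := []
      x := (x.map .bit).reverse ++ m.x
      y := (y.map .bit).reverse ++ m.y
      z := ((andBits x y).map .bit).reverse ++ m.z } (2 * x.length + 1) := by
  induction x generalizing m y with
  | nil =>
    obtain rfl : y = [] := List.eq_nil_of_length_eq_zero h.symm
    obtain ⟨⟨cur, aux, par, piv, cnt⟩, inp, out, l1, r1, x, l2, r2, y, e, z, b, nb, p, v, t, t2⟩ := m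
    dsimp only at hx hy
    subst hx hy
    exact Go.congr (Go.loop_done rfl) rfl le_rfl
  | cons c x ih =>
    obtain _ | ⟨d, y⟩ := y
    · simp at h
    obtain ⟨⟨cur, aux, par, piv, cnt⟩, inp, out, l1, r1, x', l2, r2, y', e, z, b, nb, p, v, t, t2⟩ := m
    dsimp only at hx hy
    subst hx hy
    refine Go.congr (Go.loop_step rfl (Go.op _ _) (ih _ y (by simpa using h) rfl rfl)) ?_
      (by simp only [List.length_cons]; omega)
    simp [andBits, Mem.exec, popAux, popCur, pushCur, pushAux, Mem.set, Mem.get, bitValue]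

/-- Process the circuit on stack `x` and the cocircuit on stack `y`. -/
def pairProg : Program :=
  .seq (move .x .t id) <| .seq (move .y .t2 id) <| .seq (.op (.load fun _ => Reg.init)) <|
  .seq meetLoop <| .seq
    (.ite (fun r => decide (r.cnt = 2))
      (.seq writeEquation (.seq elim (.seq (clear .p) (clear .e))))
      (.op (.load id))) <|
  .seq (clear .z) (.op (.load fun _ => Reg.init))

/-- The list of vectors after processing the circuit `x` and the cocircuit `y`. -/
def pairStep (l₁ r₁ l₂ r₂ : ℕ) (x y : List Bool) (vs : List (List Bool)) : List (List Bool) :=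
  if (andBits x y).count true = 2 then
    (reduce (dot (equationBits l₁ r₁ l₂ r₂ (andBits x y))) addBits vs).1
  else vs

theorem length_andBits (x y : List Bool) (h : x.length = y.length) :
    (andBits x y).length = x.length := by
  simp [andBits, h]

/-- The 4 counts the leading bit, the commas after the two rows and the semicolon. -/
theorem length_equationBits (l₁ r₁ l₂ r₂ : ℕ) (z : List Bool) :
    (equationBits l₁ r₁ l₂ r₂ z).length = l₁ + r₁ + l₂ + r₂ + 2 * z.length + 4 := by
  simp [equationBits]
  omega

theorem length_pivotWord_le {p : Option (List Bool)} {n : ℕ} (h : ∀ v ∈ p, v.length = n) :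
    (pivotWord p).length ≤ n := by
  cases p with
  | none => simp [pivotWord]
  | some v => simp [pivotWord, h v rfl]

/-- The pivot is erased, so only vectors in the kernel of the equation survive. The cost `12 * L +
14` per vector is that of the elimination; the rest pays for scanning the rows and for writing and
erasing. -/
theorem go_pairProg (m : Mem) (x y : List Bool) (vs : List (List Bool)) (L : ℕ)
    (hL : m.l1.length + m.r1.length + m.l2.length + m.r2.length + 2 * x.length + 4 = L)
    (hxy : x.length = y.length)
    (hvs : ∀ v ∈ vs, v.length = L) (hx : m.x = (x.map .bit).reverse)
    (hy : m.y = (y.map .bit).reverse) (hb : m.b = rowsWord vs) (he : m.e = []) (hz : m.z = [])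
    (hnb : m.nb = []) (hp : m.p = []) (h1 : m.v = []) (h2 : m.t = []) (h3 : m.t2 = []) :
    Go pairProg m { m with
      reg := Reg.init
      b := rowsWord (pairStep m.l1.length m.r1.length m.l2.length m.r2.length x y vs) }
      (vs.length * (12 * L + 14) + 20 * L + 20) := by
  have hc := foldl_bump_eq_two_iff (andBits x y)
  have hlz := length_andBits x y hxy
  obtain ⟨reg, inp, out, l1, r1, x', l2, r2, y', e, z, b, nb, p, w, t, t2⟩ := m
  dsimp only at hx hy hb he hz hnb hp h1 h2 h3 hL
  subst hx hy hb he hz hnb hp h1 h2 h3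
  have hE : (equationBits l1.length r1.length l2.length r2.length (andBits x y)).length = L := by
    rw [length_equationBits, hlz, hL]
  generalize hes : equationBits l1.length r1.length l2.length r2.length (andBits x y) = es at hE
  by_cases h : (andBits x y).count true = 2
  · have hp := length_pivotWord_le (reduce_forall (q := dot es) (add := addBits)
      (P := fun v => v.length = L) length_addBits hvs).2
    refine Go.congr (Go.seq (go_move .x .t id _ (by decide)) <|
      Go.seq (go_move .y .t2 id _ (by decide)) <| Go.seq (Go.op _ _) <|
      Go.seq (go_meetLoop _ x y hxy ?_ ?_) <|
      Go.seq (Go.ite_true ?_ (Go.seq (go_writeEquation _ (andBits x y) ?_ rfl rfl)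
        (Go.seq (go_elim _ es vs (by rwa [hE]) rfl ?_ rfl rfl rfl rfl rfl)
          (Go.seq (go_clear .p _) (go_clear .e _))))) <|
      Go.seq (go_clear .z _) (Go.op _ _)) ?_ ?_
    · simp [Mem.exec, Mem.set, Mem.get, Mem.setCur]
    · simp [Mem.exec, Mem.set, Mem.get, Mem.setCur]
    · exact decide_eq_true (hc.2 h)
    · exact List.append_nil _
    · exact congrArg (List.map _) hes
    · simp [Mem.exec, Mem.set, Mem.get, Mem.setCur, pairStep, h, hes]
    · simp [Mem.exec, Mem.set, Mem.get, Mem.setCur, hE, hlz, ← hxy, hes]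
      omega
  · refine Go.congr (Go.seq (go_move .x .t id _ (by decide)) <|
      Go.seq (go_move .y .t2 id _ (by decide)) <| Go.seq (Go.op _ _) <|
      Go.seq (go_meetLoop _ x y hxy ?_ ?_) <| Go.seq (Go.ite_false ?_ (Go.op _ _)) <|
      Go.seq (go_clear .z _) (Go.op _ _)) ?_ ?_
    · simp [Mem.exec, Mem.set, Mem.get, Mem.setCur]
    · simp [Mem.exec, Mem.set, Mem.get, Mem.setCur]
    · exact decide_eq_false fun h' => h (hc.1 h')
    · simp [Mem.exec, Mem.set, Mem.get, Mem.setCur, pairStep, h]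
    · simp [Mem.exec, Mem.set, Mem.get, Mem.setCur, hlz, ← hxy]
      omega

/-! ### All pairs of a circuit and a cocircuit -/

theorem rowsWord_append (l l' : List (List Bool)) :
    rowsWord (l ++ l') = rowsWord l ++ rowsWord l' := by
  simp [rowsWord]

theorem pairStep_forall {l₁ r₁ l₂ r₂ L : ℕ} {x y : List Bool} {vs : List (List Bool)}
    (h : ∀ v ∈ vs, v.length = L) : ∀ v ∈ pairStep l₁ r₁ l₂ r₂ x y vs, v.length = L := by
  unfold pairStep
  split_ifs
  · exact (reduce_forall (P := fun v : List Bool => v.length = L) length_addBits h).1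
  · exact h

theorem length_pairStep_le (l₁ r₁ l₂ r₂ : ℕ) (x y : List Bool) (vs : List (List Bool)) :
    (pairStep l₁ r₁ l₂ r₂ x y vs).length ≤ vs.length := by
  unfold pairStep
  split_ifs
  · exact Nat.le_of_add_right_le (reduce_length _ _ vs).le
  · exact le_rfl

/-- The list of vectors after processing the circuit `x` with a list of cocircuits, where `pre` are
the cocircuits before. -/
def innerVectors (l₁ r₁ : ℕ) (x : List Bool) :
    List (List Bool) → List (List Bool) → List (List Bool) → List (List Bool)
  | _, [], vs => vs
  | pre, y :: post, vs => innerVectors l₁ r₁ x (pre ++ [y]) post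
      (pairStep l₁ r₁ (rowsWord pre).length (rowsWord post).length x y vs)

/-- The list of vectors after processing a list of circuits, where `pre` are the circuits
before. -/
def outerVectors (ks : List (List Bool)) :
    List (List Bool) → List (List Bool) → List (List Bool) → List (List Bool)
  | _, [], vs => vs
  | pre, x :: post, vs => outerVectors ks (pre ++ [x]) post
      (innerVectors (rowsWord pre).length (rowsWord post).length x [] ks vs)

theorem innerVectors_forall {l₁ r₁ L : ℕ} {x : List Bool} {pre post vs : List (List Bool)}
    (h : ∀ v ∈ vs, v.length = L) : ∀ v ∈ innerVectors l₁ r₁ x pre post vs, v.length = L := by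
  induction post generalizing pre vs with
  | nil => exact h
  | cons y post ih => exact ih (pairStep_forall h)

theorem length_innerVectors_le (l₁ r₁ : ℕ) (x : List Bool) (pre post vs : List (List Bool)) :
    (innerVectors l₁ r₁ x pre post vs).length ≤ vs.length := by
  induction post generalizing pre vs with
  | nil => exact le_rfl
  | cons y post ih => exact (ih _ _).trans (length_pairStep_le _ _ _ _ _ _ _)

theorem outerVectors_forall {L : ℕ} {ks pre post vs : List (List Bool)}
    (h : ∀ v ∈ vs, v.length = L) : ∀ v ∈ outerVectors ks pre post vs, v.length = L := by
  induction post generalizing pre vs with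
  | nil => exact h
  | cons y post ih => exact ih (innerVectors_forall h)

theorem length_outerVectors_le (ks pre post vs : List (List Bool)) :
    (outerVectors ks pre post vs).length ≤ vs.length := by
  induction post generalizing pre vs with
  | nil => exact le_rfl
  | cons y post ih => exact (ih _ _).trans (length_innerVectors_le _ _ _ _ _ _)

/-- The loop over the cocircuits. -/
def innerLoop : Program :=
  .loop (peekCur .r2) hasCur (.seq (readRow .r2 .y) <| .seq pairProg <|
    .seq (move .y .t id) <| .seq (move .t .l2 id) (.op (put .l2 .comma)))

/-- The loop over the circuits. -/
def outerLoop : Program :=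
  .loop (peekCur .r1) hasCur (.seq (readRow .r1 .x) <| .seq innerLoop <| .seq (move .l2 .r2 id) <|
    .seq (move .x .t id) <| .seq (move .t .l1 id) (.op (put .l1 .comma)))

theorem head?_rowsWord_cons (v : List Bool) (vs : List (List Bool)) :
    (rowsWord (v :: vs)).head?.isSome := by
  rw [rowsWord_cons]; cases v <;> rfl

/-- The stacks `l2` and `r2` form a cursor: treated cocircuits lie reversed on `l2`, those to come
on `r2`, so their heights are the block lengths of the equation. The 3 in `hL` counts the leading
bit, the semicolon and the comma of the row `x`. -/
theorem go_innerLoop (m : Mem) (x : List Bool) (pre post vs : List (List Bool)) (L N : ℕ)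
    (hL : m.l1.length + m.r1.length + x.length + 3 + (rowsWord pre).length +
      (rowsWord post).length = L)
    (hpost : ∀ y ∈ post, y.length = x.length) (hvs : ∀ v ∈ vs, v.length = L)
    (hN : vs.length ≤ N) (hl2 : m.l2 = (rowsWord pre).reverse) (hr2 : m.r2 = rowsWord post)
    (hx : m.x = (x.map .bit).reverse)
    (hy : m.y = []) (hb : m.b = rowsWord vs) (he : m.e = []) (hz : m.z = [])
    (hnb : m.nb = []) (hp : m.p = []) (h1 : m.v = []) (h2 : m.t = []) (h3 : m.t2 = []) :
    ∃ r, Go innerLoop m { m with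
      reg := r
      l2 := (rowsWord (pre ++ post)).reverse
      r2 := []
      b := rowsWord (innerVectors m.l1.length m.r1.length x pre post vs) }
      (post.length * (N * (12 * L + 14) + 30 * L + 30) + 1) := by
  induction post generalizing m pre vs with
  | nil =>
    obtain ⟨reg, inp, out, l1, r1, x', l2, r2, y', e, z, b, nb, p, w, t, t2⟩ := m
    dsimp only at hx hy hb he hz hnb hp h1 h2 h3 hL hl2 hr2
    subst hx hy hb he hz hnb hp h1 h2 h3 hl2 hr2
    exact ⟨_, Go.congr (Go.loop_done rfl) (by rw [List.append_nil]; rfl) (by simp)⟩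
  | cons y post ih =>
    obtain ⟨reg, inp, out, l1, r1, x', l2, r2, y', e, z, b, nb, p, w, t, t2⟩ := m
    dsimp only at hx hy hb he hz hnb hp h1 h2 h3 hL hl2 hr2
    subst hx hy hb he hz hnb hp h1 h2 h3 hl2 hr2
    have hyx := hpost y List.mem_cons_self
    have hL' : L = l1.length + r1.length + (rowsWord pre).length + (rowsWord post).length +
        2 * x.length + 4 := by
      rw [← hL, rowsWord_cons]; simp [hyx]; omega
    have h := fun m h => go_readRow .r2 .y m (by decide) y .comma (by simp) (rowsWord post) h
    -- Two moves, from `y` to `t` to `l2`, keep the row reversed, so `l2` is again the reversed word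
    -- of the treated cocircuits.
    obtain ⟨r, hI⟩ := ih ⟨{ Reg.init with cur := none }, inp, out, l1, r1, (x.map .bit).reverse,
      (rowsWord (pre ++ [y])).reverse, rowsWord post, [], [], [],
      rowsWord (pairStep l1.length r1.length (rowsWord pre).length (rowsWord post).length x y vs),
      [], [], [], [], []⟩ (pre ++ [y])
      (pairStep l1.length r1.length (rowsWord pre).length (rowsWord post).length x y vs)
      (by rw [← hL, rowsWord_append, rowsWord_cons, rowsWord_cons]; simp [rowsWord]; omega)
      (fun w hw => hpost w (List.mem_cons_of_mem y hw)) (pairStep_forall hvs)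
      ((length_pairStep_le _ _ _ _ _ _ _).trans hN) rfl rfl rfl rfl rfl rfl rfl rfl rfl rfl rfl rfl
    have hP := fun m hL hx hy hb => go_pairProg m x y vs L hL hyx.symm hvs hx hy hb
    refine ⟨r, Go.congr (Go.loop_step (head?_rowsWord_cons y post) (Go.congr (t' := N * (12 * L + 14) + 30 * L + 28) (Go.seq
      (h _ (rowsWord_cons y post)) <| Go.seq
      (hP _ ?_ rfl ?_ rfl rfl rfl rfl rfl rfl rfl rfl) <|
      Go.seq (go_move .y .t id _ (by decide)) <| Go.seq (go_move .t .l2 id _ (by decide))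
      (Go.op _ _)) ?_ ?_) hI) ?_ ?_⟩
    · simp [Mem.exec, Mem.set, Mem.get, Mem.setCur, peekCur, hL']
    · simp [Mem.exec, Mem.set, Mem.get, Mem.setCur, peekCur]
    · simp [Mem.exec, Mem.set, Mem.get, Mem.setCur, peekCur, put, Reg.init,
        rowsWord]
    · have := Nat.mul_le_mul_right (12 * L + 14) hN
      simp [Mem.exec, Mem.set, Mem.get, Mem.setCur, peekCur, hyx]
      omega
    · simp [innerVectors]
    · simp only [List.length_cons]
      ring_nf
      omega

/-- After each circuit the cocircuits are rewound, since moving `l2` to `r2` reverses the reversed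
word. The 2 in `hL` counts the leading bit and the semicolon. -/
theorem go_outerLoop (m : Mem) (n : ℕ) (ks pre post vs : List (List Bool)) (L N : ℕ)
    (hL : (rowsWord pre).length + (rowsWord post).length + (rowsWord ks).length + 2 = L)
    (hks : ∀ y ∈ ks, y.length = n) (hpost : ∀ x ∈ post, x.length = n)
    (hvs : ∀ v ∈ vs, v.length = L)
    (hN : vs.length ≤ N) (hl1 : m.l1 = (rowsWord pre).reverse) (hr1 : m.r1 = rowsWord post)
    (hl2 : m.l2 = []) (hr2 : m.r2 = rowsWord ks) (hx : m.x = [])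
    (hy : m.y = []) (hb : m.b = rowsWord vs) (he : m.e = []) (hz : m.z = [])
    (hnb : m.nb = []) (hp : m.p = []) (h1 : m.v = []) (h2 : m.t = []) (h3 : m.t2 = []) :
    ∃ r, Go outerLoop m { m with
      reg := r
      l1 := (rowsWord (pre ++ post)).reverse
      r1 := []
      b := rowsWord (outerVectors ks pre post vs) }
      (post.length * (ks.length * (N * (12 * L + 14) + 30 * L + 30) + 10 * L + 10) + 1) := by
  induction post generalizing m pre vs with
  | nil =>
    obtain ⟨reg, inp, out, l1, r1, x', l2, r2, y', e, z, b, nb, p, w, t, t2⟩ := m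
    dsimp only at hx hy hb he hz hnb hp h1 h2 h3 hL hl2 hr2 hl1 hr1
    subst hx hy hb he hz hnb hp h1 h2 h3 hl2 hr2 hl1 hr1
    exact ⟨_, Go.congr (Go.loop_done rfl) (by rw [List.append_nil]; rfl) (by simp)⟩
  | cons x post ih =>
    obtain ⟨reg, inp, out, l1, r1, x', l2, r2, y', e, z, b, nb, p, w, t, t2⟩ := m
    dsimp only at hx hy hb he hz hnb hp h1 h2 h3 hL hl2 hr2 hl1 hr1
    subst hx hy hb he hz hnb hp h1 h2 h3 hl2 hr2 hl1 hr1
    have hxn := hpost x List.mem_cons_self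
    have hL' : L = (rowsWord pre).length + (rowsWord post).length + x.length + 3 +
        (rowsWord ks).length := by
      rw [← hL, rowsWord_cons]; simp; omega
    have h := fun m h => go_readRow .r1 .x m (by decide) x .comma (by simp) (rowsWord post) h
    obtain ⟨r', hJ⟩ := go_innerLoop ⟨{ reg with cur := some .comma }, inp, out,
      (rowsWord pre).reverse, rowsWord post, (x.map .bit).reverse, [], rowsWord ks, [], [], [],
      rowsWord vs, [], [], [], [], []⟩ x [] ks vs L N
      (by rw [hL']; simp [rowsWord]) (fun y hy => (hks y hy).trans hxn.symm) hvs hN rfl rfl rfl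
      rfl rfl rfl rfl rfl rfl rfl rfl rfl
    obtain ⟨r, hI⟩ := ih ⟨{ r' with cur := none }, inp, out, (rowsWord (pre ++ [x])).reverse,
      rowsWord post, [], [], rowsWord ks, [], [], [],
      rowsWord (innerVectors (rowsWord pre).length (rowsWord post).length x [] ks vs),
      [], [], [], [], []⟩ (pre ++ [x])
      (innerVectors (rowsWord pre).length (rowsWord post).length x [] ks vs)
      (by rw [← hL, rowsWord_append, rowsWord_cons, rowsWord_cons]; simp [rowsWord]; omega)
      (fun w hw => hpost w (List.mem_cons_of_mem x hw)) (innerVectors_forall hvs)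
      ((length_innerVectors_le _ _ _ _ _ _).trans hN) rfl rfl rfl rfl rfl rfl rfl rfl rfl rfl rfl
      rfl rfl rfl
    refine ⟨r, Go.congr (Go.loop_step (head?_rowsWord_cons x post) (Go.congr
      (t' := ks.length * (N * (12 * L + 14) + 30 * L + 30) + 10 * L + 9) (Go.seq
      (Go.congr (h _ (rowsWord_cons x post)) ?_ le_rfl) <| Go.seq hJ <|
      Go.seq (go_move .l2 .r2 id _ (by decide)) <| Go.seq (go_move .x .t id _ (by decide)) <|
      Go.seq (go_move .t .l1 id _ (by decide)) (Go.op _ _)) ?_ ?_) hI) ?_ ?_⟩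
    · simp [Mem.exec, Mem.set, Mem.get, Mem.setCur, peekCur]
    · simp [Mem.exec, Mem.set, Mem.get, Mem.setCur, put, rowsWord]
    · simp [Mem.set, Mem.get, Mem.setCur]
      omega
    · simp [outerVectors]
    · simp only [List.length_cons]
      ring_nf
      omega

/-! ### The initial list of vectors -/

/-- The unit vector with `i` zeros before and `j` zeros after the entry one. The leading bit is for
the constant term. -/
def unitBits (i j : ℕ) : List Bool :=
  false :: (List.replicate i false ++ true :: List.replicate j false)

/-- The unit vectors for the bits `1` of a word, which comes after `i` other symbols. -/
def unitVectors : ℕ → List TapeSymbol → List (List Bool)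
  | _, [] => []
  | i, a :: w =>
    if a = .bit true then unitBits i w.length :: unitVectors (i + 1) w else unitVectors (i + 1) w

/-- The vector of the constant term. -/
def constantBits (n : ℕ) : List Bool := true :: List.replicate n false

/-- Write the unit vector for the current position of the input word, of which the symbols before
are on stack `l1` and those after on stack `inp`. -/
def writeUnit : Program :=
  .seq (.op (put .b .comma)) <| .seq (copy .inp .t .b zeroBit) <| .seq (.op (put .b (.bit true))) <|
  .seq (copy .l1 .t .b zeroBit) (.op (.andThen (put .b (.bit false)) (put .l1 (.bit true))))

/-- Write all unit vectors, and move the input word to stack `l1`. -/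
def unitLoop : Program :=
  .loop (popCur .inp) hasCur
    (.ite (fun r => decide (r.cur = some (.bit true))) writeUnit (.op (pushCur .l1 id)))

/-- Copying overwrites the register that held the current symbol; as this symbol is known to be the
bit 1, it is pushed to `l1` as a constant. -/
theorem go_writeUnit (m : Mem) (vs : List (List Bool)) (hb : m.b = rowsWord vs) (ht : m.t = []) :
    Go writeUnit m { m with
      reg := { m.reg with cur := none }
      l1 := .bit true :: m.l1
      b := rowsWord (unitBits m.l1.length m.inp.length :: vs) }
      (4 * (m.l1.length + m.inp.length) + 8) := by
  obtain ⟨reg, inp, out, l1, r1, x', l2, r2, y', e, z, b, nb, p, w, t, t2⟩ := m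
  dsimp only at hb ht
  subst hb ht
  refine Go.congr (Go.seq (Go.op _ _) <|
    Go.seq (go_copy .inp .t .b _ _ (by decide) (by decide) (by decide) rfl) <|
    Go.seq (Go.op _ _) <|
    Go.seq (go_copy .l1 .t .b _ _ (by decide) (by decide) (by decide) rfl) (Go.op _ _)) ?_ ?_
  · simp [Mem.exec, Mem.set, Mem.get, Mem.setCur, put, reverse_map_zeroBit, rowsWord_cons, unitBits]
  · simp [Mem.exec, Mem.set, Mem.get, Mem.setCur, put]
    omega

/-- Symbols only pass from `inp` to `l1`, so `T` stays constant and bounds the cost of every unit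
vector. -/
theorem go_unitLoop (m : Mem) (w : List TapeSymbol) (vs : List (List Bool)) (T : ℕ)
    (hT : m.l1.length + w.length = T) (hw : m.inp = w)
    (hb : m.b = rowsWord vs) (ht : m.t = []) :
    ∃ r, Go unitLoop m { m with
      reg := r
      inp := []
      l1 := w.reverse ++ m.l1
      b := rowsWord ((unitVectors m.l1.length w).reverse ++ vs) }
      (w.length * (4 * T + 12) + 1) := by
  induction w generalizing m vs with
  | nil =>
    obtain ⟨reg, inp, out, l1, r1, x', l2, r2, y', e, z, b, nb, p, w, t, t2⟩ := m
    dsimp only at hb ht hw hT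
    subst hb ht hw
    exact ⟨_, Go.congr (Go.loop_done rfl) rfl (by simp)⟩
  | cons a w ih =>
    obtain ⟨reg, inp, out, l1, r1, x', l2, r2, y', e, z, b, nb, p, w', t, t2⟩ := m
    dsimp only at hb ht hw hT
    subst hb ht hw
    rw [List.length_cons] at hT
    by_cases ha : a = .bit true
    · subst ha
      obtain ⟨r, h⟩ := ih ⟨{ reg with cur := none }, w, out, .bit true :: l1, r1, x', l2, r2, y', e,
        z, rowsWord (unitBits l1.length w.length :: vs), nb, p, w', [], t2⟩
        (unitBits l1.length w.length :: vs) (by simp; omega) rfl rfl rfl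
      refine ⟨r, Go.congr (Go.loop_step rfl (Go.ite_true rfl (go_writeUnit _ vs rfl rfl)) h) ?_ ?_⟩
      · simp [unitVectors]
      · simp only [List.length_cons, Mem.exec, popCur, Mem.set, Mem.get, List.tail_cons]
        ring_nf
        omega
    · obtain ⟨r, h⟩ := ih ⟨{ reg with cur := some a }, w, out, a :: l1, r1, x', l2, r2, y', e,
        z, rowsWord vs, nb, p, w', [], t2⟩ vs (by simp; omega) rfl rfl rfl
      refine ⟨r, Go.congr (Go.loop_step rfl (Go.ite_false ?_ (Go.op _ _)) h) ?_ ?_⟩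
      · simpa [Mem.exec, popCur, Mem.get] using ha
      · simp [unitVectors, ha]
      · simp only [List.length_cons]
        ring_nf
        omega

/-! ### Splitting the input word -/

/-- Move the reversed word on stack `l1` to stack `r2`, up to the semicolon. -/
def splitLoop : Program :=
  .loop (popCur .l1) (fun r => decide (r.cur ≠ some .semicolon)) (.op (pushCur .r2 id))

/-- In its use `l1` holds the reversed input, so `u` is the reversed word of the cocircuits, which
is put back in order on `r2`. -/
theorem go_splitLoop (m : Mem) (u w : List TapeSymbol) (hu : .semicolon ∉ u)
    (hl : m.l1 = u ++ .semicolon :: w) :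
    ∃ r, Go splitLoop m { m with
      reg := r
      l1 := w
      r2 := u.reverse ++ m.r2 } (2 * u.length + 1) := by
  induction u generalizing m with
  | nil =>
    obtain ⟨reg, inp, out, l1, r1, x', l2, r2, y', e, z, b, nb, p, w, t, t2⟩ := m
    dsimp only at hl
    subst hl
    exact ⟨_, Go.congr (Go.loop_done rfl) rfl le_rfl⟩
  | cons a u ih =>
    obtain ⟨reg, inp, out, l1, r1, x', l2, r2, y', e, z, b, nb, p, w', t, t2⟩ := m
    dsimp only at hl
    subst hl
    simp only [List.mem_cons, not_or] at hu
    obtain ⟨r, h⟩ := ih ⟨{ reg with cur := some a }, inp, out, u ++ .semicolon :: w, r1, x', l2,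
      a :: r2, y', e, z, b, nb, p, w', t, t2⟩ hu.2 rfl
    refine ⟨r, Go.congr (Go.loop_step ?_ (Go.op _ _) h) ?_ ?_⟩
    · simpa [Mem.exec, popCur, Mem.get] using Ne.symm hu.1
    · simp
    · simp only [List.length_cons]
      omega

/-! ### Writing the answer -/

/-- The symbol for a value at a position of the input word. -/
def fillSymbol (a : TapeSymbol) (b : Bool) : TapeSymbol :=
  match a with
  | .bit _ => .bit b
  | a => a

/-- The word of the same shape as `w` with given values of the bits. -/
def fill (w : List TapeSymbol) (v : List Bool) : List TapeSymbol := List.zipWith fillSymbol w v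

/-- Write the values on stack `v`, in the shape of the word on stack `l1`, to stack `out`. -/
def fillLoop : Program :=
  .loop (popCur .l1) hasCur (.op (.andThen (popAux .v) (.andThen (pushCur .t id)
    (.push .out fun r => fillSymbol (r.cur.getD .comma) (bitValue r.aux)))))

theorem go_fillLoop (m : Mem) (w rest : List TapeSymbol) (v : List Bool)
    (h : w.length = v.length) (hw : m.l1 = w) (hv : m.v = v.map .bit ++ rest) :
    ∃ r, Go fillLoop m { m with
      reg := r
      l1 := []
      t := w.reverse ++ m.t
      v := rest
      out := (fill w v).reverse ++ m.out } (2 * w.length + 1) := by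
  induction w generalizing m v with
  | nil =>
    obtain rfl : v = [] := List.eq_nil_of_length_eq_zero h.symm
    obtain ⟨reg, inp, out, l1, r1, x', l2, r2, y', e, z, b, nb, p, w, t, t2⟩ := m
    dsimp only at hw hv
    subst hw hv
    exact ⟨_, Go.congr (Go.loop_done rfl) rfl le_rfl⟩
  | cons a w ih =>
    obtain _ | ⟨c, v⟩ := v
    · simp at h
    obtain ⟨reg, inp, out, l1, r1, x', l2, r2, y', e, z, b, nb, p, w', t, t2⟩ := m
    dsimp only at hw hv
    subst hw hv
    obtain ⟨r, h⟩ := ih ⟨{ reg with cur := some a, aux := some (.bit c) }, inp,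
      fillSymbol a c :: out, w, r1, x', l2, r2, y', e, z, b, nb, p, v.map .bit ++ rest, a :: t, t2⟩
      v (by simpa using h) rfl rfl
    refine ⟨r, Go.congr (Go.loop_step rfl (Go.op _ _) h) ?_ ?_⟩
    · simp [fill]
    · simp only [List.length_cons]
      omega

/-- Write the vector on stack `v` to stack `out`, ended by a semicolon. -/
def emit : Program :=
  .seq (.op (put .out .semicolon)) <| .seq fillLoop <| .seq (move .t .l1 id) (.op (popAux .v))

/-- The word for a vector in the output, where `w` is the input word. -/
def outputWord (w : List TapeSymbol) (v : List Bool) : List TapeSymbol :=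
  fill w v.tail ++ [.semicolon]

/-- Vector and template are read from their ends, so the bit of the constant term is the last one
left on `v`; it is dropped and does not reach the output. -/
theorem go_emit (m : Mem) (w : List TapeSymbol) (v : List Bool) (h : v.length = w.length + 1)
    (hw : m.l1 = w.reverse) (hv : m.v = (v.map .bit).reverse) (ht : m.t = []) :
    ∃ r, Go emit m { m with
      reg := r
      v := []
      out := outputWord w v ++ m.out } (4 * w.length + 4) := by
  obtain _ | ⟨c, v⟩ := v
  · simp at h
  obtain ⟨reg, inp, out, l1, r1, x', l2, r2, y', e, z, b, nb, p, w', t, t2⟩ := m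
  dsimp only at hw hv ht
  subst hw hv ht
  have hl : w.length = v.length := by simpa using h.symm
  obtain ⟨r, hF⟩ := go_fillLoop ⟨reg, inp, .semicolon :: out, w.reverse, r1, x', l2, r2, y', e, z,
    b, nb, p, ((c :: v).map .bit).reverse, [], t2⟩ w.reverse [.bit c] v.reverse (by simpa using hl)
    rfl (by simp)
  refine ⟨{ r with cur := none, aux := some (.bit c) }, Go.congr (Go.seq (Go.op _ _) <| Go.seq hF <|
    Go.seq (go_move .t .l1 id _ (by decide)) (Go.op _ _)) ?_ ?_⟩
  · simp [Mem.exec, Mem.set, Mem.get, Mem.setCur, outputWord, fill, popAux,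
      ← List.reverse_zipWith hl]
  · simp [Mem.get]
    omega

/-- Write the vectors on stack `b` to stack `out`. -/
def emitLoop : Program :=
  .loop (peekCur .b) hasCur (.seq (readRow .b .v) emit)

/-- Each vector is written in front of the earlier output, hence the reversed order. -/
theorem go_emitLoop (m : Mem) (w : List TapeSymbol) (vs : List (List Bool))
    (hvs : ∀ v ∈ vs, v.length = w.length + 1) (hw : m.l1 = w.reverse) (hb : m.b = rowsWord vs)
    (hv : m.v = []) (ht : m.t = []) :
    ∃ r, Go emitLoop m { m with
      reg := r
      b := []
      out := vs.reverse.flatMap (outputWord w) ++ m.out } (vs.length * (6 * w.length + 9) + 1) := by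
  induction vs generalizing m with
  | nil =>
    obtain ⟨reg, inp, out, l1, r1, x', l2, r2, y', e, z, b, nb, p, w, t, t2⟩ := m
    dsimp only at hw hb hv ht
    subst hw hb hv ht
    exact ⟨_, Go.congr (Go.loop_done rfl) rfl (by simp)⟩
  | cons v vs ih =>
    obtain ⟨reg, inp, out, l1, r1, x', l2, r2, y', e, z, b, nb, p, w', t, t2⟩ := m
    dsimp only at hw hb hv ht
    subst hw hb hv ht
    have h := fun m h => go_readRow .b .v m (by decide) v .comma (by simp) (rowsWord vs) h
    obtain ⟨r', hE⟩ := go_emit ⟨{ reg with cur := some .comma }, inp, out, w.reverse, r1, x', l2, r2,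
      y', e, z, rowsWord vs, nb, p, (v.map .bit).reverse, [], t2⟩ w v (hvs v List.mem_cons_self)
      rfl rfl rfl
    obtain ⟨r, hI⟩ := ih ⟨r', inp, outputWord w v ++ out, w.reverse, r1, x', l2, r2,
      y', e, z, rowsWord vs, nb, p, [], [], t2⟩ (fun u hu => hvs u (List.mem_cons_of_mem v hu))
      rfl rfl rfl rfl
    refine ⟨r, Go.congr (Go.loop_step (head?_rowsWord_cons v vs) (Go.seq
      (Go.congr (h _ (rowsWord_cons v vs)) ?_ le_rfl) hE) hI) ?_ ?_⟩
    · simp [Mem.exec, Mem.set, Mem.get, Mem.setCur, peekCur]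
    · simp
    · simp only [List.length_cons, hvs v List.mem_cons_self]
      ring_nf
      omega

/-! ### The whole program -/

/-- Write the initial list of vectors to stack `b`, and split the input word. -/
def initProg : Program :=
  .seq (.op (put .b .comma)) <| .seq (copy .inp .t .b zeroBit) <| .seq (.op (put .b (.bit true))) <|
  .seq unitLoop <| .seq splitLoop (move .l1 .r1 id)

/-- The initial list of vectors for an input word. -/
def initialVectors (w : List TapeSymbol) : List (List Bool) :=
  (unitVectors 0 w).reverse ++ [constantBits w.length]

/-- Eliminate with the constant term, after the input word is reassembled on stack `l1`. -/
def solveProg : Program :=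
  .seq (.op (put .l1 .semicolon)) <| .seq (move .r2 .l1 id) <| .seq (copy .l1 .t .e zeroBit) <|
  .seq (.op (put .e (.bit true))) elim

/-- Write the answer. -/
def answerProg : Program :=
  .ite (fun r => r.piv)
    (.seq emitLoop <| .seq (move .p .v id) <| .seq emit <| .seq (.op (put .out (.bit true))) <|
      .seq (clear .l1) <| .seq (clear .e) (.op (.load fun _ => Reg.init)))
    (.seq (clear .b) <| .seq (clear .l1) <| .seq (clear .e) <| .seq (.op (put .out (.bit false)))
      (.op (.load fun _ => Reg.init)))

/-- The whole program. -/
def mainProg : Program :=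
  .seq initProg <| .seq outerLoop <| .seq solveProg answerProg

/-- The memory with a word on stack `inp`. -/
def inputMem (w : List TapeSymbol) : Mem :=
  ⟨Reg.init, w, [], [], [], [], [], [], [], [], [], [], [], [], [], [], []⟩

/-- The memory with a word on stack `out`. -/
def outputMem (w : List TapeSymbol) : Mem :=
  ⟨Reg.init, [], w, [], [], [], [], [], [], [], [], [], [], [], [], [], []⟩

/-! ### Word lengths and the running time of the whole program -/

theorem semicolon_notMem_rowsWord (l : List (List Bool)) : .semicolon ∉ rowsWord l := by
  simp [rowsWord]

theorem length_le_length_rowsWord (l : List (List Bool)) : l.length ≤ (rowsWord l).length := by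
  induction l with
  | nil => simp
  | cons v l ih => rw [rowsWord_cons]; simp; omega

theorem length_rowsWord_of_forall {l : List (List Bool)} {n : ℕ} (h : ∀ v ∈ l, v.length = n) :
    (rowsWord l).length = l.length * (n + 1) := by
  induction l with
  | nil => simp [rowsWord]
  | cons v l ih =>
    rw [rowsWord_cons, List.length_append, List.length_map, List.length_cons, List.length_cons,
      ih fun w hw => h w (List.mem_cons_of_mem v hw), h v List.mem_cons_self]
    ring

theorem length_unitVectors_le (i : ℕ) (w : List TapeSymbol) :
    (unitVectors i w).length ≤ w.length := by
  induction w generalizing i with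
  | nil => simp [unitVectors]
  | cons a w ih =>
    have := ih (i + 1)
    unfold unitVectors
    split_ifs <;> simp <;> omega

theorem length_of_mem_unitVectors (i : ℕ) (w : List TapeSymbol) :
    ∀ v ∈ unitVectors i w, v.length = i + w.length + 1 := by
  induction w generalizing i with
  | nil => simp [unitVectors]
  | cons a w ih =>
    have h := ih (i + 1)
    unfold unitVectors
    split_ifs
    · intro v hv
      rcases List.mem_cons.1 hv with rfl | hv
      · simp [unitBits, Nat.add_assoc]
      · rw [h v hv, List.length_cons]; omega
    · intro v hv
      rw [h v hv, List.length_cons]; omega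

theorem length_of_mem_initialVectors (w : List TapeSymbol) :
    ∀ v ∈ initialVectors w, v.length = w.length + 1 := by
  intro v hv
  rcases List.mem_append.1 hv with hv | hv
  · rw [length_of_mem_unitVectors 0 w v (List.mem_reverse.1 hv), Nat.zero_add]
  · rw [List.mem_singleton.1 hv]; simp [constantBits]

theorem length_initialVectors_le (w : List TapeSymbol) :
    (initialVectors w).length ≤ w.length + 1 := by
  simpa [initialVectors] using length_unitVectors_le 0 w

theorem go_initProg (cs ks : List (List Bool)) (w : List TapeSymbol)
    (hw : w = rowsWord cs ++ .semicolon :: rowsWord ks) :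
    ∃ r, Go initProg (inputMem w) { inputMem [] with
      reg := r
      r1 := rowsWord cs
      r2 := rowsWord ks
      b := rowsWord (initialVectors w) } (w.length * (4 * w.length + 12) + 8 * w.length + 10) := by
  have hB : rowsWord [constantBits w.length] =
      .bit true :: ((List.replicate w.length false).map .bit ++ [.comma]) := by
    simp [rowsWord, constantBits]
  obtain ⟨r₁, h₁⟩ := go_unitLoop { inputMem w with b := rowsWord [constantBits w.length] } w
    [constantBits w.length] w.length (by simp [inputMem]) rfl rfl rfl
  obtain ⟨r₂, h₂⟩ := go_splitLoop { inputMem [] with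
      reg := r₁
      l1 := (rowsWord ks).reverse ++ .semicolon :: (rowsWord cs).reverse
      b := rowsWord (initialVectors w) } (rowsWord ks).reverse (rowsWord cs).reverse
      (by simpa using semicolon_notMem_rowsWord ks) rfl
  have hl : w.length = (rowsWord cs).length + (rowsWord ks).length + 1 := by
    rw [hw]; simp; omega
  refine ⟨{ r₂ with cur := none }, Go.congr (Go.seq (Go.op _ _) <|
    Go.seq (go_copy .inp .t .b _ _ (by decide) (by decide) (by decide) rfl) <|
    Go.seq (Go.op _ _) <| Go.seq (Go.pre ?_ h₁) <|
    Go.seq (Go.pre ?_ h₂) (go_move .l1 .r1 id _ (by decide))) ?_ ?_⟩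
  · simp [Mem.exec, Mem.set, Mem.get, Mem.setCur, put, inputMem, hB, reverse_map_zeroBit,
      Reg.init]
  · simp [inputMem, initialVectors, hw]
  · simp [Mem.set, Mem.get, Mem.setCur, inputMem]
  · simp [Mem.exec, Mem.set, Mem.get, put, inputMem]
    omega

/-- Beyond its leading 1 the functional is zero, so it needs only the length of the reassembled
word; the word itself remains on `l1` as the template for the output. -/
theorem go_solveProg (m : Mem) (w₁ w₂ : List TapeSymbol) (vs : List (List Bool)) (W : ℕ)
    (hW : w₁.length + w₂.length + 1 = W) (hvs : ∀ v ∈ vs, v.length = W + 1)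
    (hl1 : m.l1 = w₁.reverse) (hr2 : m.r2 = w₂) (hb : m.b = rowsWord vs) (he : m.e = [])
    (hnb : m.nb = []) (hp : m.p = []) (h1 : m.v = []) (h2 : m.t = []) (h3 : m.t2 = []) :
    Go solveProg m { m with
      reg := { Reg.init with piv := (reduce (dot (constantBits W)) addBits vs).2.isSome }
      l1 := (w₁ ++ .semicolon :: w₂).reverse
      r2 := []
      e := (constantBits W).map .bit
      b := rowsWord (reduce (dot (constantBits W)) addBits vs).1
      p := pivotWord (reduce (dot (constantBits W)) addBits vs).2 }
      (vs.length * (12 * (W + 1) + 14) + 6 * W + 8) := by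
  have hc : (constantBits W).length = W + 1 := by simp [constantBits]
  have hE : .bit true :: (w₁.map zeroBit ++ zeroBit .semicolon :: w₂.map zeroBit) =
      (constantBits W).map .bit := by
    have h := reverse_map_zeroBit (w₁ ++ .semicolon :: w₂).reverse
    rw [List.map_reverse, List.reverse_reverse, List.map_append, List.map_cons] at h
    rw [h, constantBits, ← hW, List.map_cons]
    simp
    omega
  obtain ⟨reg, inp, out, l1, r1, x, l2, r2, y, e, z', b, nb, p, w, t, t2⟩ := m
  dsimp only at hl1 hr2 hb he hnb hp h1 h2 h3
  subst hl1 hr2 hb he hnb hp h1 h2 h3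
  refine Go.congr (Go.seq (Go.op _ _) <| Go.seq (go_move .r2 .l1 id _ (by decide)) <|
    Go.seq (go_copy .l1 .t .e _ _ (by decide) (by decide) (by decide) rfl) <|
    Go.seq (Go.op _ _) (go_elim _ (constantBits W) vs (by rwa [hc]) rfl ?_ rfl rfl rfl rfl rfl))
    ?_ ?_
  · simp [Mem.exec, Mem.set, Mem.get, Mem.setCur, put, hE]
  · simp [Mem.exec, Mem.set, Mem.get, Mem.setCur, put, hE]
  · rw [hc]
    simp [Mem.exec, Mem.set, Mem.get, Mem.setCur, put]
    omega

/-- The output word for an input word, a list of vectors and a pivot. -/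
def answerWord (w : List TapeSymbol) : List (List Bool) × Option (List Bool) → List TapeSymbol
  | (_, none) => [.bit false]
  | (vs, some p) => .bit true :: (p :: vs.reverse).flatMap (outputWord w)

/-- The pivot is written after the other vectors and therefore precedes them in the output. All
remaining stacks and registers are cleared, as the halting configuration demands. -/
theorem go_answerProg (w : List TapeSymbol) (vs : List (List Bool)) (piv : Option (List Bool))
    (es : List Bool) (hvs : ∀ v ∈ vs, v.length = w.length + 1)
    (hp : ∀ p ∈ piv, p.length = w.length + 1) (he : es.length = w.length + 1) :
    Go answerProg { inputMem [] with
        reg := { Reg.init with piv := piv.isSome }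
        l1 := w.reverse
        e := es.map .bit
        b := rowsWord vs
        p := pivotWord piv } (outputMem (answerWord w (vs, piv)))
      (vs.length * (6 * w.length + 9) + 15 * w.length + 20) := by
  cases piv with
  | none =>
    refine Go.congr (Go.ite_false rfl (Go.seq (go_clear .b _) <| Go.seq (go_clear .l1 _) <|
      Go.seq (go_clear .e _) <| Go.seq (Go.op _ _) (Go.op _ _))) ?_ ?_
    · simp [Mem.exec, Mem.set, Mem.get, Mem.setCur, put, inputMem, outputMem, answerWord,
        pivotWord]
    · have h := length_rowsWord_of_forall hvs
      simp [Mem.set, Mem.get, Mem.setCur, inputMem, he, h]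
      ring_nf
      omega
  | some p =>
    obtain ⟨r₁, h₁⟩ := go_emitLoop { inputMem [] with
        reg := { Reg.init with piv := true }
        l1 := w.reverse
        e := es.map .bit
        b := rowsWord vs
        p := p.map .bit } w vs hvs rfl rfl rfl rfl
    obtain ⟨r₂, h₂⟩ := go_emit { inputMem [] with
        reg := { r₁ with cur := none }
        l1 := w.reverse
        e := es.map .bit
        out := vs.reverse.flatMap (outputWord w)
        v := (p.map .bit).reverse } w p (hp p rfl) rfl rfl rfl
    refine Go.congr (Go.ite_true rfl (Go.seq (Go.pre ?_ h₁) <|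
      Go.seq (go_move .p .v id _ (by decide)) <| Go.seq (Go.pre ?_ h₂) <| Go.seq (Go.op _ _) <|
      Go.seq (go_clear .l1 _) <| Go.seq (go_clear .e _) (Go.op _ _))) ?_ ?_
    · simp [inputMem, pivotWord]
    · simp [Mem.set, Mem.get, Mem.setCur, inputMem]
    · simp [Mem.exec, Mem.set, Mem.get, Mem.setCur, put, inputMem, outputMem, answerWord]
    · simp [Mem.exec, Mem.set, Mem.get, Mem.setCur, put, inputMem, he, hp p rfl]
      omega

/-- A bound for the number of steps of the program on input words of length `W`. -/
def timeBound (W : ℕ) : ℕ :=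
  (W * (4 * W + 12) + 8 * W + 10) +
  ((W * (W * ((W + 1) * (12 * (W + 1) + 14) + 30 * (W + 1) + 30) + 10 * (W + 1) + 10) + 1) +
  (((W + 1) * (12 * (W + 1) + 14) + 6 * W + 8) + ((W + 1) * (6 * W + 9) + 15 * W + 20)))

/-- The list of vectors and the pivot that the program computes. -/
def result (cs ks : List (List Bool)) (w : List TapeSymbol) :
    List (List Bool) × Option (List Bool) :=
  reduce (dot (constantBits w.length)) addBits (outerVectors ks [] cs (initialVectors w))

/-- Every loop count is at most the word length or one more: each circuit or cocircuit contributes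
at least its comma to the word, and each unit vector belongs to one of its symbols. -/
theorem go_mainProg (n : ℕ) (cs ks : List (List Bool)) (w : List TapeSymbol)
    (hw : w = rowsWord cs ++ .semicolon :: rowsWord ks) (hcs : ∀ c ∈ cs, c.length = n)
    (hks : ∀ k ∈ ks, k.length = n) :
    Go mainProg (inputMem w) (outputMem (answerWord w (result cs ks w))) (timeBound w.length) := by
  have hl : w.length = (rowsWord cs).length + (rowsWord ks).length + 1 := by
    rw [hw]; simp; omega
  have hc := length_le_length_rowsWord cs
  have hk := length_le_length_rowsWord ks
  have hv := length_of_mem_initialVectors w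
  have hv' := length_initialVectors_le w
  have hu : ∀ v ∈ outerVectors ks [] cs (initialVectors w), v.length = w.length + 1 :=
    outerVectors_forall hv
  have hu' := (length_outerVectors_le ks [] cs (initialVectors w)).trans hv'
  have hr := reduce_forall (q := dot (constantBits w.length)) (add := addBits)
    (P := fun v : List Bool => v.length = w.length + 1) length_addBits hu
  have hr' := (Nat.le_of_add_right_le (reduce_length (dot (constantBits w.length)) addBits
    (outerVectors ks [] cs (initialVectors w))).le).trans hu'
  obtain ⟨r₁, h₁⟩ := go_initProg cs ks w hw
  obtain ⟨r₂, h₂⟩ := go_outerLoop { inputMem [] with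
      reg := r₁
      r1 := rowsWord cs
      r2 := rowsWord ks
      b := rowsWord (initialVectors w) } n ks [] cs (initialVectors w) (w.length + 1)
      (w.length + 1) (by rw [hl]; simp [rowsWord]) hks hcs hv hv' rfl rfl rfl rfl rfl rfl rfl
      rfl rfl rfl rfl rfl rfl rfl
  have h₃ := go_solveProg { inputMem [] with
      reg := r₂
      l1 := (rowsWord cs).reverse
      r2 := rowsWord ks
      b := rowsWord (outerVectors ks [] cs (initialVectors w)) } (rowsWord cs) (rowsWord ks)
      (outerVectors ks [] cs (initialVectors w)) w.length hl.symm hu rfl rfl rfl rfl rfl rfl rfl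
      rfl rfl
  have h₄ := go_answerProg w (result cs ks w).1 (result cs ks w).2 (constantBits w.length) hr.1 hr.2
    (by simp [constantBits])
  refine Go.congr (Go.seq h₁ (Go.seq h₂ (Go.seq h₃ (Go.pre ?_ h₄)))) rfl ?_
  · rw [← hw]
    rfl
  · unfold timeBound result
    gcongr <;> omega

/-! ### Elimination preserves bases -/

section LinearAlgebra

variable {V : Type*} [AddCommGroup V] [Module (ZMod 2) V]

/-- The span of the members of a list. -/
abbrev listSpan (l : List V) : Submodule (ZMod 2) V := Submodule.span (ZMod 2) {x | x ∈ l}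

theorem listSpan_congr {a b : List V} (h : ∀ x, x ∈ a ↔ x ∈ b) : listSpan a = listSpan b :=
  congrArg (Submodule.span (ZMod 2)) (Set.ext h)

theorem listSpan_append (a b : List V) : listSpan (a ++ b) = listSpan a ⊔ listSpan b := by
  rw [listSpan, listSpan, listSpan, ← Submodule.span_union]
  exact congrArg _ (Set.ext fun _ => List.mem_append)

theorem listSpan_singleton (p : V) : listSpan [p] = Submodule.span (ZMod 2) {p} :=
  congrArg _ (Set.ext fun _ => List.mem_singleton)

/-- Independence is thereby reduced to the span and the number of vectors, which elimination
preserves. -/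
theorem linearIndependent_get_iff (l : List V) :
    LinearIndependent (ZMod 2) l.get ↔ Module.finrank (ZMod 2) (listSpan l) = l.length := by
  rw [linearIndependent_iff_card_eq_finrank_span, Fintype.card_fin, Set.finrank,
    Set.range_list_get, eq_comm]

variable (ℓ : V →ₗ[ZMod 2] ZMod 2)

/-- The test of a linear functional. -/
def functionalTest (v : V) : Bool := decide (ℓ v = 1)

theorem eq_zero_of_ne_one {a : ZMod 2} (h : a ≠ 1) : a = 0 := by
  revert h; revert a; decide

/-- Adding the pivot is undone by subtracting it; in the other cases the vectors are only
rearranged. -/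
theorem span_reduceStep (s : List V × Option V) (v : V) :
    listSpan ((reduceStep (functionalTest ℓ) (· + ·) s v).1 ++
      (reduceStep (functionalTest ℓ) (· + ·) s v).2.toList) =
    listSpan (v :: (s.1 ++ s.2.toList)) := by
  obtain ⟨acc, _ | p⟩ := s <;> unfold reduceStep <;> dsimp only <;> split_ifs
  · exact listSpan_congr fun x => by simp [or_comm]
  · exact listSpan_congr fun x => by simp
  · refine le_antisymm (Submodule.span_le.2 fun x hx => ?_) (Submodule.span_le.2 fun x hx => ?_)
    · simp at hx
      rcases hx with rfl | hx | rfl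
      · exact add_mem (Submodule.subset_span (by simp)) (Submodule.subset_span (by simp))
      · exact Submodule.subset_span (by simp [hx])
      · exact Submodule.subset_span (by simp)
    · simp at hx
      rcases hx with rfl | hx | rfl
      · rw [← add_sub_cancel_right x p]
        exact sub_mem (Submodule.subset_span (by simp)) (Submodule.subset_span (by simp))
      · exact Submodule.subset_span (by simp [hx])
      · exact Submodule.subset_span (by simp)
  · exact listSpan_congr fun x => by simp

theorem span_foldl_reduceStep (s : List V × Option V) (l : List V) :
    listSpan ((l.foldl (reduceStep (functionalTest ℓ) (· + ·)) s).1 ++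
      (l.foldl (reduceStep (functionalTest ℓ) (· + ·)) s).2.toList) =
    listSpan (l ++ (s.1 ++ s.2.toList)) := by
  induction l generalizing s with
  | nil => rfl
  | cons v l ih =>
    rw [List.foldl_cons, ih, listSpan_append, span_reduceStep, ← listSpan_append]
    exact listSpan_congr fun x => by simp; tauto

/-- A vector with value 1 either becomes the pivot or is corrected by it, and `1 + 1 = 0`. -/
theorem foldl_reduceStep_values (s : List V × Option V) (l : List V)
    (h1 : ∀ w ∈ s.1, ℓ w = 0) (h2 : ∀ w ∈ s.2, ℓ w = 1) :
    (∀ w ∈ (l.foldl (reduceStep (functionalTest ℓ) (· + ·)) s).1, ℓ w = 0) ∧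
      ∀ w ∈ (l.foldl (reduceStep (functionalTest ℓ) (· + ·)) s).2, ℓ w = 1 := by
  induction l generalizing s with
  | nil => exact ⟨h1, h2⟩
  | cons v l ih =>
    have h11 : (1 : ZMod 2) + 1 = 0 := rfl
    obtain ⟨acc, piv⟩ := s
    by_cases h : ℓ v = 1
    · have hq : functionalTest ℓ v = true := decide_eq_true h
      cases piv with
      | none =>
        refine ih _ ?_ ?_ <;> simp only [reduceStep, hq, if_true]
        · exact h1
        · rintro _ ⟨⟩; exact h
      | some p =>
        refine ih _ ?_ ?_ <;> simp only [reduceStep, hq, if_true]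
        · intro w hw
          rcases List.mem_cons.1 hw with rfl | hw
          · rw [map_add, h, h2 p rfl, h11]
          · exact h1 w hw
        · exact h2
    · have hq : functionalTest ℓ v = false := decide_eq_false h
      have h0 : ∀ w ∈ v :: acc, ℓ w = 0 := by
        intro w hw
        rcases List.mem_cons.1 hw with rfl | hw
        · exact eq_zero_of_ne_one h
        · exact h1 w hw
      cases piv <;> refine ih _ ?_ ?_ <;> simp only [reduceStep, hq] <;> assumption

/-- The kept vectors lie in the kernel of `ℓ`. With a pivot `p`, the span of `l` is the sum of the
line of `p` and their span, and `ℓ p = 1`, so a vector lies in the kernel exactly when its component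
along `p` vanishes. Without a pivot nothing is discarded and `ℓ` vanishes on the whole span. -/
theorem reduce_spec (l : List V) (hl : LinearIndependent (ZMod 2) l.get) :
    LinearIndependent (ZMod 2) (reduce (functionalTest ℓ) (· + ·) l).1.get ∧
    (∀ x, x ∈ listSpan (reduce (functionalTest ℓ) (· + ·) l).1 ↔ x ∈ listSpan l ∧ ℓ x = 0) ∧
    (∀ p ∈ (reduce (functionalTest ℓ) (· + ·) l).2, p ∈ listSpan l ∧ ℓ p = 1) ∧
    ((reduce (functionalTest ℓ) (· + ·) l).2 = none → ∀ x ∈ listSpan l, ℓ x = 0) := by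
  have hs := span_foldl_reduceStep ℓ ([], none) l
  have hlen := reduce_length (functionalTest ℓ) (· + ·) l
  have hv := foldl_reduceStep_values ℓ ([], none) l (by simp) (by simp)
  have hs' : listSpan ((reduce (functionalTest ℓ) (· + ·) l).2.toList ++
      (reduce (functionalTest ℓ) (· + ·) l).1) = listSpan l := by
    refine Eq.trans ?_ (hs.trans ?_)
    · exact listSpan_congr fun x => by simp [reduce, or_comm]
    · exact listSpan_congr fun x => by simp
  have hv1 : ∀ w ∈ (reduce (functionalTest ℓ) (· + ·) l).1, ℓ w = 0 := fun w hw =>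
    hv.1 w (List.mem_reverse.1 hw)
  have hv2 : ∀ w ∈ (reduce (functionalTest ℓ) (· + ·) l).2, ℓ w = 1 := hv.2
  generalize reduce (functionalTest ℓ) (· + ·) l = r at *
  obtain ⟨acc, piv⟩ := r
  dsimp only at *
  have hker : listSpan acc ≤ LinearMap.ker ℓ := Submodule.span_le.2 fun x hx => hv1 x hx
  -- The list has the span and the length of the independent list `l`.
  have hli : LinearIndependent (ZMod 2) (piv.toList ++ acc).get := by
    rw [linearIndependent_get_iff] at hl ⊢
    rw [hs', hl, List.length_append]
    omega
  cases piv with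
  | none =>
    refine ⟨hli, fun x => ?_, by simp, fun _ x hx => ?_⟩
    · rw [← hs']
      exact ⟨fun h => ⟨h, hker h⟩, fun h => h.1⟩
    · rw [← hs'] at hx
      exact hker hx
  | some p =>
    have hp := hv2 p rfl
    have hsp : listSpan l = Submodule.span (ZMod 2) {p} ⊔ listSpan acc := by
      rw [← hs', listSpan_append, Option.toList_some, listSpan_singleton]
    -- The pivot is the head of the independent list, and dropping it shifts the indices by one.
    refine ⟨hli.comp Fin.succ (Fin.succ_injective _), fun x => ?_, ?_, by simp⟩
    · rw [hsp]
      refine ⟨fun h => ⟨Submodule.mem_sup_right h, hker h⟩, fun ⟨h, h0⟩ => ?_⟩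
      obtain ⟨y, hy, z, hz, rfl⟩ := Submodule.mem_sup.1 h
      obtain ⟨c, rfl⟩ := Submodule.mem_span_singleton.1 hy
      have hz0 : ℓ z = 0 := hker hz
      -- On `c • p + z` the value of `ℓ` is `c`.
      rw [map_add, map_smul, hp, hz0, add_zero, smul_eq_mul, mul_one] at h0
      rwa [h0, zero_smul, zero_add]
    · rintro _ ⟨⟩
      rw [hsp]
      exact ⟨Submodule.mem_sup_left (Submodule.mem_span_singleton_self p), hp⟩

/-- The control flow depends only on the tests, and the new vectors only on sums, so an encoding
that respects both commutes with elimination. This carries `reduce_spec` over to bit strings. -/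
theorem reduce_map {α β : Type*} (f : α → β) {q : α → Bool} {q' : β → Bool}
    {add : α → α → α} {add' : β → β → β} (hq : ∀ a, q' (f a) = q a)
    (hadd : ∀ a b, add' (f a) (f b) = f (add a b)) (l : List α) :
    reduce q' add' (l.map f) = ((reduce q add l).1.map f, (reduce q add l).2.map f) := by
  have h : ∀ (l : List α) (s : List α × Option α),
      (l.map f).foldl (reduceStep q' add') (s.1.map f, s.2.map f) =
        ((l.foldl (reduceStep q add) s).1.map f, (l.foldl (reduceStep q add) s).2.map f) := by
    intro l
    induction l with
    | nil => intro s; rfl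
    | cons a l ih =>
      intro s
      rw [List.map_cons, List.foldl_cons, List.foldl_cons, ← ih]
      congr 1
      obtain ⟨acc, _ | p⟩ := s <;> simp only [reduceStep, hq, Option.map] <;> split_ifs <;>
        simp [hadd]
  have h' := h l ([], none)
  simp only [List.map_nil, Option.map_none] at h'
  simp [reduce, h']

end LinearAlgebra

end BlandJensenMachine

/-! ### Signings of set systems -/

namespace SignedSubset

variable {α : Type*}

/-- The set `X` signed by `f`: `e` is positive if `f e = 0` and negative if `f e = 1`. -/
def ofFun (X : Set α) (f : α → ZMod 2) : SignedSubset α where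
  pos := {e | e ∈ X ∧ f e = 0}
  neg := {e | e ∈ X ∧ f e = 1}
  disj := by
    rw [Set.disjoint_left]
    rintro e ⟨-, h0⟩ ⟨-, h1⟩
    exact zero_ne_one (h0.symm.trans h1)

theorem zmod_two_cases (a : ZMod 2) : a = 0 ∨ a = 1 := by
  revert a; decide

theorem supp_ofFun (X : Set α) (f : α → ZMod 2) : (ofFun X f).supp = X := by
  ext e
  simp only [supp, ofFun, Set.mem_union, Set.mem_ofPred_eq, ← and_or_left]
  exact and_iff_left (zmod_two_cases (f e))

theorem opp_ofFun (X : Set α) (f : α → ZMod 2) : (ofFun X f).opp = ofFun X (fun e => f e + 1) := by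
  have h0 : ∀ a : ZMod 2, a = 1 ↔ a + 1 = 0 := by decide
  have h1 : ∀ a : ZMod 2, a = 0 ↔ a + 1 = 1 := by decide
  ext e
  · exact and_congr_right fun _ => h0 (f e)
  · exact and_congr_right fun _ => h1 (f e)

theorem supp_opp (Z : SignedSubset α) : Z.opp.supp = Z.supp :=
  Set.union_comm _ _

theorem opp_opp (Z : SignedSubset α) : Z.opp.opp = Z :=
  rfl

theorem ofFun_congr {X : Set α} {f g : α → ZMod 2} (h : ∀ e ∈ X, f e = g e) :
    ofFun X f = ofFun X g := by
  ext e <;> exact and_congr_right fun he => by rw [h e he]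

theorem ofFun_eq_iff {X : Set α} {f g : α → ZMod 2} :
    ofFun X f = ofFun X g ↔ ∀ e ∈ X, f e = g e := by
  refine ⟨fun h e he => ?_, ofFun_congr⟩
  rcases zmod_two_cases (f e) with h0 | h1
  · have : e ∈ (ofFun X g).pos := h ▸ ⟨he, h0⟩
    exact h0.trans this.2.symm
  · have : e ∈ (ofFun X g).neg := h ▸ ⟨he, h1⟩
    exact h1.trans this.2.symm

theorem exists_eq_ofFun (Z : SignedSubset α) : ∃ f, Z = ofFun Z.supp f := by
  classical
  refine ⟨fun e => if e ∈ Z.neg then 1 else 0, ?_⟩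
  have hd := Set.disjoint_left.1 Z.disj
  ext e
  · by_cases h : e ∈ Z.neg
    · simp only [ofFun, Set.mem_ofPred_eq, h, if_true, one_ne_zero, and_false, iff_false]
      exact fun h' => hd h' h
    · simp [ofFun, h, supp]
  · by_cases h : e ∈ Z.neg <;> simp [ofFun, h, supp]

/-- Reversing one of the sets exchanges agreements and disagreements, that is, the two sides of the
equivalence. -/
theorem orthogonal_opp_left (X Y : SignedSubset α) : X.opp.Orthogonal Y ↔ X.Orthogonal Y := by
  unfold Orthogonal opp
  dsimp only
  rw [Set.union_comm (X.neg ∩ Y.pos), Set.union_comm (X.neg ∩ Y.neg)]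
  exact iff_comm

theorem orthogonal_opp_right (X Y : SignedSubset α) : X.Orthogonal Y.opp ↔ X.Orthogonal Y :=
  iff_comm

/-- At each of `a` and `b` the signs either agree or disagree. Hence orthogonality asks for
agreement at exactly one of them, so that `f a + g a` and `f b + g b` differ. -/
theorem orthogonal_ofFun_iff {X Y : Set α} {f g : α → ZMod 2} {a b : α} (h : X ∩ Y = {a, b}) :
    (ofFun X f).Orthogonal (ofFun Y g) ↔ f a + g a + f b + g b + 1 = 0 := by
  have h1 : (((ofFun X f).pos ∩ (ofFun Y g).pos) ∪ ((ofFun X f).neg ∩ (ofFun Y g).neg)).Nonempty ↔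
      f a = g a ∨ f b = g b := by
    have : ((ofFun X f).pos ∩ (ofFun Y g).pos) ∪ ((ofFun X f).neg ∩ (ofFun Y g).neg) =
        {e | e ∈ ({a, b} : Set α) ∧ f e = g e} := by
      rw [← h]
      ext e
      have := zmod_two_cases (f e)
      have := zmod_two_cases (g e)
      simp only [ofFun, Set.mem_union, Set.mem_inter_iff, Set.mem_ofPred_eq]
      grind
    rw [this]
    constructor
    · rintro ⟨e, rfl | rfl, he⟩
      · exact Or.inl he
      · exact Or.inr he
    · rintro (he | he)
      · exact ⟨a, Or.inl rfl, he⟩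
      · exact ⟨b, Or.inr rfl, he⟩
  have h2 : (((ofFun X f).pos ∩ (ofFun Y g).neg) ∪ ((ofFun X f).neg ∩ (ofFun Y g).pos)).Nonempty ↔
      f a ≠ g a ∨ f b ≠ g b := by
    have : ((ofFun X f).pos ∩ (ofFun Y g).neg) ∪ ((ofFun X f).neg ∩ (ofFun Y g).pos) =
        {e | e ∈ ({a, b} : Set α) ∧ f e ≠ g e} := by
      rw [← h]
      ext e
      have := zmod_two_cases (f e)
      have := zmod_two_cases (g e)
      simp only [ofFun, Set.mem_union, Set.mem_inter_iff, Set.mem_ofPred_eq]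
      grind
    rw [this]
    constructor
    · rintro ⟨e, rfl | rfl, he⟩
      · exact Or.inl he
      · exact Or.inr he
    · rintro (he | he)
      · exact ⟨a, Or.inl rfl, he⟩
      · exact ⟨b, Or.inr rfl, he⟩
  unfold Orthogonal
  rw [h1, h2]
  generalize f a = p, g a = q, f b = r, g b = s
  revert p q r s
  decide

/-- All sets of the system `S`, signed by `F`, and their opposites. -/
def signedSystem (S : Set (Set α)) (F : Set α → α → ZMod 2) : Set (SignedSubset α) :=
  {Z | ∃ X ∈ S, Z = ofFun X (F X) ∨ Z = (ofFun X (F X)).opp}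

theorem signedSystem_congr {S : Set (Set α)} {F G : Set α → α → ZMod 2}
    (h : ∀ X ∈ S, ∀ e ∈ X, F X e = G X e) : signedSystem S F = signedSystem S G := by
  ext Z
  refine exists_congr fun X => and_congr_right fun hX => ?_
  rw [ofFun_congr (h X hX)]

theorem supp_of_mem {S : Set (Set α)} {F : Set α → α → ZMod 2} {Z : SignedSubset α}
    (hZ : Z ∈ signedSystem S F) :
    Z.supp ∈ S ∧ (Z = ofFun Z.supp (F Z.supp) ∨ Z = (ofFun Z.supp (F Z.supp)).opp) := by
  obtain ⟨X, hX, h⟩ := hZ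
  have hs : Z.supp = X := by
    rcases h with rfl | rfl
    · exact supp_ofFun _ _
    · rw [supp_opp, supp_ofFun]
  rw [hs]
  exact ⟨hX, h⟩

theorem supp_image_signedSystem (S : Set (Set α)) (F : Set α → α → ZMod 2) :
    supp '' signedSystem S F = S := by
  ext X
  refine ⟨?_, fun hX => ⟨_, ⟨X, hX, Or.inl rfl⟩, supp_ofFun _ _⟩⟩
  rintro ⟨Z, hZ, rfl⟩
  exact (supp_of_mem hZ).1

/-- In an antichain an inclusion of supports is an equality, and each support carries just one
signing and its opposite. -/
theorem isSignedClutter_signedSystem {S : Set (Set α)} (hS : IsAntichain (· ⊆ ·) S)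
    (F : Set α → α → ZMod 2) : IsSignedClutter (signedSystem S F) := by
  constructor
  · ext Z
    constructor
    · rintro ⟨Z, ⟨X, hX, rfl | rfl⟩, rfl⟩
      · exact ⟨X, hX, Or.inr rfl⟩
      · exact ⟨X, hX, Or.inl rfl⟩
    · rintro ⟨X, hX, rfl | rfl⟩
      · exact ⟨_, ⟨X, hX, Or.inr rfl⟩, rfl⟩
      · exact ⟨_, ⟨X, hX, Or.inl rfl⟩, rfl⟩
  · intro X hX Z hZ h
    obtain ⟨hX1, hX2⟩ := supp_of_mem hX
    obtain ⟨hZ1, hZ2⟩ := supp_of_mem hZ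
    have hs : Z.supp = X.supp := hS.eq hZ1 hX1 h
    rw [hs] at hZ2
    generalize ofFun X.supp (F X.supp) = U at hX2 hZ2
    rcases hX2 with rfl | rfl
    · exact hZ2
    · rw [opp_opp]; exact hZ2.symm

/-- Pick one member for every support; by the clutter condition each member with the same support is
this one or its opposite. -/
theorem IsSignedClutter.exists_eq_signedSystem {O : Set (SignedSubset α)}
    (hO : IsSignedClutter O) : ∃ F, O = signedSystem (supp '' O) F := by
  have h : ∀ X, ∃ f, X ∈ supp '' O → ofFun X f ∈ O := by
    intro X
    by_cases hX : X ∈ supp '' O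
    · obtain ⟨Z, hZ, rfl⟩ := hX
      obtain ⟨f, hf⟩ := exists_eq_ofFun Z
      exact ⟨f, fun _ => hf ▸ hZ⟩
    · exact ⟨0, fun h => absurd h hX⟩
  choose F hF using h
  refine ⟨F, Set.ext fun Z => ⟨fun hZ => ?_, ?_⟩⟩
  · have hs : Z.supp ∈ supp '' O := ⟨Z, hZ, rfl⟩
    exact ⟨Z.supp, hs, hO.2 _ (hF _ hs) Z hZ (supp_ofFun _ _).ge⟩
  · rintro ⟨X, hX, rfl | rfl⟩
    · exact hF X hX
    · rw [← hO.1]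
      exact ⟨_, hF X hX, rfl⟩

/-- A set has only two signings in each system, opposite to each other, so the systems agree when `F
X` and `G X` differ on `X` by the constant 0 or by the constant 1. -/
theorem signedSystem_eq_iff {S : Set (Set α)} {F G : Set α → α → ZMod 2} :
    signedSystem S F = signedSystem S G ↔
      ∀ X ∈ S, ∀ a ∈ X, ∀ b ∈ X, F X a - G X a = F X b - G X b := by
  constructor
  · intro h X hX a ha b hb
    have hm : ofFun X (F X) ∈ signedSystem S G := h ▸ ⟨X, hX, Or.inl rfl⟩
    have hm' := (supp_of_mem hm).2
    rw [supp_ofFun] at hm'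
    rcases hm' with e | e
    · rw [ofFun_eq_iff] at e
      rw [e a ha, e b hb, sub_self, sub_self]
    · rw [opp_ofFun, ofFun_eq_iff] at e
      rw [e a ha, e b hb, add_sub_cancel_left, add_sub_cancel_left]
  · intro h
    have key : ∀ F G : Set α → α → ZMod 2,
        (∀ X ∈ S, ∀ a ∈ X, ∀ b ∈ X, F X a - G X a = F X b - G X b) →
        signedSystem S F ⊆ signedSystem S G := by
      intro F G h Z hZ
      obtain ⟨X, hX, hZ⟩ := hZ
      refine ⟨X, hX, ?_⟩
      have hd : ofFun X (F X) = ofFun X (G X) ∨ ofFun X (F X) = (ofFun X (G X)).opp := by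
        rw [opp_ofFun, ofFun_eq_iff, ofFun_eq_iff]
        -- On the empty set all signings coincide; otherwise a point of `X` determines the constant.
        rcases X.eq_empty_or_nonempty with rfl | ⟨a, ha⟩
        · left; simp
        · rcases zmod_two_cases (F X a - G X a) with h0 | h1
          · left
            intro b hb
            rw [← sub_eq_zero, ← h X hX a ha b hb, h0]
          · right
            intro b hb
            rw [← sub_eq_iff_eq_add', ← h X hX a ha b hb, h1]
      rcases hd with hd | hd <;> rw [hd] at hZ
      · exact hZ
      · rw [opp_opp] at hZ; exact hZ.symm
    refine (key F G h).antisymm (key G F fun X hX a ha b hb => ?_)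
    rw [← neg_sub, h X hX a ha b hb, neg_sub]

end SignedSubset

/-! ### Weak orientations as solutions of the Bland-Jensen system -/

namespace Matroid

variable {α : Type*} (M : Matroid α)

open SignedSubset

open Classical in
/-- The signs of the elements of the circuits given by `x`. -/
noncomputable def circuitSigns (x : M.BJVar → ZMod 2) (X : Set α) (e : α) : ZMod 2 :=
  if h : M.IsCircuit X ∧ e ∈ X then x (Sum.inl ⟨e, X, h.1, h.2⟩) else 0

open Classical in
/-- The signs of the elements of the cocircuits given by `x`. -/
noncomputable def cocircuitSigns (x : M.BJVar → ZMod 2) (Y : Set α) (e : α) : ZMod 2 :=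
  if h : M.IsCocircuit Y ∧ e ∈ Y then x (Sum.inr ⟨e, Y, h.1, h.2⟩) else 0

variable {M}

theorem circuitSigns_eq (x : M.BJVar → ZMod 2) (i : M.CircuitVar) :
    M.circuitSigns x i.set i.elt = x (Sum.inl i) :=
  dif_pos ⟨i.isCircuit, i.mem⟩

theorem cocircuitSigns_eq (x : M.BJVar → ZMod 2) (i : M.CocircuitVar) :
    M.cocircuitSigns x i.set i.elt = x (Sum.inr i) :=
  dif_pos ⟨i.isCocircuit, i.mem⟩

theorem signedCircuit_eq (x : M.BJVar → ZMod 2) (X : Set α) (hX : M.IsCircuit X) :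
    M.signedCircuit x X hX = ofFun X (M.circuitSigns x X) := by
  ext e
  · constructor
    · rintro ⟨h, h0⟩
      exact ⟨h, (circuitSigns_eq x ⟨e, X, hX, h⟩).trans h0⟩
    · rintro ⟨h, h0⟩
      exact ⟨h, (circuitSigns_eq x ⟨e, X, hX, h⟩).symm.trans h0⟩
  · constructor
    · rintro ⟨h, h0⟩
      exact ⟨h, (circuitSigns_eq x ⟨e, X, hX, h⟩).trans h0⟩
    · rintro ⟨h, h0⟩
      exact ⟨h, (circuitSigns_eq x ⟨e, X, hX, h⟩).symm.trans h0⟩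

theorem signedCocircuit_eq (x : M.BJVar → ZMod 2) (Y : Set α) (hY : M.IsCocircuit Y) :
    M.signedCocircuit x Y hY = ofFun Y (M.cocircuitSigns x Y) := by
  ext e
  · constructor
    · rintro ⟨h, h0⟩
      exact ⟨h, (cocircuitSigns_eq x ⟨e, Y, hY, h⟩).trans h0⟩
    · rintro ⟨h, h0⟩
      exact ⟨h, (cocircuitSigns_eq x ⟨e, Y, hY, h⟩).symm.trans h0⟩
  · constructor
    · rintro ⟨h, h0⟩
      exact ⟨h, (cocircuitSigns_eq x ⟨e, Y, hY, h⟩).trans h0⟩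
    · rintro ⟨h, h0⟩
      exact ⟨h, (cocircuitSigns_eq x ⟨e, Y, hY, h⟩).symm.trans h0⟩

theorem signingOf_eq (x : M.BJVar → ZMod 2) :
    M.signingOf x = (signedSystem {C | M.IsCircuit C} (M.circuitSigns x),
      signedSystem {K | M.IsCocircuit K} (M.cocircuitSigns x)) := by
  refine Prod.ext (Set.ext fun Z => ?_) (Set.ext fun Z => ?_)
  · refine exists_congr fun X => ?_
    rw [← exists_prop]
    exact exists_congr fun hX => by rw [signedCircuit_eq]
  · refine exists_congr fun X => ?_
    rw [← exists_prop]
    exact exists_congr fun hX => by rw [signedCocircuit_eq]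

theorem signingOf_eq_iff (x y : M.BJVar → ZMod 2) :
    M.signingOf x = M.signingOf y ↔ M.SignEquivalent x y := by
  rw [signingOf_eq, signingOf_eq, Prod.mk.injEq, signedSystem_eq_iff, signedSystem_eq_iff]
  refine and_congr ⟨fun h i j hij => ?_, fun h X hX a ha b hb => ?_⟩
    ⟨fun h i j hij => ?_, fun h X hX a ha b hb => ?_⟩
  · have := h i.set i.isCircuit i.elt i.mem j.elt (hij ▸ j.mem)
    rwa [circuitSigns_eq, circuitSigns_eq, hij, circuitSigns_eq, circuitSigns_eq] at this
  · have := h ⟨a, X, hX, ha⟩ ⟨b, X, hX, hb⟩ rfl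
    rwa [← circuitSigns_eq x, ← circuitSigns_eq y, ← circuitSigns_eq x,
      ← circuitSigns_eq y] at this
  · have := h i.set i.isCocircuit i.elt i.mem j.elt (hij ▸ j.mem)
    rwa [cocircuitSigns_eq, cocircuitSigns_eq, hij, cocircuitSigns_eq, cocircuitSigns_eq] at this
  · have := h ⟨a, X, hX, ha⟩ ⟨b, X, hX, hb⟩ rfl
    rwa [← cocircuitSigns_eq x, ← cocircuitSigns_eq y, ← cocircuitSigns_eq x,
      ← cocircuitSigns_eq y] at this

/-- Circuits form an antichain, and so do cocircuits, being circuits of the dual matroid. -/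
theorem isSigning_signingOf (x : M.BJVar → ZMod 2) :
    M.IsSigning (M.signingOf x).1 (M.signingOf x).2 := by
  rw [signingOf_eq]
  exact ⟨isSignedClutter_signedSystem (fun X hX Y hY hne h => hne (hX.eq_of_subset_isCircuit hY h)) _,
    isSignedClutter_signedSystem (fun X hX Y hY hne h => hne (hX.eq_of_subset_isCircuit hY h)) _,
    supp_image_signedSystem _ _, supp_image_signedSystem _ _⟩

theorem IsSigning.exists_eq_signingOf {O O' : Set (SignedSubset α)} (h : M.IsSigning O O') :
    ∃ x, (O, O') = M.signingOf x := by
  obtain ⟨h1, h2, h3, h4⟩ := h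
  obtain ⟨F, hF⟩ := h1.exists_eq_signedSystem
  obtain ⟨G, hG⟩ := h2.exists_eq_signedSystem
  obtain ⟨x, hx, hx'⟩ : ∃ x : M.BJVar → ZMod 2,
      (∀ i, x (Sum.inl i) = F i.set i.elt) ∧ ∀ i, x (Sum.inr i) = G i.set i.elt :=
    ⟨Sum.elim (fun i => F i.set i.elt) (fun i => G i.set i.elt), fun _ => rfl, fun _ => rfl⟩
  refine ⟨x, ?_⟩
  rw [signingOf_eq, hF, hG, h3, h4, Prod.mk.injEq]
  exact ⟨signedSystem_congr fun X hX e he =>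
      (hx _).symm.trans (circuitSigns_eq x ⟨e, X, hX, he⟩).symm,
    signedSystem_congr fun X hX e he =>
      (hx' _).symm.trans (cocircuitSigns_eq x ⟨e, X, hX, he⟩).symm⟩

theorem BJEquation.linearForm_eq (q : M.BJEquation) (x : M.BJVar → ZMod 2) :
    q.linearForm x = M.circuitSigns x q.circuit q.e + M.cocircuitSigns x q.cocircuit q.e +
      M.circuitSigns x q.circuit q.f + M.cocircuitSigns x q.cocircuit q.f := by
  rw [circuitSigns_eq x ⟨q.e, q.circuit, q.isCircuit, q.e_mem.1⟩,
    cocircuitSigns_eq x ⟨q.e, q.cocircuit, q.isCocircuit, q.e_mem.2⟩,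
    circuitSigns_eq x ⟨q.f, q.circuit, q.isCircuit, q.f_mem.1⟩,
    cocircuitSigns_eq x ⟨q.f, q.cocircuit, q.isCocircuit, q.f_mem.2⟩]
  rfl

/-- Orthogonality is insensitive to reversal, so it suffices to test the chosen signing of each set,
where it is the linear equation. -/
theorem isWeakOrientation_signingOf_iff (x : M.BJVar → ZMod 2) :
    M.IsWeakOrientation (M.signingOf x).1 (M.signingOf x).2 ↔ x ∈ M.bjSolutions := by
  rw [IsWeakOrientation, and_iff_right (isSigning_signingOf x), signingOf_eq]
  constructor
  · intro h q
    have := h _ ⟨q.circuit, q.isCircuit, Or.inl rfl⟩ _ ⟨q.cocircuit, q.isCocircuit, Or.inl rfl⟩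
    rw [supp_ofFun, supp_ofFun, q.inter_eq, Set.ncard_pair q.ne,
      orthogonal_ofFun_iff q.inter_eq, ← q.linearForm_eq] at this
    exact this rfl
  · rintro h Z ⟨X, hX, hZ⟩ W ⟨Y, hY, hW⟩ hc
    have hs : Z.supp = X := by
      rcases hZ with rfl | rfl
      · exact supp_ofFun _ _
      · rw [supp_opp, supp_ofFun]
    have hs' : W.supp = Y := by
      rcases hW with rfl | rfl
      · exact supp_ofFun _ _
      · rw [supp_opp, supp_ofFun]
    rw [hs, hs', Set.ncard_eq_two] at hc
    obtain ⟨a, b, hab, he⟩ := hc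
    have := h ⟨X, Y, a, b, hX, hY, hab, he⟩
    rw [BJEquation.linearForm_eq, ← orthogonal_ofFun_iff he] at this
    rcases hZ with rfl | rfl <;> rcases hW with rfl | rfl
    · exact this
    · rwa [orthogonal_opp_right]
    · rwa [orthogonal_opp_left]
    · rwa [orthogonal_opp_left, orthogonal_opp_right]

theorem isWeakOrientation_iff (P : Set (SignedSubset α) × Set (SignedSubset α)) :
    M.IsWeakOrientation P.1 P.2 ↔ ∃ x ∈ M.bjSolutions, P = M.signingOf x := by
  constructor
  · intro h
    obtain ⟨x, hx⟩ := h.1.exists_eq_signingOf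
    refine ⟨x, ?_, hx⟩
    rw [← isWeakOrientation_signingOf_iff, ← hx]
    exact h
  · rintro ⟨x, hx, rfl⟩
    exact (isWeakOrientation_signingOf_iff x).2 hx

theorem weaklyOrientable_iff : M.WeaklyOrientable ↔ M.bjSolutions.Nonempty := by
  constructor
  · rintro ⟨O, O', h⟩
    obtain ⟨x, hx, -⟩ := (isWeakOrientation_iff (O, O')).1 h
    exact ⟨x, hx⟩
  · rintro ⟨x, hx⟩
    exact ⟨_, _, (isWeakOrientation_signingOf_iff x).2 hx⟩

theorem mem_bjNullSpace_iff (x : M.BJVar → ZMod 2) :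
    x ∈ M.bjNullSpace ↔ ∀ q : M.BJEquation, q.linearForm x = 0 := by
  simp [bjNullSpace, Submodule.mem_iInf]

/-- The solutions of the inhomogeneous system form the coset of the null space through any one
solution. -/
theorem AffineDescription.describesWeakOrientations {d : M.AffineDescription}
    (h1 : d.particular ∈ M.bjSolutions) (h2 : LinearIndependent (ZMod 2) d.basis.get)
    (h3 : Submodule.span (ZMod 2) {v | v ∈ d.basis} = M.bjNullSpace) :
    d.DescribesWeakOrientations := by
  refine ⟨h1, h2, h3, Set.ext fun P => ?_, fun v _ w _ => signingOf_eq_iff _ _⟩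
  rw [Set.mem_ofPred_eq, isWeakOrientation_iff, h3]
  constructor
  · rintro ⟨x, hx, rfl⟩
    refine ⟨x - d.particular, (mem_bjNullSpace_iff _).2 fun q => ?_, by rw [add_sub_cancel]⟩
    rw [map_sub, sub_eq_zero]
    exact add_right_cancel ((hx q).trans (h1 q).symm)
  · rintro ⟨v, hv, rfl⟩
    refine ⟨_, fun q => ?_, rfl⟩
    rw [map_add, (mem_bjNullSpace_iff v).1 hv q, add_zero]
    exact h1 q

end Matroid

namespace BlandJensenMachine

/-! ### Vectors of the system as strings of bits -/

theorem dot_append {l l' m m' : List Bool} (h : l.length = m.length) :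
    dot (l ++ l') (m ++ m') = (dot l m ^^ dot l' m') := by
  induction l generalizing m with
  | nil =>
    obtain rfl : m = [] := List.eq_nil_of_length_eq_zero h.symm
    simp [dot]
  | cons a l ih =>
    obtain _ | ⟨b, m⟩ := m
    · simp at h
    · simp [dot, ih (Nat.succ.inj h)]

theorem dot_replicate_false (n : ℕ) (m : List Bool) : dot (List.replicate n false) m = false := by
  induction n generalizing m with
  | zero => simp [dot]
  | succ n ih => cases m <;> simp [List.replicate_succ, dot, ih]

theorem decide_add_eq_one (a b : ZMod 2) :
    decide (a + b = 1) = (decide (a = 1) ^^ decide (b = 1)) := by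
  revert a b; decide

theorem dot_map {β : Type*} (l : List β) (p : β → Bool) (f : β → ZMod 2) :
    dot (l.map p) (l.map fun e => decide (f e = 1)) =
      decide ((l.map fun e => if p e then f e else 0).sum = 1) := by
  induction l with
  | nil => simp [dot]
  | cons a l ih =>
    rw [List.map_cons, List.map_cons, dot, ih, List.map_cons, List.sum_cons, decide_add_eq_one]
    congr 1
    cases p a <;> simp

theorem dot_finRange {n : ℕ} {a b : Fin n} (hab : a ≠ b) (p : Fin n → Bool)
    (hp : ∀ e, p e = true ↔ e = a ∨ e = b) (f : Fin n → ZMod 2) :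
    dot ((List.finRange n).map p) ((List.finRange n).map fun e => decide (f e = 1)) =
      decide (f a + f b = 1) := by
  have h : ((List.finRange n).map fun e => if p e then f e else 0).sum =
      ∑ e ∈ ({a, b} : Finset (Fin n)), f e := by
    rw [← List.ofFn_eq_map, List.sum_ofFn, Finset.sum_ite, Finset.sum_const_zero, add_zero]
    refine Finset.sum_congr (Finset.ext fun e => ?_) fun _ _ => rfl
    simp [hp]
  rw [dot_map, h, Finset.sum_pair hab]

/-- The values `f C e`, for all rows `C` of a list, as bits. A bit `0` follows each row. -/
def valueBits {n : ℕ} (rows : List (Finset (Fin n))) (f : Set (Fin n) → Fin n → ZMod 2) :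
    List Bool :=
  rows.flatMap fun C : Finset (Fin n) => (List.finRange n).map (fun e => decide (f C e = 1)) ++ [false]

/-- The characteristic vectors of a list of sets. -/
def rowBits {n : ℕ} (rows : List (Finset (Fin n))) : List (List Bool) :=
  rows.map fun C => (List.finRange n).map fun e => decide (e ∈ C)

theorem rowBits_cons {n : ℕ} (C : Finset (Fin n)) (rows : List (Finset (Fin n))) :
    rowBits (C :: rows) = ((List.finRange n).map fun e => decide (e ∈ C)) :: rowBits rows :=
  rfl

section

variable {n : ℕ} (rows : List (Finset (Fin n)))

theorem valueBits_cons (C : Finset (Fin n)) (f : Set (Fin n) → Fin n → ZMod 2) :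
    valueBits (C :: rows) f =
      (List.finRange n).map (fun e => decide (f C e = 1)) ++ false :: valueBits rows f := by
  simp [valueBits]

theorem valueBits_append (rows' : List (Finset (Fin n))) (f : Set (Fin n) → Fin n → ZMod 2) :
    valueBits (rows ++ rows') f = valueBits rows f ++ valueBits rows' f := by
  simp [valueBits]

theorem length_valueBits (f : Set (Fin n) → Fin n → ZMod 2) :
    (valueBits rows f).length = (rowsWord (rowBits rows)).length := by
  induction rows with
  | nil => rfl
  | cons C rows ih =>
    rw [valueBits_cons, rowBits, List.map_cons, rowsWord_cons]
    simp only [List.length_append, List.length_map, List.length_cons, ih, rowBits]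

theorem valueBits_eq_replicate {f : Set (Fin n) → Fin n → ZMod 2}
    (h : ∀ C : Finset (Fin n), C ∈ rows → ∀ e, f C e ≠ 1) :
    valueBits rows f = List.replicate (rowsWord (rowBits rows)).length false := by
  refine List.eq_replicate_iff.2 ⟨length_valueBits rows f, fun b hb => ?_⟩
  simp only [valueBits, List.mem_flatMap, List.mem_append, List.mem_map, List.mem_singleton] at hb
  obtain ⟨C, hC, ⟨e, -, rfl⟩ | rfl⟩ := hb
  · exact decide_eq_false (h C hC e)
  · rfl

theorem addBits_valueBits (f g : Set (Fin n) → Fin n → ZMod 2) :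
    addBits (valueBits rows f) (valueBits rows g) = valueBits rows fun C e => f C e + g C e := by
  induction rows with
  | nil => rfl
  | cons C rows ih =>
    rw [valueBits_cons, valueBits_cons, valueBits_cons, ← ih, addBits,
      List.zipWith_append (by simp), List.zipWith_map]
    simp [addBits, decide_add_eq_one]

theorem fill_rowsWord (f : Set (Fin n) → Fin n → ZMod 2) :
    fill (rowsWord (rowBits rows)) (valueBits rows f) =
      rows.flatMap fun C : Finset (Fin n) => MatroidInstance.encodeRow fun e => decide (f C e = 1) := by
  induction rows with
  | nil => rfl
  | cons C rows ih =>
    rw [valueBits_cons, rowBits, List.map_cons, rowsWord_cons, List.flatMap_cons, ← ih, fill,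
      List.zipWith_append (by simp)]
    simp [fill, fillSymbol, MatroidInstance.encodeRow, rowBits]

theorem rowsWord_rowBits :
    rowsWord (rowBits rows) =
      rows.flatMap fun C : Finset (Fin n) => MatroidInstance.encodeRow fun e => decide (e ∈ C) := by
  simp [rowsWord, rowBits, MatroidInstance.encodeRow, List.flatMap_map, Function.comp_def]

theorem length_of_mem_rowBits : ∀ c ∈ rowBits rows, c.length = n := by
  simp [rowBits]

/-- The blocks of the two strings are aligned; only the leading bit and the blocks of `X` and `Y`
meet nonzero coefficients. -/
theorem dot_equationBits (rows' : List (Finset (Fin n))) (c₁ c₂ d₁ d₂ : List (Finset (Fin n)))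
    (X Y : Finset (Fin n)) (hr : rows = c₁ ++ X :: c₂) (hr' : rows' = d₁ ++ Y :: d₂)
    (z : List Bool) (hz : z.length = n) (b : Bool) (f g : Set (Fin n) → Fin n → ZMod 2) :
    dot (equationBits (rowsWord (rowBits c₁)).length (rowsWord (rowBits c₂)).length
        (rowsWord (rowBits d₁)).length (rowsWord (rowBits d₂)).length z)
      (b :: (valueBits rows f ++ false :: valueBits rows' g)) =
    (b ^^ (dot z ((List.finRange n).map fun e => decide (f X e = 1)) ^^
      dot z ((List.finRange n).map fun e => decide (g Y e = 1)))) := by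
  rw [hr, hr', valueBits_append, valueBits_append, valueBits_cons, valueBits_cons, equationBits,
    dot, List.append_assoc, dot_append (by simp [length_valueBits]), dot_replicate_false,
    List.append_assoc, dot_append (by simp [hz]), List.cons_append, dot,
    dot_append (by simp [length_valueBits]), dot_replicate_false, dot,
    dot_append (by simp [length_valueBits]), dot_replicate_false, dot_append (by simp [hz]), dot,
    dot_replicate_false]
  simp

end

theorem count_andBits {n : ℕ} (X Y : Finset (Fin n)) :
    (andBits ((List.finRange n).map fun e => decide (e ∈ X))
      ((List.finRange n).map fun e => decide (e ∈ Y))).count true = (X ∩ Y).card := by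
  have h : X ∩ Y = ((List.finRange n).filter fun e => decide (e ∈ X) && decide (e ∈ Y)).toFinset := by
    ext e; simp
  rw [h, List.toFinset_card_of_nodup ((List.nodup_finRange n).filter _), andBits, List.zipWith_map,
    List.zipWith_self, List.count, List.countP_map, List.countP_eq_length_filter]
  congr 2
  funext e
  simp

/-! ### The unit vectors -/

/-- The unit vectors for the bits `1` of a word, with `i` symbols before it and `j` after it. -/
def unitVectorsBetween (i : ℕ) : List TapeSymbol → ℕ → List (List Bool)
  | [], _ => []
  | a :: w, j =>
    if a = .bit true then unitBits i (w.length + j) :: unitVectorsBetween (i + 1) w j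
    else unitVectorsBetween (i + 1) w j

/-- A unit vector knows how many symbols follow it, so cutting a word requires the count `j` in
`unitVectorsBetween`. -/
theorem unitVectors_append (i : ℕ) (w w' : List TapeSymbol) :
    unitVectors i (w ++ w') =
      unitVectorsBetween i w w'.length ++ unitVectors (i + w.length) w' := by
  induction w generalizing i with
  | nil => rfl
  | cons a w ih =>
    rw [List.cons_append, unitVectors, unitVectorsBetween, ih, List.length_append,
      List.length_cons, Nat.add_right_comm, ← Nat.add_assoc]
    split_ifs <;> rfl

theorem unitVectors_eq (i : ℕ) (w : List TapeSymbol) :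
    unitVectors i w = unitVectorsBetween i w 0 := by
  have h := unitVectors_append i w []
  rwa [List.append_nil, unitVectors, List.append_nil] at h

theorem unitVectorsBetween_append (i : ℕ) (w w' : List TapeSymbol) (j : ℕ) :
    unitVectorsBetween i (w ++ w') j =
      unitVectorsBetween i w (w'.length + j) ++ unitVectorsBetween (i + w.length) w' j := by
  induction w generalizing i with
  | nil => rfl
  | cons a w ih =>
    rw [List.cons_append, unitVectorsBetween, unitVectorsBetween, ih, List.length_append,
      List.length_cons, Nat.add_right_comm i 1, ← Nat.add_assoc, Nat.add_assoc w.length]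
    split_ifs <;> rfl

/-- The string `v` with zeros before and after it, and a leading zero. -/
def padBits (i : ℕ) (v : List Bool) (j : ℕ) : List Bool :=
  false :: (List.replicate i false ++ (v ++ List.replicate j false))

theorem unitVectorsBetween_map {β : Type*} [DecidableEq β] (l : List β) (hl : l.Nodup)
    (p : β → Bool) (i j : ℕ) :
    unitVectorsBetween i ((l.map p).map .bit) j =
      (l.filter p).map fun e => padBits i (l.map fun f => decide (f = e)) j := by
  induction l generalizing i with
  | nil => rfl
  | cons a l ih =>
    obtain ⟨ha, hl⟩ := List.nodup_cons.1 hl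
    have h1 : ∀ e ∈ l.filter p, padBits (i + 1) (l.map fun f => decide (f = e)) j =
        padBits i ((a :: l).map fun f => decide (f = e)) j := by
      intro e he
      have : a ≠ e := fun h => ha (h ▸ List.mem_of_mem_filter he)
      simp [padBits, List.replicate_succ', this]
    have h2 : (l.map fun f => decide (f = a)) = List.replicate l.length false :=
      List.eq_replicate_iff.2 ⟨by simp, by
        intro b hb
        obtain ⟨f, hf, rfl⟩ := List.mem_map.1 hb
        exact decide_eq_false fun h => ha (h ▸ hf)⟩
    rw [List.map_cons, List.map_cons, unitVectorsBetween, ih hl, List.map_congr_left h1,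
      List.filter_cons]
    cases hp : p a
    · simp
    · simp only [if_true, List.map_cons, decide_true, h2, List.length_map]
      congr 1
      simp [padBits, unitBits]

/-- The indicator function of a row and an element. -/
noncomputable def indicator {n : ℕ} (p : Finset (Fin n) × Fin n) (C : Set (Fin n)) (e : Fin n) : ZMod 2 :=
  open Classical in if C = p.1 ∧ e = p.2 then 1 else 0

/-- All pairs of a row and an element of the row. -/
def incidences {n : ℕ} (rows : List (Finset (Fin n))) : List (Finset (Fin n) × Fin n) :=
  (rows ×ˢ List.finRange n).filter fun p => decide (p.2 ∈ p.1)

theorem nodup_incidences {n : ℕ} {rows : List (Finset (Fin n))} (h : rows.Nodup) :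
    (incidences rows).Nodup :=
  (h.product (List.nodup_finRange n)).filter _

theorem mem_incidences {n : ℕ} {rows : List (Finset (Fin n))} {p : Finset (Fin n) × Fin n} :
    p ∈ incidences rows ↔ p.1 ∈ rows ∧ p.2 ∈ p.1 := by
  obtain ⟨C, e⟩ := p
  simp [incidences]

theorem incidences_cons {n : ℕ} (C : Finset (Fin n)) (rows : List (Finset (Fin n))) :
    incidences (C :: rows) =
      ((List.finRange n).filter fun e => decide (e ∈ C)).map (C, ·) ++ incidences rows := by
  rw [incidences, List.product_cons, List.filter_append, List.filter_map]
  rfl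

theorem indicator_ne_one {n : ℕ} {p : Finset (Fin n) × Fin n} {C : Finset (Fin n)} {e : Fin n}
    (h : C ≠ p.1) : indicator p C e ≠ 1 := by
  rw [indicator, if_neg]
  · exact zero_ne_one
  · exact fun h' => h (Finset.coe_injective h'.1)

/-- Since no row is repeated, the indicator of an incidence vanishes on all other rows, and its
encoding has a single 1, at the place of that incidence in the word. -/
theorem unitVectorsBetween_rowsWord {n : ℕ} (rows : List (Finset (Fin n))) (h : rows.Nodup)
    (i j : ℕ) :
    unitVectorsBetween i (rowsWord (rowBits rows)) j =
      (incidences rows).map fun p => padBits i (valueBits rows (indicator p)) j := by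
  induction rows generalizing i with
  | nil => rfl
  | cons C rows ih =>
    obtain ⟨hC, h⟩ := List.nodup_cons.1 h
    have h1 : ∀ e, padBits i ((List.finRange n).map fun f => decide (f = e))
        ((rowsWord (rowBits rows)).length + 1 + j) =
        padBits i (valueBits (C :: rows) (indicator (C, e))) j := by
      intro e
      rw [valueBits_cons, valueBits_eq_replicate]
      · have h2 : ∀ f, (indicator (C, e) C f = 1) = (f = e) := fun f => by
          simp [indicator]
        simp only [h2, padBits, List.append_assoc, List.cons_append, ← List.replicate_add]
        rw [Nat.add_right_comm, List.replicate_succ]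
      · rintro D hD f
        exact indicator_ne_one fun h' => hC ((show D = C from h') ▸ hD)
    have h2 : ∀ p ∈ incidences rows, padBits (i + (n + 1)) (valueBits rows (indicator p)) j =
        padBits i (valueBits (C :: rows) (indicator p)) j := by
      intro p hp
      have h3 : ((List.finRange n).map fun f => decide (indicator p C f = 1)) =
          List.replicate n false :=
        List.eq_replicate_iff.2 ⟨by simp, by
          intro b hb
          obtain ⟨f, hf, rfl⟩ := List.mem_map.1 hb
          exact decide_eq_false (indicator_ne_one fun h' => hC (h' ▸ (mem_incidences.1 hp).1))⟩
      rw [valueBits_cons, h3]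
      simp [padBits, List.replicate_add]
    have e1 : rowsWord (rowBits (C :: rows)) =
        ((List.finRange n).map fun e => decide (e ∈ C)).map .bit ++
          ([.comma] ++ rowsWord (rowBits rows)) := by
      rw [rowBits, List.map_cons, rowsWord_cons]; rfl
    rw [e1, unitVectorsBetween_append, unitVectorsBetween_map _ (List.nodup_finRange n),
      unitVectorsBetween_append, ih h, incidences_cons, List.map_append]
    refine congrArg₂ (· ++ ·) ((List.map_congr_left fun e _ => ?_).trans List.map_map.symm) ?_
    · rw [Function.comp_apply, ← h1]
      congr 1
    · rw [← List.map_congr_left h2]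
      simp [unitVectorsBetween, Nat.add_assoc]

/-! ### The algorithm on an instance -/

namespace Instance

open Matroid

variable (I : MatroidInstance)

/-- The assignments of the variables, together with a value for the constant term. -/
abbrev Vec : Type := Option I.M.BJVar → ZMod 2

/-- Forget the value for the constant term. -/
def forget : Vec I →ₗ[ZMod 2] (I.M.BJVar → ZMod 2) := LinearMap.funLeft (ZMod 2) (ZMod 2) some

/-- The value for the constant term. -/
def constantTerm : Vec I →ₗ[ZMod 2] ZMod 2 := LinearMap.proj none

/-- The left hand side of an equation. -/
def equationForm (q : I.M.BJEquation) : Vec I →ₗ[ZMod 2] ZMod 2 :=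
  q.linearForm ∘ₗ forget I + constantTerm I

/-- A vector as a string of bits, in the shape of the input word, after a bit for the constant
term. -/
noncomputable def vecBits (v : Vec I) : List Bool :=
  decide (v none = 1) :: (valueBits I.circuits (I.M.circuitSigns (forget I v)) ++
    false :: valueBits I.cocircuits (I.M.cocircuitSigns (forget I v)))

variable {I}

theorem circuitSigns_add (x y : I.M.BJVar → ZMod 2) :
    I.M.circuitSigns (x + y) = fun C e => I.M.circuitSigns x C e + I.M.circuitSigns y C e := by
  ext C e
  unfold circuitSigns
  split_ifs
  · rfl
  · rw [add_zero]

theorem cocircuitSigns_add (x y : I.M.BJVar → ZMod 2) :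
    I.M.cocircuitSigns (x + y) = fun C e => I.M.cocircuitSigns x C e + I.M.cocircuitSigns y C e := by
  ext C e
  unfold cocircuitSigns
  split_ifs
  · rfl
  · rw [add_zero]

theorem addBits_vecBits (u v : Vec I) :
    addBits (vecBits I u) (vecBits I v) = vecBits I (u + v) := by
  rw [vecBits, vecBits, vecBits, addBits, List.zipWith_cons_cons, List.zipWith_append
    (by simp [length_valueBits]), List.zipWith_cons_cons, ← addBits, ← addBits, addBits_valueBits,
    addBits_valueBits, Pi.add_apply, decide_add_eq_one, map_add,
    circuitSigns_add, cocircuitSigns_add, Bool.xor_false]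

theorem encode_eq : I.encode =
    rowsWord (rowBits I.circuits) ++ .semicolon :: rowsWord (rowBits I.cocircuits) := by
  rw [MatroidInstance.encode, rowsWord_rowBits, rowsWord_rowBits, List.append_assoc]
  rfl

theorem length_encode : I.encode.length = (rowsWord (rowBits I.circuits)).length +
    ((rowsWord (rowBits I.cocircuits)).length + 1) := by
  rw [encode_eq, List.length_append, List.length_cons]

theorem encodeVector_eq (x : I.M.BJVar → ZMod 2) : I.encodeVector x =
    fill (rowsWord (rowBits I.circuits)) (valueBits I.circuits (I.M.circuitSigns x)) ++
      .semicolon ::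
      fill (rowsWord (rowBits I.cocircuits)) (valueBits I.cocircuits (I.M.cocircuitSigns x)) := by
  have h1 : ∀ (C : Set (Fin I.n)) (e : Fin I.n),
      (∃ i : I.M.CircuitVar, i.elt = e ∧ i.set = C ∧ x (Sum.inl i) = 1) ↔
        I.M.circuitSigns x C e = 1 := by
    intro C e
    constructor
    · rintro ⟨i, rfl, rfl, h⟩
      rwa [circuitSigns_eq]
    · intro h
      unfold circuitSigns at h
      split_ifs at h with h'
      · exact ⟨⟨e, C, h'.1, h'.2⟩, rfl, rfl, h⟩
      · exact absurd h zero_ne_one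
  have h2 : ∀ (C : Set (Fin I.n)) (e : Fin I.n),
      (∃ i : I.M.CocircuitVar, i.elt = e ∧ i.set = C ∧ x (Sum.inr i) = 1) ↔
        I.M.cocircuitSigns x C e = 1 := by
    intro C e
    constructor
    · rintro ⟨i, rfl, rfl, h⟩
      rwa [cocircuitSigns_eq]
    · intro h
      unfold cocircuitSigns at h
      split_ifs at h with h'
      · exact ⟨⟨e, C, h'.1, h'.2⟩, rfl, rfl, h⟩
      · exact absurd h zero_ne_one
  rw [MatroidInstance.encodeVector, fill_rowsWord, fill_rowsWord]
  simp only [h1, h2, List.append_assoc, List.singleton_append]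
  simp [List.flatMap_map, ← List.map_eq_flatMap]

theorem outputWord_vecBits (v : Vec I) :
    outputWord I.encode (vecBits I v) = I.encodeVector (forget I v) ++ [.semicolon] := by
  rw [encodeVector_eq, outputWord, encode_eq, vecBits, List.tail_cons, fill, List.zipWith_append
    (by simp [length_valueBits])]
  rfl

/-- The vectors in the list are a basis of the subspace of vectors with the property `P`. -/
def IsBasisOf (vs : List (List Bool)) (P : Vec I → Prop) : Prop :=
  ∃ us : List (Vec I), vs = us.map (vecBits I) ∧ LinearIndependent (ZMod 2) us.get ∧
    ∀ v, v ∈ listSpan us ↔ P v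

theorem IsBasisOf.congr {vs : List (List Bool)} {P Q : Vec I → Prop} (h : IsBasisOf vs P)
    (hPQ : ∀ v, P v ↔ Q v) : IsBasisOf vs Q :=
  let ⟨us, h1, h2, h3⟩ := h
  ⟨us, h1, h2, fun v => (h3 v).trans (hPQ v)⟩

/-- All equations for `X` and `Y` hold. -/
def Holds (X Y : Set (Fin I.n)) (v : Vec I) : Prop :=
  ∀ q : I.M.BJEquation, q.circuit = X → q.cocircuit = Y → equationForm I q v = 0

/-- A pair meeting in two elements contributes one equation, whose form the machine evaluates as an
inner product; `reduce_spec`, carried over by `reduce_map`, then passes to its kernel. Any other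
pair contributes no equation. -/
theorem isBasisOf_pairStep {vs : List (List Bool)} {P : Vec I → Prop} (h : IsBasisOf vs P)
    {c₁ c₂ d₁ d₂ : List (Finset (Fin I.n))} {X Y : Finset (Fin I.n)}
    (hr : I.circuits = c₁ ++ X :: c₂) (hr' : I.cocircuits = d₁ ++ Y :: d₂) :
    IsBasisOf (pairStep (rowsWord (rowBits c₁)).length (rowsWord (rowBits c₂)).length
      (rowsWord (rowBits d₁)).length (rowsWord (rowBits d₂)).length
      ((List.finRange I.n).map fun e => decide (e ∈ X))
      ((List.finRange I.n).map fun e => decide (e ∈ Y)) vs) fun v => P v ∧ Holds X Y v := by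
  obtain ⟨us, rfl, hli, hs⟩ := h
  unfold pairStep
  rw [count_andBits]
  split_ifs with hc
  · obtain ⟨a, b, hab, hXY⟩ := Finset.card_eq_two.1 hc
    have hX : I.M.IsCircuit (X : Set (Fin I.n)) := (I.mem_circuits X).1 (by rw [hr]; simp)
    have hY : I.M.IsCocircuit (Y : Set (Fin I.n)) := (I.mem_cocircuits Y).1 (by rw [hr']; simp)
    have hXY' : (X : Set (Fin I.n)) ∩ Y = {a, b} := by
      rw [← Finset.coe_inter, hXY, Finset.coe_pair]
    let q : I.M.BJEquation := ⟨X, Y, a, b, hX, hY, hab, hXY'⟩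
    -- The circuit and the cocircuit determine the equation up to exchanging `e` and `f`, and the
    -- form is symmetric in them.
    have hq : ∀ q' : I.M.BJEquation, q'.circuit = X → q'.cocircuit = Y →
        ∀ v, equationForm I q' v = equationForm I q v := by
      intro q' h1 h2 v
      have h3 := q'.inter_eq
      rw [h1, h2, hXY', Set.pair_eq_pair_iff] at h3
      simp only [equationForm, LinearMap.add_apply, LinearMap.comp_apply,
        BJEquation.linearForm_eq, h1, h2]
      rcases h3 with ⟨e1, e2⟩ | ⟨e1, e2⟩
      · rw [← e1, ← e2]
      · rw [← e1, ← e2]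
        simp only [q]
        ring
    have hdot : ∀ v : Vec I, dot (equationBits (rowsWord (rowBits c₁)).length
        (rowsWord (rowBits c₂)).length (rowsWord (rowBits d₁)).length
        (rowsWord (rowBits d₂)).length (andBits ((List.finRange I.n).map fun e => decide (e ∈ X))
        ((List.finRange I.n).map fun e => decide (e ∈ Y)))) (vecBits I v) =
        functionalTest (equationForm I q) v := by
      intro v
      have hz : andBits ((List.finRange I.n).map fun e => decide (e ∈ X))
          ((List.finRange I.n).map fun e => decide (e ∈ Y)) =
          (List.finRange I.n).map fun e => decide (e ∈ X) && decide (e ∈ Y) := by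
        rw [andBits, List.zipWith_map, List.zipWith_self]
      have hp : ∀ e, (decide (e ∈ X) && decide (e ∈ Y)) = true ↔ e = a ∨ e = b := by
        intro e
        rw [Bool.and_eq_true, decide_eq_true_eq, decide_eq_true_eq, ← Finset.mem_inter, hXY]
        simp
      rw [vecBits, dot_equationBits _ _ c₁ c₂ d₁ d₂ X Y hr hr' _ (by simp [andBits]), hz,
        dot_finRange hab _ hp, dot_finRange hab _ hp, ← decide_add_eq_one, ← decide_add_eq_one,
        functionalTest, decide_eq_decide, equationForm, LinearMap.add_apply, LinearMap.comp_apply,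
        BJEquation.linearForm_eq]
      refine Eq.congr_left ?_
      simp only [q, constantTerm, LinearMap.proj_apply]
      ring
    rw [reduce_map (vecBits I) hdot addBits_vecBits]
    obtain ⟨h1, h2, -, -⟩ := reduce_spec (equationForm I q) us hli
    refine ⟨_, rfl, h1, fun v => (h2 v).trans (and_congr (hs v) ⟨fun h q' e1 e2 => ?_, fun h => ?_⟩)⟩
    · rw [hq q' e1 e2, h]
    · exact h q rfl rfl
  -- An equation for this pair would force an intersection of two elements.
  · refine ⟨us, rfl, hli, fun v => (hs v).trans (and_iff_left fun q h1 h2 => absurd ?_ hc).symm⟩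
    have h3 := q.inter_eq
    rw [h1, h2, ← Finset.coe_inter, ← Finset.coe_pair, Finset.coe_inj] at h3
    rw [h3, Finset.card_pair q.ne]

/-- The property `P` is arbitrary so that it can absorb the equations already imposed. -/
theorem isBasisOf_innerVectors {P : Vec I → Prop} {c₁ c₂ : List (Finset (Fin I.n))}
    {X : Finset (Fin I.n)} (hr : I.circuits = c₁ ++ X :: c₂) (pre post : List (Finset (Fin I.n)))
    (hr' : I.cocircuits = pre ++ post) {vs : List (List Bool)} (h : IsBasisOf vs P) :
    IsBasisOf (innerVectors (rowsWord (rowBits c₁)).length (rowsWord (rowBits c₂)).length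
      ((List.finRange I.n).map fun e => decide (e ∈ X)) (rowBits pre) (rowBits post) vs)
      fun v => P v ∧ ∀ Y ∈ post, Holds (X : Set (Fin I.n)) (Y : Set (Fin I.n)) v := by
  induction post generalizing P pre vs with
  | nil => exact h.congr fun v => by simp
  | cons Y post ih =>
    have e : rowBits pre ++ [(List.finRange I.n).map fun e => decide (e ∈ Y)] =
        rowBits (pre ++ [Y]) := by simp [rowBits]
    rw [rowBits_cons, innerVectors, e]
    refine (ih (pre ++ [Y]) (by rw [hr', List.append_assoc]; rfl)
      (isBasisOf_pairStep h hr hr')).congr fun v => ?_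
    rw [and_assoc, List.forall_mem_cons]

theorem isBasisOf_outerVectors {P : Vec I → Prop} (pre post : List (Finset (Fin I.n)))
    (hr : I.circuits = pre ++ post) {vs : List (List Bool)} (h : IsBasisOf vs P) :
    IsBasisOf (outerVectors (rowBits I.cocircuits) (rowBits pre) (rowBits post) vs)
      fun v => P v ∧ ∀ X ∈ post, ∀ Y ∈ I.cocircuits,
        Holds (X : Set (Fin I.n)) (Y : Set (Fin I.n)) v := by
  induction post generalizing P pre vs with
  | nil => exact h.congr fun v => by simp
  | cons X post ih =>
    have e : rowBits pre ++ [(List.finRange I.n).map fun e => decide (e ∈ X)] =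
        rowBits (pre ++ [X]) := by simp [rowBits]
    rw [rowBits_cons, outerVectors, e]
    refine (ih (pre ++ [X]) (by rw [hr, List.append_assoc]; rfl)
      (isBasisOf_innerVectors hr [] I.cocircuits rfl h)).congr fun v => ?_
    rw [and_assoc, List.forall_mem_cons]

end Instance

/-! ### The initial basis and the answer -/

section LinearAlgebra

variable {V W : Type*} [AddCommGroup V] [Module (ZMod 2) V] [AddCommGroup W] [Module (ZMod 2) W]

theorem listSpan_map (f : V →ₗ[ZMod 2] W) (l : List V) :
    listSpan (l.map f) = (listSpan l).map f := by
  rw [listSpan, listSpan, Submodule.map_span]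
  exact congrArg _ (Set.ext fun x => by simp)

/-- A map injective on the span preserves its dimension; it need not be injective elsewhere. -/
theorem linearIndependent_get_map (f : V →ₗ[ZMod 2] W) {l : List V}
    (hl : LinearIndependent (ZMod 2) l.get) (h : ∀ x ∈ listSpan l, f x = 0 → x = 0) :
    LinearIndependent (ZMod 2) (l.map f).get := by
  have hi : Function.Injective (f.domRestrict (listSpan l)) := by
    rw [injective_iff_map_eq_zero]
    exact fun x hx => Subtype.ext (h x x.2 hx)
  rw [linearIndependent_get_iff] at hl ⊢
  rw [listSpan_map, List.length_map, ← hl, ← LinearMap.finrank_range_of_inj hi,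
    LinearMap.range_domRestrict]

theorem linearIndependent_get_reverse {l : List V} (hl : LinearIndependent (ZMod 2) l.get) :
    LinearIndependent (ZMod 2) l.reverse.get := by
  rw [linearIndependent_get_iff] at hl ⊢
  rw [listSpan_congr fun x => List.mem_reverse, hl, List.length_reverse]

theorem listSpan_single_eq_top {ι : Type*} [DecidableEq ι] {l : List ι} (h : ∀ i, i ∈ l) :
    listSpan (l.map fun i => (Pi.single i 1 : ι → ZMod 2)) = ⊤ := by
  have : Fintype ι := ⟨l.toFinset, fun i => List.mem_toFinset.2 (h i)⟩
  rw [eq_top_iff, ← (Pi.basisFun (ZMod 2) ι).span_eq]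
  refine Submodule.span_mono ?_
  rintro _ ⟨i, rfl⟩
  exact List.mem_map.2 ⟨i, h i, (Pi.basisFun_apply _ _ _).symm⟩

theorem linearIndependent_get_single {ι : Type*} [DecidableEq ι] {l : List ι} (hl : l.Nodup)
    (h : ∀ i, i ∈ l) :
    LinearIndependent (ZMod 2) (l.map fun i => (Pi.single i 1 : ι → ZMod 2)).get := by
  have : Fintype ι := ⟨l.toFinset, fun i => List.mem_toFinset.2 (h i)⟩
  rw [linearIndependent_get_iff, listSpan_single_eq_top h, finrank_top,
    Module.finrank_fintype_fun_eq_card, List.length_map, ← List.toFinset_card_of_nodup hl,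
    ← Finset.card_univ]
  congr 1
  ext i
  simp [h]

end LinearAlgebra

namespace Instance

open Matroid

variable {I : MatroidInstance}

/-- The variable of an element of a circuit in the list. -/
def circuitIndex (p : Finset (Fin I.n) × Fin I.n) (h : p ∈ incidences I.circuits) : I.M.BJVar :=
  .inl ⟨p.2, p.1, (I.mem_circuits p.1).1 (mem_incidences.1 h).1, (mem_incidences.1 h).2⟩

/-- The variable of an element of a cocircuit in the list. -/
def cocircuitIndex (p : Finset (Fin I.n) × Fin I.n) (h : p ∈ incidences I.cocircuits) :
    I.M.BJVar :=
  .inr ⟨p.2, p.1, (I.mem_cocircuits p.1).1 (mem_incidences.1 h).1, (mem_incidences.1 h).2⟩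

variable (I) in
/-- All allVars. -/
def allVars : List I.M.BJVar :=
  (incidences I.circuits).pmap circuitIndex (fun _ h => h) ++
    (incidences I.cocircuits).pmap cocircuitIndex fun _ h => h

theorem mem_allVars (i : I.M.BJVar) : i ∈ allVars I := by
  classical
  obtain ⟨e, C, hC, he⟩ | ⟨e, C, hC, he⟩ := i
  · refine List.mem_append_left _ (List.mem_pmap.2 ⟨(C.toFinset, e), mem_incidences.2 ⟨?_, ?_⟩, ?_⟩)
    · rw [I.mem_circuits, Set.coe_toFinset]; exact hC
    · exact Set.mem_toFinset.2 he
    · simp [circuitIndex]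
  · refine List.mem_append_right _ (List.mem_pmap.2 ⟨(C.toFinset, e), mem_incidences.2 ⟨?_, ?_⟩, ?_⟩)
    · rw [I.mem_cocircuits, Set.coe_toFinset]; exact hC
    · exact Set.mem_toFinset.2 he
    · simp [cocircuitIndex]

theorem nodup_allVars : (allVars I).Nodup := by
  refine List.Nodup.append
    (List.Nodup.pmap ?_ (nodup_incidences I.circuits_nodup))
    (List.Nodup.pmap ?_ (nodup_incidences I.cocircuits_nodup)) ?_
  · rintro ⟨C, e⟩ h ⟨D, f⟩ h' he
    simpa [circuitIndex, and_comm] using he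
  · rintro ⟨C, e⟩ h ⟨D, f⟩ h' he
    simpa [cocircuitIndex, and_comm] using he
  · intro i h h'
    obtain ⟨p, hp, rfl⟩ := List.mem_pmap.1 h
    obtain ⟨q, hq, he⟩ := List.mem_pmap.1 h'
    simp [circuitIndex, cocircuitIndex] at he

open Classical in
theorem vecBits_single_none : vecBits I (Pi.single none 1) = constantBits I.encode.length := by
  have h : forget I (Pi.single none 1) = 0 := by
    ext i; simp [forget]
  have h1 : I.M.circuitSigns (0 : I.M.BJVar → ZMod 2) = fun _ _ => 0 := by
    ext C e; simp [circuitSigns]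
  have h2 : I.M.cocircuitSigns (0 : I.M.BJVar → ZMod 2) = fun _ _ => 0 := by
    ext C e; simp [cocircuitSigns]
  rw [vecBits, h, h1, h2, valueBits_eq_replicate _ (by simp), valueBits_eq_replicate _ (by simp),
    length_encode, constantBits, ← List.replicate_succ, ← List.replicate_add]
  simp

open Classical in
theorem vecBits_single_circuit (p : Finset (Fin I.n) × Fin I.n) (h : p ∈ incidences I.circuits) :
    vecBits I (Pi.single (some (circuitIndex p h)) 1) =
      padBits 0 (valueBits I.circuits (indicator p)) ((rowsWord (rowBits I.cocircuits)).length + 1) := by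
  have h0 := mem_incidences.1 h
  have h1 : I.M.circuitSigns (forget I (Pi.single (some (circuitIndex p h)) 1)) = indicator p := by
    ext C e
    unfold circuitSigns indicator
    split_ifs with h2 h3 h3
    · obtain ⟨rfl, rfl⟩ := h3
      simp [forget, circuitIndex, LinearMap.funLeft_apply]
    · rw [forget, LinearMap.funLeft_apply, Pi.single_eq_of_ne]
      simp only [circuitIndex, ne_eq, Option.some.injEq, Sum.inl.injEq, CircuitVar.mk.injEq]
      tauto
    · obtain ⟨rfl, rfl⟩ := h3
      exact absurd (And.intro ((I.mem_circuits p.1).1 h0.1) h0.2) h2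
    · rfl
  have h2 : I.M.cocircuitSigns (forget I (Pi.single (some (circuitIndex p h)) 1)) =
      fun _ _ => 0 := by
    ext C e
    unfold cocircuitSigns
    split_ifs
    · rw [forget, LinearMap.funLeft_apply, Pi.single_eq_of_ne (by simp [circuitIndex])]
    · rfl
  rw [vecBits, h1, h2, valueBits_eq_replicate I.cocircuits (by simp), ← List.replicate_succ,
    Pi.single_eq_of_ne (by simp)]
  simp [padBits]

open Classical in
theorem vecBits_single_cocircuit (p : Finset (Fin I.n) × Fin I.n)
    (h : p ∈ incidences I.cocircuits) :
    vecBits I (Pi.single (some (cocircuitIndex p h)) 1) =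
      padBits ((rowsWord (rowBits I.circuits)).length + 1)
        (valueBits I.cocircuits (indicator p)) 0 := by
  have h0 := mem_incidences.1 h
  have h1 : I.M.cocircuitSigns (forget I (Pi.single (some (cocircuitIndex p h)) 1)) =
      indicator p := by
    ext C e
    unfold cocircuitSigns indicator
    split_ifs with h2 h3 h3
    · obtain ⟨rfl, rfl⟩ := h3
      simp [forget, cocircuitIndex, LinearMap.funLeft_apply]
    · rw [forget, LinearMap.funLeft_apply, Pi.single_eq_of_ne]
      simp only [cocircuitIndex, ne_eq, Option.some.injEq, Sum.inr.injEq, CocircuitVar.mk.injEq]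
      tauto
    · obtain ⟨rfl, rfl⟩ := h3
      exact absurd (And.intro ((I.mem_cocircuits p.1).1 h0.1) h0.2) h2
    · rfl
  have h2 : I.M.circuitSigns (forget I (Pi.single (some (cocircuitIndex p h)) 1)) =
      fun _ _ => 0 := by
    ext C e
    unfold circuitSigns
    split_ifs
    · rw [forget, LinearMap.funLeft_apply, Pi.single_eq_of_ne (by simp [cocircuitIndex])]
    · rfl
  rw [vecBits, h1, h2, valueBits_eq_replicate I.circuits (by simp), Pi.single_eq_of_ne (by simp)]
  simp [padBits, List.replicate_add]

/-- The bits 1 of the input word are the incidences, that is, the variables; with the constant term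
they index the standard basis. -/
theorem isBasisOf_initialVectors : IsBasisOf (I := I) (initialVectors I.encode) fun _ => True := by
  classical
  refine ⟨(((allVars I).map some).reverse ++ [none]).map fun i => Pi.single i 1, ?_, ?_, ?_⟩
  · rw [initialVectors, encode_eq, unitVectors_append, unitVectors, if_neg (by simp),
      unitVectors_eq, unitVectorsBetween_rowsWord _ I.circuits_nodup,
      unitVectorsBetween_rowsWord _ I.cocircuits_nodup, List.map_append, List.map_append,
      ← encode_eq, ← vecBits_single_none, allVars, List.map_append, List.map_pmap,
      List.map_pmap]
    congr 1
    rw [List.map_reverse, List.map_reverse, List.map_append, List.map_append, List.map_pmap,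
      List.map_pmap, List.map_pmap, List.map_pmap]
    simp only [vecBits_single_circuit, vecBits_single_cocircuit, List.pmap_eq_map,
      List.length_cons, Nat.zero_add]
  · refine linearIndependent_get_single ?_ ?_
    · refine List.Nodup.append (List.nodup_reverse.2
        (nodup_allVars.map (Option.some_injective _))) (by simp) (by simp)
    · rintro (_ | i)
      · simp
      · simp [mem_allVars]
  · intro v
    rw [listSpan_single_eq_top]
    · simp
    · rintro (_ | i)
      · simp
      · simp [mem_allVars]

theorem dot_constantBits (v : Vec I) :
    dot (constantBits I.encode.length) (vecBits I v) = functionalTest (constantTerm I) v := by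
  rw [constantBits, vecBits, dot, dot_replicate_false]
  simp only [functionalTest, constantTerm, Bool.true_and, Bool.xor_false, LinearMap.proj_apply]
  exact decide_eq_decide.2 Iff.rfl

/-- The lists are complete, so running over all pairs meets every equation. -/
theorem forall_holds_iff (v : Vec I) :
    (∀ X ∈ I.circuits, ∀ Y ∈ I.cocircuits, Holds (X : Set (Fin I.n)) (Y : Set (Fin I.n)) v) ↔
      ∀ q : I.M.BJEquation, equationForm I q v = 0 := by
  classical
  refine ⟨fun h q => ?_, fun h X _ Y _ q _ _ => h q⟩
  refine h q.circuit.toFinset ?_ q.cocircuit.toFinset ?_ q ?_ ?_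
  · rw [I.mem_circuits, Set.coe_toFinset]; exact q.isCircuit
  · rw [I.mem_cocircuits, Set.coe_toFinset]; exact q.isCocircuit
  · rw [Set.coe_toFinset]
  · rw [Set.coe_toFinset]

variable (I) in
/-- The vector with the given values and the constant term `c`. -/
def extend (c : ZMod 2) (x : I.M.BJVar → ZMod 2) : Vec I := fun i => i.elim c x

theorem forget_extend (c : ZMod 2) (x : I.M.BJVar → ZMod 2) : forget I (extend I c x) = x := rfl

theorem constantTerm_extend (c : ZMod 2) (x : I.M.BJVar → ZMod 2) :
    constantTerm I (extend I c x) = c := rfl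

theorem eq_zero_of_forget {v : Vec I} (h : constantTerm I v = 0) (h' : forget I v = 0) : v = 0 := by
  ext i
  cases i with
  | none => exact h
  | some i => exact congrFun h' i

variable (I) in
-- The span before the last round is the solution space of the homogenized system. Its part with
-- constant term 0 is the null space, and its vectors with constant term 1 are the solutions; the
-- last elimination yields a basis of the former and, if there is one, a vector of the latter.
theorem exists_answer : ∃ ans : Option I.M.AffineDescription,
    ((ans.isSome ↔ I.M.WeaklyOrientable) ∧ ∀ d, ans = some d → d.DescribesWeakOrientations) ∧
    answerWord I.encode (result (rowBits I.circuits) (rowBits I.cocircuits) I.encode) =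
      I.encodeAnswer ans := by
  obtain ⟨us, hus, hli, hspan⟩ := isBasisOf_outerVectors (I := I) [] I.circuits rfl
    isBasisOf_initialVectors
  simp only [true_and, forall_holds_iff] at hspan
  obtain ⟨h1, h2, h3, h4⟩ := reduce_spec (constantTerm I) us hli
  have hres : result (rowBits I.circuits) (rowBits I.cocircuits) I.encode =
      ((reduce (functionalTest (constantTerm I)) (· + ·) us).1.map (vecBits I),
        (reduce (functionalTest (constantTerm I)) (· + ·) us).2.map (vecBits I)) := by
    rw [result, show outerVectors (rowBits I.cocircuits) [] (rowBits I.circuits)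
      (initialVectors I.encode) = us.map (vecBits I) from hus]
    exact reduce_map (vecBits I) dot_constantBits addBits_vecBits us
  rw [hres]
  generalize reduce (functionalTest (constantTerm I)) (· + ·) us = r at *
  obtain ⟨acc, piv⟩ := r
  dsimp only at *
  have hform : ∀ (q : I.M.BJEquation) (v : Vec I),
      equationForm I q v = q.linearForm (forget I v) + constantTerm I v := fun _ _ => rfl
  cases piv with
  | none =>
    refine ⟨none, ⟨?_, by simp⟩, rfl⟩
    rw [weaklyOrientable_iff]
    refine ⟨by simp, fun ⟨x, hx⟩ => ?_⟩
    -- A solution with constant term 1 would lie in a span on which, for lack of a pivot, the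
    -- constant term vanishes.
    have hx' : extend I 1 x ∈ listSpan us := (hspan _).2 fun q => hx q
    exact absurd (h4 rfl _ hx') one_ne_zero
  | some p =>
    obtain ⟨hp, hp1⟩ := h3 p rfl
    rw [hspan] at hp
    -- The pivot has constant term 1, which turns each homogenized equation into the original one.
    have hsol : forget I p ∈ I.M.bjSolutions := fun q => by
      rw [← hp1, ← hform, hp q]
    -- The basis is reversed because emitting the vectors reverses their order.
    refine ⟨some ⟨forget I p, acc.reverse.map (forget I)⟩, ⟨?_, ?_⟩, ?_⟩
    · rw [weaklyOrientable_iff]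
      exact iff_of_true rfl ⟨_, hsol⟩
    · rintro _ ⟨⟩
      refine AffineDescription.describesWeakOrientations hsol ?_ ?_
      -- Forgetting the constant term is injective on vectors where it is zero.
      · refine linearIndependent_get_map _ (linearIndependent_get_reverse h1) fun v hv => ?_
        rw [listSpan_congr fun x => List.mem_reverse, h2] at hv
        exact eq_zero_of_forget hv.2
      · change listSpan (acc.reverse.map (forget I)) = _
        ext x
        rw [listSpan_map, listSpan_congr fun x => List.mem_reverse, mem_bjNullSpace_iff,
          Submodule.mem_map]
        constructor
        · rintro ⟨v, hv, rfl⟩ q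
          obtain ⟨hv, hv0⟩ := (h2 v).1 hv
          have := (hspan v).1 hv q
          rwa [hform, hv0, add_zero] at this
        · intro hx
          refine ⟨extend I 0 x, (h2 _).2 ⟨(hspan _).2 fun q => ?_, rfl⟩, rfl⟩
          rw [hform, forget_extend, constantTerm_extend, hx q, add_zero]
    · simp only [answerWord, Option.map_some, MatroidInstance.encodeAnswer, List.flatMap_cons,
        outputWord_vecBits, ← List.map_reverse, List.flatMap_map]

end Instance

/-! ### The machine and its polynomial time bound -/

theorem inputMem_toStore (w : List TapeSymbol) :
    (inputMem w).toStore = StackMachine.single Reg.init .inp w :=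
  Prod.ext rfl (funext fun k => by cases k <;> rfl)

theorem outputMem_toStore (w : List TapeSymbol) :
    (outputMem w).toStore = StackMachine.single Reg.init .out w :=
  Prod.ext rfl (funext fun k => by cases k <;> rfl)

open Polynomial in
/-- The time bound as a polynomial. -/
noncomputable def timePolynomial : ℕ[X] :=
  (X * (4 * X + 12) + 8 * X + 10) +
  ((X * (X * ((X + 1) * (12 * (X + 1) + 14) + 30 * (X + 1) + 30) + 10 * (X + 1) + 10) + 1) +
  (((X + 1) * (12 * (X + 1) + 14) + 6 * X + 8) + ((X + 1) * (6 * X + 9) + 15 * X + 20))) + 1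

theorem eval_timePolynomial (W : ℕ) : timePolynomial.eval W = timeBound W + 1 := by
  simp [timePolynomial, timeBound]

theorem outputs (I : MatroidInstance) :
    Nonempty (Turing.TM2OutputsInTime (mainProg.machine .inp .out Reg.init) I.encode
      (some (answerWord I.encode (result (rowBits I.circuits) (rowBits I.cocircuits) I.encode)))
      (timeBound I.encode.length + 1)) := by
  have h := go_mainProg I.n (rowBits I.circuits) (rowBits I.cocircuits) I.encode
    Instance.encode_eq (length_of_mem_rowBits _) (length_of_mem_rowBits _)
  rw [Go, inputMem_toStore, outputMem_toStore] at h
  exact h.outputs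

end BlandJensenMachine

open BlandJensenMachine in
/-- There is an algorithm (a multi-stack Turing machine, which halts within a number of steps that
is polynomial in the length of its input word) that decides, for a matroid given by the lists of
its circuits and cocircuits, whether it is weakly orientable, and if it is, outputs a particular
solution and a null space basis that describe all its weak orientations. -/
theorem mainTheorem8 :
    ∃ answer : (I : MatroidInstance) → Option I.M.AffineDescription,
      Nonempty (Turing.TM2ComputableInPolyTime MatroidInstance.encode
        (id : List TapeSymbol → List TapeSymbol) (fun I => I.encodeAnswer (answer I))) ∧
      ∀ I : MatroidInstance,
        ((answer I).isSome ↔ I.M.WeaklyOrientable) ∧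
        ∀ d, answer I = some d → d.DescribesWeakOrientations := by
  -- Only the answer is chosen instance by instance; the machine is the same for all of them.
  choose answer h using Instance.exists_answer
  refine ⟨answer, ⟨?_⟩, fun I => (h I).1⟩
  refine
    { tm := mainProg.machine .inp .out Reg.init
      inputAlphabet := Equiv.refl _
      outputAlphabet := Equiv.refl _
      time := timePolynomial
      outputsFun := fun I => ?_ }
  have ho := (outputs I).some
  rw [(h I).2, ← eval_timePolynomial] at ho
  -- The tape alphabets are identified with `TapeSymbol` by the identity, so translating words
  -- changes nothing.
  have e : ∀ l : List TapeSymbol, l.map (Equiv.refl TapeSymbol).invFun = l := List.map_id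
  exact (congrArg₂ (fun u v => Turing.TM2OutputsInTime (mainProg.machine .inp .out Reg.init) u
    (some v) (timePolynomial.eval I.encode.length)) (e _) (e _)).mpr ho
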